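/- Let $\mathbb{K}$ be a field of characteristic zero. All operads are symmetric operads in graded $\mathbb{K}$-vector spaces with the Koszul sign rule, and morphisms of graded operads and graded $\mathbb{S}$-modules preserve degrees. Let $\mathrm{Lie}$ be the operad of Lie algebras, generated by a skew-symmetric bracket $\{1,2\}$ of degree $0$ subject to the Jacobi identity. Let $\mathcal{O}$ be the operad generated by unary operations $d_1,d_2,\dots$ of degree $1$ and a commutative binary product $1\otimes 1$ of degree $0$, subject to the associativity of the product and to the derivation rules $d_n(1\otimes 1)=d_n\otimes 1+1\otimes d_n$ for $n\ge 1$. Besides its degree, $\mathcal{O}$ carries a second grading that is additive under composition, the weight, with $w(d_n)=n$ and $w(1\otimes 1)=-1$. Let $\mathcal{D}_\infty\subset\mathcal{O}$ be the suboperad of weight $0$, graded by degree, and let $\mathcal{D}^1_\infty$ be its part of degree $1$. Let $\mathrm{Lie}\otimes\mathcal{D}_\infty$ be the aritywise tensor product operad. Then: 1. $(\mathrm{Lie}\otimes\mathcal{D}^1_\infty)(1)=0$, and for every $n\ge 2$ the normal higher derived brackets $$\{d_{n-1}(l_1),l_2,\dots,l_n\}:=\sigma\cdot\Big(\{\{\{1,2\},\dots\},n\}\otimes(d_{n-1}\otimes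 1\otimes\cdots\otimes 1)\Big),\qquad l_i=\sigma(i),\ \sigma\in S_n,$$ form a basis of $(\mathrm{Lie}\otimes\mathcal{D}^1_\infty)(n)$. 2. $\mathrm{Lie}\otimes\mathcal{D}_\infty$ is the free graded operad over its sub-$\mathbb{S}$-module $\mathrm{Lie}\otimes\mathcal{D}^1_\infty$, that is, $\mathcal{T}(\mathrm{Lie}\otimes\mathcal{D}^1_\infty)\cong\mathrm{Lie}\otimes\mathcal{D}_\infty$ via the canonical morphism: every morphism of graded $\mathbb{S}$-modules from $\mathrm{Lie}\otimes\mathcal{D}^1_\infty$ to a graded operad $\mathcal{Q}$ extends uniquely to a morphism of graded operads $\mathrm{Lie}\otimes\mathcal{D}_\infty\to\mathcal{Q}$. 3. For every $n\ge 1$, $$\dim(\mathrm{Lie}\otimes\mathcal{D}_\infty)(n)=n!\,s(n)=(n-1)!\,\dim\mathcal{D}_\infty(n),$$ where $s(n)$ is the small Schröder number ($s(1),s(2),s(3),s(4),\dots=1,1,3,11,\dots$), the number of planar rooted trees with $n$ leaves all of whose internal vertices have at least two children. -/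

import Mathlib

open scoped TensorProduct

universe u v v' v'' w

noncomputable section

namespace HigherDerived

/-! ### Graded symmetric operads, in terms of partial compositions

`obj n g` is the component of arity `n` and degree `g`, where the degrees are taken in an additive
group `Γ`, with a homomorphism `par : Γ →+ ℤ` that governs the Koszul signs. Arities and degrees
that have to match are compared by hypotheses `m + n = k + 1` and `a + b = c`. Inputs are numbered
from `0`. -/

/-- The position, among the `k = m + n - 1` inputs of `μ ∘ᵢ ν`, of the input `j ≠ i` of `μ`. -/
def outerPos {m n k : ℕ} (h : m + n = k + 1) (i j : Fin m) (hne : j ≠ i) : Fin k :=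
  ⟨if j.val < i.val then j.val else j.val + n - 1, by
    have := i.isLt
    have := j.isLt
    have : j.val ≠ i.val := fun e => hne (Fin.ext e)
    split <;> omega⟩

/-- The position, among the `k = m + n - 1` inputs of `μ ∘ᵢ ν`, of the input `l` of `ν`. -/
def innerPos {m n k : ℕ} (h : m + n = k + 1) (i : Fin m) (l : Fin n) : Fin k :=
  ⟨i.val + l.val, by
    have := i.isLt
    have := l.isLt
    omega⟩

/-- `ρ` is the block permutation built from `σ` and `τ`: it is the permutation that relabels
`μ ∘ᵢ ν` when the inputs of `μ` are relabelled by `σ` and those of `ν` by `τ`. -/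
def IsBlockPerm {m n k : ℕ} (h : m + n = k + 1) (i : Fin m)
    (σ : Equiv.Perm (Fin m)) (τ : Equiv.Perm (Fin n)) (ρ : Equiv.Perm (Fin k)) : Prop :=
  (∀ (j : Fin m) (hne : j ≠ i),
      ρ (outerPos h i j hne) = outerPos h (σ i) (σ j) (fun e => hne (σ.injective e))) ∧
    ∀ l : Fin n, ρ (innerPos h i l) = innerPos h (σ i) (τ l)

/-- A `Γ`-graded `𝕊`-module. The left action `act σ` relabels the input `j` as `σ j`. -/
structure GradedSModule (K : Type u) [Field K] (Γ : Type w) where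
  obj : ℕ → Γ → Type v
  [addCommGroup : ∀ n g, AddCommGroup (obj n g)]
  [module : ∀ n g, Module K (obj n g)]
  act : ∀ {n g}, Representation K (Equiv.Perm (Fin n)) (obj n g)

attribute [instance] GradedSModule.addCommGroup GradedSModule.module

/-- A `Γ`-graded symmetric operad with Koszul signs given by `par`. `comp h e i x y` is the partial
composition `x ∘ᵢ y`. -/
structure GradedOperad (K : Type u) [Field K] (Γ : Type w) [AddCommGroup Γ] (par : Γ →+ ℤ) extends
    GradedSModule.{u, v, w} K Γ where
  one : obj 1 0
  comp : ∀ {m n k : ℕ} {a b c : Γ}, m + n = k + 1 → a + b = c → Fin m →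
    (obj m a →ₗ[K] obj n b →ₗ[K] obj k c)
  one_comp : ∀ {n : ℕ} {b : Γ} (h : 1 + n = n + 1) (e : 0 + b = b) (y : obj n b),
    comp h e 0 one y = y
  comp_one : ∀ {m : ℕ} {a : Γ} (h : m + 1 = m + 1) (e : a + 0 = a) (i : Fin m) (x : obj m a),
    comp h e i x one = x
  act_comp : ∀ {m n k : ℕ} {a b c : Γ} (h : m + n = k + 1) (e : a + b = c) (i : Fin m)
    (σ : Equiv.Perm (Fin m)) (τ : Equiv.Perm (Fin n)) (ρ : Equiv.Perm (Fin k)),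
    IsBlockPerm h i σ τ ρ → ∀ (x : obj m a) (y : obj n b),
      comp h e (σ i) (act σ x) (act τ y) = act ρ (comp h e i x y)
  assoc : ∀ {l m n p q r : ℕ} {a b c d d' f : Γ}
    (h₁ : l + m = p + 1) (h₂ : p + n = r + 1) (h₃ : m + n = q + 1) (h₄ : l + q = r + 1)
    (e₁ : a + b = d) (e₂ : d + c = f) (e₃ : b + c = d') (e₄ : a + d' = f)
    (i : Fin l) (j : Fin m) (s : Fin p), s.val = i.val + j.val →
    ∀ (x : obj l a) (y : obj m b) (z : obj n c),
      comp h₂ e₂ s (comp h₁ e₁ i x y) z = comp h₄ e₄ i x (comp h₃ e₃ j y z)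
  parallel : ∀ {l m n p q r : ℕ} {a b c d d' f : Γ}
    (h₁ : l + m = p + 1) (h₂ : p + n = r + 1) (h₃ : l + n = q + 1) (h₄ : q + m = r + 1)
    (e₁ : a + b = d) (e₂ : d + c = f) (e₃ : a + c = d') (e₄ : d' + b = f)
    (i j : Fin l) (s : Fin p) (t : Fin q), i < j → s.val + 1 = j.val + m → t.val = i.val →
    ∀ (x : obj l a) (y : obj m b) (z : obj n c),
      comp h₂ e₂ s (comp h₁ e₁ i x y) z =
        (par b * par c).negOnePow • comp h₄ e₄ t (comp h₃ e₃ j x z) y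

/-- An operad in vector spaces, with no grading. -/
abbrev Operad (K : Type u) [Field K] := GradedOperad.{u, v, 0} K Unit 0

/-- Morphisms of graded `𝕊`-modules. -/
structure SHom {K : Type u} [Field K] {Γ : Type w} (E : GradedSModule.{u, v, w} K Γ)
    (F : GradedSModule.{u, v', w} K Γ) where
  map : ∀ {n : ℕ} {g : Γ}, E.obj n g →ₗ[K] F.obj n g
  map_act : ∀ {n : ℕ} {g : Γ} (σ : Equiv.Perm (Fin n)) (x : E.obj n g),
    map (E.act σ x) = F.act σ (map x)

/-- Morphisms of graded operads. -/
structure OperadHom {K : Type u} [Field K] {Γ : Type w} [AddCommGroup Γ] {par : Γ →+ ℤ}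
    (P : GradedOperad.{u, v, w} K Γ par) (Q : GradedOperad.{u, v', w} K Γ par) extends
    SHom P.toGradedSModule Q.toGradedSModule where
  map_one : map P.one = Q.one
  map_comp : ∀ {m n k : ℕ} {a b c : Γ} (h : m + n = k + 1) (e : a + b = c) (i : Fin m)
    (x : P.obj m a) (y : P.obj n b),
    map (P.comp h e i x y) = Q.comp h e i (map x) (map y)

/-- `P` is the free operad over the graded `𝕊`-module `E`, along `ι : E → P`: every morphism of
graded `𝕊`-modules from `E` to a graded operad `Q` extends along `ι` to exactly one morphism of
operads `P → Q`. -/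
def IsFreeOperad {K : Type u} [Field K] {Γ : Type w} [AddCommGroup Γ] {par : Γ →+ ℤ}
    (E : GradedSModule.{u, v, w} K Γ) (P : GradedOperad.{u, v', w} K Γ par)
    (ι : SHom E P.toGradedSModule) : Prop :=
  ∀ (Q : GradedOperad.{u, v'', w} K Γ par) (f : SHom E Q.toGradedSModule),
    ∃! F : OperadHom P Q, ∀ (n : ℕ) (g : Γ) (x : E.obj n g), F.map (ι.map x) = f.map x

/-- The part of degree `d` of `E.obj n g`: everything if `g = d`, and zero otherwise. -/
def degreeSubmodule {K : Type u} [Field K] {Γ : Type w} (E : GradedSModule.{u, v, w} K Γ) (d : Γ)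
    (n : ℕ) (g : Γ) : Submodule K (E.obj n g) where
  carrier := {x | g ≠ d → x = 0}
  zero_mem' := fun _ => rfl
  add_mem' := fun hx hy hg => by rw [hx hg, hy hg, add_zero]
  smul_mem' := fun c x hx hg => by rw [hx hg, smul_zero]

/-- The sub-`𝕊`-module of `E` that is its part of degree `d`. -/
def degreePart {K : Type u} [Field K] {Γ : Type w} (E : GradedSModule.{u, v, w} K Γ) (d : Γ) :
    GradedSModule.{u, v, w} K Γ where
  obj n g := degreeSubmodule E d n g
  act {n g} :=
    { toFun := fun σ => (E.act σ).restrict (p := degreeSubmodule E d n g)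
        (q := degreeSubmodule E d n g) (fun x hx hg => by rw [hx hg, _root_.map_zero])
      map_one' := by ext x; simp [LinearMap.restrict_apply]
      map_mul' := fun σ τ => by ext x; rw [map_mul]; rfl }

/-- The inclusion of the part of degree `d`. -/
def degreeIncl {K : Type u} [Field K] {Γ : Type w} (E : GradedSModule.{u, v, w} K Γ) (d : Γ) :
    SHom (degreePart E d) E where
  map {n g} := (degreeSubmodule E d n g).subtype
  map_act _ _ := rfl

/-! ### Operads given by generators and relations -/

/-- Formal composites of the generators `G`. -/
inductive Mon {Γ : Type w} [AddCommGroup Γ] (G : ℕ → Γ → Type w) : ℕ → Γ → Type w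
  | gen {n : ℕ} {g : Γ} (x : G n g) : Mon G n g
  | one : Mon G 1 0
  | act {n : ℕ} {g : Γ} (σ : Equiv.Perm (Fin n)) (x : Mon G n g) : Mon G n g
  | comp {m n k : ℕ} {a b c : Γ} (h : m + n = k + 1) (e : a + b = c) (i : Fin m)
      (x : Mon G m a) (y : Mon G n b) : Mon G k c

/-- Linear combinations of formal composites, of fixed arity and degree. -/
abbrev Lin (K : Type u) [Field K] {Γ : Type w} [AddCommGroup Γ] (G : ℕ → Γ → Type w)
    (n : ℕ) (g : Γ) : Type (max u w) :=
  Mon G n g →₀ K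

section Presentation

variable {K : Type u} [Field K] {Γ : Type w} [AddCommGroup Γ] {G : ℕ → Γ → Type w}

/-- A formal composite as a linear combination. -/
abbrev mon {n : ℕ} {g : Γ} (x : Mon G n g) : Lin K G n g := Finsupp.single x 1

/-- A generator as a linear combination. -/
abbrev gen {n : ℕ} {g : Γ} (x : G n g) : Lin K G n g := mon (Mon.gen x)

/-- The linear extension of the formal relabelling. -/
def linAct {n : ℕ} {g : Γ} (σ : Equiv.Perm (Fin n)) : Lin K G n g →ₗ[K] Lin K G n g :=
  Finsupp.lmapDomain K K (Mon.act σ)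

/-- The bilinear extension of the formal partial composition. -/
def linComp {m n k : ℕ} {a b c : Γ} (h : m + n = k + 1) (e : a + b = c) (i : Fin m) :
    Lin K G m a →ₗ[K] Lin K G n b →ₗ[K] Lin K G k c :=
  Finsupp.linearCombination K fun x => Finsupp.lmapDomain K K (Mon.comp h e i x)

/-- The ideal generated by the axioms of a graded operad with signs `par` and by the elements
that satisfy `R`. -/
inductive InIdeal (par : Γ →+ ℤ) (R : ∀ {n : ℕ} {g : Γ}, Lin K G n g → Prop) :
    ∀ {n : ℕ} {g : Γ}, Lin K G n g → Prop
  | rel {n : ℕ} {g : Γ} {x : Lin K G n g} : R x → InIdeal par R x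
  | zero {n : ℕ} {g : Γ} : InIdeal par R (0 : Lin K G n g)
  | add {n : ℕ} {g : Γ} {x y : Lin K G n g} :
      InIdeal par R x → InIdeal par R y → InIdeal par R (x + y)
  | smul {n : ℕ} {g : Γ} (c : K) {x : Lin K G n g} : InIdeal par R x → InIdeal par R (c • x)
  | act {n : ℕ} {g : Γ} (σ : Equiv.Perm (Fin n)) {x : Lin K G n g} :
      InIdeal par R x → InIdeal par R (linAct σ x)
  | comp_left {m n k : ℕ} {a b c : Γ} (h : m + n = k + 1) (e : a + b = c) (i : Fin m)
      {x : Lin K G m a} (y : Lin K G n b) : InIdeal par R x → InIdeal par R (linComp h e i x y)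
  | comp_right {m n k : ℕ} {a b c : Γ} (h : m + n = k + 1) (e : a + b = c) (i : Fin m)
      (x : Lin K G m a) {y : Lin K G n b} : InIdeal par R y → InIdeal par R (linComp h e i x y)
  | act_one {n : ℕ} {g : Γ} (x : Mon G n g) : InIdeal par R (mon (.act 1 x) - mon x)
  | act_mul {n : ℕ} {g : Γ} (σ τ : Equiv.Perm (Fin n)) (x : Mon G n g) :
      InIdeal par R (mon (.act (σ * τ) x) - mon (.act σ (.act τ x)))
  | one_comp {n : ℕ} {b : Γ} (h : 1 + n = n + 1) (e : 0 + b = b) (y : Mon G n b) :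
      InIdeal par R (mon (.comp h e 0 .one y) - mon y)
  | comp_one {m : ℕ} {a : Γ} (h : m + 1 = m + 1) (e : a + 0 = a) (i : Fin m) (x : Mon G m a) :
      InIdeal par R (mon (.comp h e i x .one) - mon x)
  | act_comp {m n k : ℕ} {a b c : Γ} (h : m + n = k + 1) (e : a + b = c) (i : Fin m)
      (σ : Equiv.Perm (Fin m)) (τ : Equiv.Perm (Fin n)) (ρ : Equiv.Perm (Fin k)) :
      IsBlockPerm h i σ τ ρ → ∀ (x : Mon G m a) (y : Mon G n b),
        InIdeal par R (mon (.comp h e (σ i) (.act σ x) (.act τ y)) - mon (.act ρ (.comp h e i x y)))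
  | assoc {l m n p q r : ℕ} {a b c d d' f : Γ}
      (h₁ : l + m = p + 1) (h₂ : p + n = r + 1) (h₃ : m + n = q + 1) (h₄ : l + q = r + 1)
      (e₁ : a + b = d) (e₂ : d + c = f) (e₃ : b + c = d') (e₄ : a + d' = f)
      (i : Fin l) (j : Fin m) (s : Fin p) : s.val = i.val + j.val →
      ∀ (x : Mon G l a) (y : Mon G m b) (z : Mon G n c),
        InIdeal par R (mon (.comp h₂ e₂ s (.comp h₁ e₁ i x y) z) -
          mon (.comp h₄ e₄ i x (.comp h₃ e₃ j y z)))
  | parallel {l m n p q r : ℕ} {a b c d d' f : Γ}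
      (h₁ : l + m = p + 1) (h₂ : p + n = r + 1) (h₃ : l + n = q + 1) (h₄ : q + m = r + 1)
      (e₁ : a + b = d) (e₂ : d + c = f) (e₃ : a + c = d') (e₄ : d' + b = f)
      (i j : Fin l) (s : Fin p) (t : Fin q) : i < j → s.val + 1 = j.val + m → t.val = i.val →
      ∀ (x : Mon G l a) (y : Mon G m b) (z : Mon G n c),
        InIdeal par R (mon (.comp h₂ e₂ s (.comp h₁ e₁ i x y) z) -
          (par b * par c).negOnePow • mon (.comp h₄ e₄ t (.comp h₃ e₃ j x z) y))

/-- The ideal as a family of subspaces. -/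
def ideal (par : Γ →+ ℤ) (R : ∀ {n : ℕ} {g : Γ}, Lin K G n g → Prop) (n : ℕ) (g : Γ) :
    Submodule K (Lin K G n g) where
  carrier := {x | InIdeal par R x}
  zero_mem' := .zero
  add_mem' := .add
  smul_mem' c _ hx := .smul c hx

theorem linAct_mon {n : ℕ} {g : Γ} (σ : Equiv.Perm (Fin n)) (x : Mon G n g) :
    linAct σ (mon x : Lin K G n g) = mon (.act σ x) := by
  simp [linAct]

theorem linComp_mon {m n k : ℕ} {a b c : Γ} (h : m + n = k + 1) (e : a + b = c) (i : Fin m)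
    (x : Mon G m a) (y : Mon G n b) :
    linComp h e i (mon x : Lin K G m a) (mon y : Lin K G n b) = mon (.comp h e i x y) := by
  simp [linComp]

/-- The relabelling on the quotient by the ideal. -/
def quotAct (par : Γ →+ ℤ) (R : ∀ {n : ℕ} {g : Γ}, Lin K G n g → Prop) {n : ℕ} {g : Γ}
    (σ : Equiv.Perm (Fin n)) :
    (Lin K G n g ⧸ ideal par R n g) →ₗ[K] (Lin K G n g ⧸ ideal par R n g) :=
  Submodule.mapQ _ _ (linAct σ) fun _ hx => InIdeal.act σ hx

/-- The partial composition on the quotient by the ideal. -/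
def quotComp (par : Γ →+ ℤ) (R : ∀ {n : ℕ} {g : Γ}, Lin K G n g → Prop)
    {m n k : ℕ} {a b c : Γ} (h : m + n = k + 1) (e : a + b = c) (i : Fin m) :
    (Lin K G m a ⧸ ideal par R m a) →ₗ[K] (Lin K G n b ⧸ ideal par R n b) →ₗ[K]
      (Lin K G k c ⧸ ideal par R k c) :=
  LinearMap.liftQ₂ _ _ ((linComp h e i).compr₂ (ideal par R k c).mkQ)
    (fun x hx => by
      refine LinearMap.ext fun y => ?_
      exact (Submodule.Quotient.mk_eq_zero _).2 (InIdeal.comp_left h e i y hx))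
    (fun y hy => by
      refine LinearMap.ext fun x => ?_
      exact (Submodule.Quotient.mk_eq_zero _).2 (InIdeal.comp_right h e i x hy))

theorem quot_hom_ext {par : Γ →+ ℤ} {R : ∀ {n : ℕ} {g : Γ}, Lin K G n g → Prop} {n : ℕ} {g : Γ}
    {M : Type*} [AddCommGroup M] [Module K M] {f f' : (Lin K G n g ⧸ ideal par R n g) →ₗ[K] M}
    (hf : ∀ x : Mon G n g, f (Submodule.Quotient.mk (mon x)) = f' (Submodule.Quotient.mk (mon x))) :
    f = f' := by
  refine Submodule.linearMap_qext _ (Finsupp.lhom_ext' fun x => LinearMap.ext_ring ?_)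
  exact hf x

theorem quot_induction {par : Γ →+ ℤ} {R : ∀ {n : ℕ} {g : Γ}, Lin K G n g → Prop} {n : ℕ} {g : Γ}
    {p : (Lin K G n g ⧸ ideal par R n g) → Prop} (zero : p 0)
    (add : ∀ x y, p x → p y → p (x + y)) (smul : ∀ (r : K) x, p x → p (r • x))
    (mon : ∀ x : Mon G n g, p (Submodule.Quotient.mk (mon x)))
    (x : Lin K G n g ⧸ ideal par R n g) : p x := by
  obtain ⟨x, rfl⟩ := Submodule.Quotient.mk_surjective _ x
  induction x using Finsupp.induction_linear with
  | zero => exact zero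
  | add x y hx hy => exact add _ _ hx hy
  | single x r =>
    have := smul r _ (mon x)
    rwa [← Submodule.Quotient.mk_smul, Finsupp.smul_single, smul_eq_mul, mul_one] at this

theorem quotAct_mon {par : Γ →+ ℤ} {R : ∀ {n : ℕ} {g : Γ}, Lin K G n g → Prop} {n : ℕ} {g : Γ}
    (σ : Equiv.Perm (Fin n)) (x : Mon G n g) :
    quotAct par R σ (Submodule.Quotient.mk (mon x)) = Submodule.Quotient.mk (mon (.act σ x)) := by
  rw [← linAct_mon]; rfl

theorem quotComp_mon {par : Γ →+ ℤ} {R : ∀ {n : ℕ} {g : Γ}, Lin K G n g → Prop}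
    {m n k : ℕ} {a b c : Γ} (h : m + n = k + 1) (e : a + b = c) (i : Fin m)
    (x : Mon G m a) (y : Mon G n b) :
    quotComp par R h e i (Submodule.Quotient.mk (mon x)) (Submodule.Quotient.mk (mon y)) =
      Submodule.Quotient.mk (mon (.comp h e i x y)) := by
  rw [← linComp_mon]; rfl

/-- The graded operad with generators `G` and relations `R`. -/
def presented (K : Type u) [Field K] (G : ℕ → Γ → Type w) (par : Γ →+ ℤ)
    (R : ∀ {n : ℕ} {g : Γ}, Lin K G n g → Prop) : GradedOperad.{u, max u w, w} K Γ par where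
  obj n g := Lin K G n g ⧸ ideal par R n g
  act :=
    { toFun := quotAct par R
      map_one' := quot_hom_ext fun x => by
        rw [quotAct_mon]
        exact (Submodule.Quotient.eq _).2 (InIdeal.act_one x)
      map_mul' := fun σ τ => quot_hom_ext fun x => by
        rw [Module.End.mul_apply, quotAct_mon, quotAct_mon, quotAct_mon]
        exact (Submodule.Quotient.eq _).2 (InIdeal.act_mul σ τ x) }
  one := Submodule.Quotient.mk (mon .one)
  comp h e i := quotComp par R h e i
  one_comp {n b} h e y := by
    refine LinearMap.congr_fun (f := quotComp par R h e 0 _) (g := LinearMap.id)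
      (quot_hom_ext fun y => ?_) y
    rw [quotComp_mon]
    exact (Submodule.Quotient.eq _).2 (InIdeal.one_comp h e y)
  comp_one {m a} h e i x := by
    refine LinearMap.congr_fun (f := (quotComp par R h e i).flip (Submodule.Quotient.mk (mon .one)))
      (g := LinearMap.id) (quot_hom_ext fun x => ?_) x
    rw [LinearMap.flip_apply, quotComp_mon]
    exact (Submodule.Quotient.eq _).2 (InIdeal.comp_one h e i x)
  act_comp {m n k a b c} h e i σ τ ρ hρ x y := by
    refine LinearMap.congr_fun₂
      (f := (quotComp par R h e (σ i)).compl₁₂ (quotAct par R σ) (quotAct par R τ))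
      (g := (quotComp par R h e i).compr₂ (quotAct par R ρ))
      (quot_hom_ext fun x => quot_hom_ext fun y => ?_) x y
    simp only [LinearMap.compl₁₂_apply, LinearMap.compr₂_apply, quotAct_mon, quotComp_mon]
    exact (Submodule.Quotient.eq _).2 (InIdeal.act_comp h e i σ τ ρ hρ x y)
  assoc {l m n p q r a b c d d' f} h₁ h₂ h₃ h₄ e₁ e₂ e₃ e₄ i j s hs x y z := by
    induction x using quot_induction with
    | zero => simp only [_root_.map_zero, LinearMap.zero_apply]
    | add x₁ x₂ hx₁ hx₂ => simp only [_root_.map_add, LinearMap.add_apply, hx₁, hx₂]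
    | smul r x hx => simp only [_root_.map_smul, LinearMap.smul_apply, hx]
    | mon x =>
    induction y using quot_induction with
    | zero => simp only [_root_.map_zero, LinearMap.zero_apply]
    | add x₁ x₂ hx₁ hx₂ => simp only [_root_.map_add, LinearMap.add_apply, hx₁, hx₂]
    | smul r x hx => simp only [_root_.map_smul, LinearMap.smul_apply, hx]
    | mon y =>
    induction z using quot_induction with
    | zero => simp only [_root_.map_zero]
    | add x₁ x₂ hx₁ hx₂ => simp only [_root_.map_add, hx₁, hx₂]
    | smul r x hx => simp only [_root_.map_smul, hx]
    | mon z =>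
    simp only [quotComp_mon]
    exact (Submodule.Quotient.eq _).2 (InIdeal.assoc h₁ h₂ h₃ h₄ e₁ e₂ e₃ e₄ i j s hs x y z)
  parallel {l m n p q r a b c d d' f} h₁ h₂ h₃ h₄ e₁ e₂ e₃ e₄ i j s t hij hs ht x y z := by
    induction x using quot_induction with
    | zero => simp only [_root_.map_zero, LinearMap.zero_apply, smul_zero]
    | add x₁ x₂ hx₁ hx₂ => simp only [_root_.map_add, LinearMap.add_apply, smul_add, hx₁, hx₂]
    | smul r x hx => simp only [_root_.map_smul, LinearMap.smul_apply, hx, smul_comm r]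
    | mon x =>
    induction y using quot_induction with
    | zero => simp only [_root_.map_zero, LinearMap.zero_apply, smul_zero]
    | add x₁ x₂ hx₁ hx₂ => simp only [_root_.map_add, LinearMap.add_apply, smul_add, hx₁, hx₂]
    | smul r x hx => simp only [_root_.map_smul, LinearMap.smul_apply, hx, smul_comm r]
    | mon y =>
    induction z using quot_induction with
    | zero => simp only [_root_.map_zero, LinearMap.zero_apply, smul_zero]
    | add x₁ x₂ hx₁ hx₂ => simp only [_root_.map_add, LinearMap.add_apply, smul_add, hx₁, hx₂]
    | smul r x hx => simp only [_root_.map_smul, LinearMap.smul_apply, hx, smul_comm r]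
    | mon z =>
    simp only [quotComp_mon]
    exact (Submodule.Quotient.eq _).2
      (InIdeal.parallel h₁ h₂ h₃ h₄ e₁ e₂ e₃ e₄ i j s t hij hs ht x y z)

/-- The class of a generator in the operad given by generators and relations. -/
def presentedGen (K : Type u) [Field K] {G : ℕ → Γ → Type w} (par : Γ →+ ℤ)
    (R : ∀ {n : ℕ} {g : Γ}, Lin K G n g → Prop) {n : ℕ} {g : Γ} (x : G n g) :
    (presented K G par R).obj n g :=
  Submodule.Quotient.mk (gen x)

end Presentation

/-! ### The operad `Lie` -/

/-- The generator of `Lie`: a binary bracket. -/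
inductive LieGen : ℕ → Unit → Type
  | bracket : LieGen 2 ()

/-- The relations of `Lie`: skew-symmetry `{1,2} + {2,1} = 0`, and the Jacobi identity
`{{1,2},3} + {{2,3},1} + {{3,1},2} = 0`. -/
inductive LieRel (K : Type u) [Field K] : ∀ {n : ℕ} {g : Unit}, Lin K LieGen n g → Prop
  | skew : LieRel K (gen .bracket + linAct (Equiv.swap 0 1) (gen .bracket))
  | jacobi (h : 2 + 2 = 3 + 1) (e : () + () = ()) (x : Lin K LieGen 3 ()) :
      x = linComp h e 0 (gen .bracket) (gen .bracket) →
      LieRel K (x + linAct (finRotate 3) x + linAct (finRotate 3) (linAct (finRotate 3) x))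

/-- The operad of Lie algebras. -/
def Lie (K : Type u) [Field K] : Operad.{u, u} K := presented K LieGen 0 (LieRel K)

/-- The left-normed bracket `{{{1,2},...},n+1}`. -/
def leftNormed (K : Type u) [Field K] : ∀ n : ℕ, (Lie K).obj (n + 1) ()
  | 0 => (Lie K).one
  | n + 1 => (Lie K).comp (m := 2) (n := n + 1) (a := ()) (b := ()) (by omega) rfl 0
      (presentedGen K 0 (LieRel K) .bracket) (leftNormed K n)

/-! ### The operad `O` and the deformation operad -/

/-- The first component `ℤ × ℤ → ℤ`, the degree; the second component is the weight. -/
abbrev degreeHom : ℤ × ℤ →+ ℤ := AddMonoidHom.fst ℤ ℤ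

/-- The generators of `O`: operators `d n` for `n ≥ 1`, of arity `1`, degree `1` and weight `n`,
and a product `1 ⊗ 1` of arity `2`, degree `0` and weight `-1`. -/
inductive OGen : ℕ → ℤ × ℤ → Type
  | d (n : ℕ) (hn : 1 ≤ n) : OGen 1 (1, (n : ℤ))
  | mul : OGen 2 (0, -1)

/-- The relations of `O`: the product is commutative and associative, and each `d n` is a
derivation of it. -/
inductive ORel (K : Type u) [Field K] : ∀ {n : ℕ} {g : ℤ × ℤ}, Lin K OGen n g → Prop
  | comm : ORel K (gen .mul - linAct (Equiv.swap 0 1) (gen .mul))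
  | assoc (h : 2 + 2 = 3 + 1) (e : ((0, -1) : ℤ × ℤ) + (0, -1) = (0, -2)) :
      ORel K (linComp h e 0 (gen .mul) (gen .mul) - linComp h e 1 (gen .mul) (gen .mul))
  | deriv (n : ℕ) (hn : 1 ≤ n) (h : 1 + 2 = 2 + 1) (h' : 2 + 1 = 2 + 1)
      (e : ((1, (n : ℤ)) : ℤ × ℤ) + (0, -1) = (1, (n : ℤ) - 1))
      (e' : ((0, -1) : ℤ × ℤ) + (1, (n : ℤ)) = (1, (n : ℤ) - 1)) :
      ORel K (linComp h e 0 (gen (.d n hn)) (gen .mul) -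
        (linComp h' e' 0 (gen .mul) (gen (.d n hn)) + linComp h' e' 1 (gen .mul) (gen (.d n hn))))

/-- The operad `O`, graded by degree and weight. -/
def OOperad (K : Type u) [Field K] : GradedOperad.{u, u, 0} K (ℤ × ℤ) degreeHom :=
  presented K OGen degreeHom (ORel K)

/-- The suboperad of weight `0` of an operad graded by degree and weight. -/
def weightZero {K : Type u} [Field K] (P : GradedOperad.{u, v, 0} K (ℤ × ℤ) degreeHom) :
    GradedOperad.{u, v, 0} K ℤ (AddMonoidHom.id ℤ) where
  obj n g := P.obj n (g, 0)
  act := P.act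
  one := P.one
  comp h e := P.comp h (by rw [← e]; rfl)
  one_comp h _ := P.one_comp h _
  comp_one h _ := P.comp_one h _
  act_comp h _ := P.act_comp h _
  assoc h₁ h₂ h₃ h₄ _ _ _ _ := P.assoc h₁ h₂ h₃ h₄ _ _ _ _
  parallel h₁ h₂ h₃ h₄ _ _ _ _ := P.parallel h₁ h₂ h₃ h₄ _ _ _ _

/-- The deformation operad `D_∞`, graded by degree. -/
def DInfty (K : Type u) [Field K] : GradedOperad.{u, u, 0} K ℤ (AddMonoidHom.id ℤ) :=
  weightZero (OOperad K)

/-- The iterated product `1 ⊗ ... ⊗ 1` of arity `n + 1`. -/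
def iteratedMul (K : Type u) [Field K] : ∀ n : ℕ, (OOperad K).obj (n + 1) (0, -(n : ℤ))
  | 0 => (OOperad K).one
  | n + 1 => (OOperad K).comp (m := 2) (n := n + 1) (by omega) (by ext <;> simp) 0
      (presentedGen K degreeHom (ORel K) .mul) (iteratedMul K n)

/-- The element `d_{n+1} ⊗ 1 ⊗ ... ⊗ 1` of `D_∞`, of arity `n + 2` and degree `1`. -/
def dFirst (K : Type u) [Field K] (n : ℕ) : (DInfty K).obj (n + 2) 1 :=
  (OOperad K).comp (m := n + 2) (n := 1) rfl (by ext <;> simp) 0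
    (iteratedMul K (n + 1)) (presentedGen K degreeHom (ORel K) (.d (n + 1) (by omega)))

/-! ### The tensor product -/

/-- The aritywise tensor product of an operad `P` with a graded operad `Q`; here `P` is placed in
degree `0`, so that no signs arise. -/
def tensorOperad {K : Type u} [Field K] {Γ : Type w} [AddCommGroup Γ] {par : Γ →+ ℤ}
    (P : Operad.{u, v} K) (Q : GradedOperad.{u, v', w} K Γ par) :
    GradedOperad.{u, max v v', w} K Γ par where
  obj n g := P.obj n () ⊗[K] Q.obj n g
  act := P.act.tprod Q.act
  one := P.one ⊗ₜ Q.one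
  comp h e i := TensorProduct.map₂ (P.comp (a := ()) (b := ()) h rfl i) (Q.comp h e i)
  one_comp h e y := by
    induction y using TensorProduct.induction_on with
    | zero => simp only [_root_.map_zero]
    | add x y hx hy => simp only [_root_.map_add, hx, hy]
    | tmul x y => exact congrArg₂ (TensorProduct.tmul K) (P.one_comp h _ x) (Q.one_comp h e y)
  comp_one h e i x := by
    induction x using TensorProduct.induction_on with
    | zero => simp only [_root_.map_zero, LinearMap.zero_apply]
    | add x y hx hy => simp only [_root_.map_add, LinearMap.add_apply, hx, hy]
    | tmul x y => exact congrArg₂ (TensorProduct.tmul K) (P.comp_one h _ i x) (Q.comp_one h e i y)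
  act_comp h e i σ τ ρ hρ x y := by
    induction x using TensorProduct.induction_on with
    | zero => simp only [_root_.map_zero, LinearMap.zero_apply]
    | add x y hx hy => simp only [_root_.map_add, LinearMap.add_apply, hx, hy]
    | tmul x x' =>
    induction y using TensorProduct.induction_on with
    | zero => simp only [_root_.map_zero]
    | add x y hx hy => simp only [_root_.map_add, hx, hy]
    | tmul y y' =>
    exact congrArg₂ (TensorProduct.tmul K) (P.act_comp h _ i σ τ ρ hρ x y)
      (Q.act_comp h e i σ τ ρ hρ x' y')
  assoc h₁ h₂ h₃ h₄ e₁ e₂ e₃ e₄ i j s hs x y z := by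
    induction x using TensorProduct.induction_on with
    | zero => simp only [_root_.map_zero, LinearMap.zero_apply]
    | add x y hx hy => simp only [_root_.map_add, LinearMap.add_apply, hx, hy]
    | tmul x x' =>
    induction y using TensorProduct.induction_on with
    | zero => simp only [_root_.map_zero, LinearMap.zero_apply]
    | add x y hx hy => simp only [_root_.map_add, LinearMap.add_apply, hx, hy]
    | tmul y y' =>
    induction z using TensorProduct.induction_on with
    | zero => simp only [_root_.map_zero]
    | add x y hx hy => simp only [_root_.map_add, hx, hy]
    | tmul z z' =>
    exact congrArg₂ (TensorProduct.tmul K) (P.assoc h₁ h₂ h₃ h₄ _ _ _ _ i j s hs x y z)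
      (Q.assoc h₁ h₂ h₃ h₄ e₁ e₂ e₃ e₄ i j s hs x' y' z')
  parallel h₁ h₂ h₃ h₄ e₁ e₂ e₃ e₄ i j s t hij hs ht x y z := by
    induction x using TensorProduct.induction_on with
    | zero => simp only [_root_.map_zero, LinearMap.zero_apply, smul_zero]
    | add x y hx hy => simp only [_root_.map_add, LinearMap.add_apply, smul_add, hx, hy]
    | tmul x x' =>
    induction y using TensorProduct.induction_on with
    | zero => simp only [_root_.map_zero, LinearMap.zero_apply, smul_zero]
    | add x y hx hy => simp only [_root_.map_add, LinearMap.add_apply, smul_add, hx, hy]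
    | tmul y y' =>
    induction z using TensorProduct.induction_on with
    | zero => simp only [_root_.map_zero, LinearMap.zero_apply, smul_zero]
    | add x y hx hy => simp only [_root_.map_add, LinearMap.add_apply, smul_add, hx, hy]
    | tmul z z' =>
    have hP := P.parallel h₁ h₂ h₃ h₄ (a := ()) (b := ()) (c := ()) rfl rfl rfl rfl i j s t
      hij hs ht x y z
    have hQ := Q.parallel h₁ h₂ h₃ h₄ e₁ e₂ e₃ e₄ i j s t hij hs ht x' y' z'
    simp only [AddMonoidHom.zero_apply, mul_zero, Int.negOnePow_zero, one_smul] at hP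
    simp only [TensorProduct.map₂_apply_tmul, TensorProduct.map_tmul]
    rw [hP, hQ, Units.smul_def, Units.smul_def, TensorProduct.tmul_smul]

/-- The graded operad `Lie ⊗ D_∞`. -/
def LieD (K : Type u) [Field K] : GradedOperad.{u, u, 0} K ℤ (AddMonoidHom.id ℤ) :=
  tensorOperad (Lie K) (DInfty K)

/-- The normal higher derived bracket `{d_{n+1}(l₁), l₂, ..., l_{n+2}}` in `Lie ⊗ D_∞`, of
arity `n + 2` and degree `1`, where `lᵢ = σ i`. -/
def normalBracket (K : Type u) [Field K] (n : ℕ) (σ : Equiv.Perm (Fin (n + 2))) :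
    (LieD K).obj (n + 2) 1 :=
  (LieD K).act σ (leftNormed K (n + 1) ⊗ₜ[K] dFirst K n)

end HigherDerived

end

/-!
The operad `Lie ⊗ D_∞` is compared with the free operad `FreeOp` on one generator of degree one in
each arity at least two. The morphism `freeHom` maps the generators to the higher derived brackets.
It is surjective onto the part of weight zero, and both sides are then shown to have the same
dimension, by an upper bound for the free operad and a lower bound for `Lie ⊗ D_∞`.

*Surjectivity.* Let `M` be a suboperad of `Lie ⊗ O` that contains the higher derived brackets, and
let `[x, y]` be the operation obtained from the bracket `{1,2} ⊗ (1 ⊗ 1)`, which has weight `-1`. An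
element has level `t ≥ 0` if bracketing it with `t` elements of `M` leads into `M`, and level `-t` if
it is a combination of brackets of `t + 1` elements of `M`. By the Jacobi identity the bracket lowers
the sum of the levels by one (`brk_mem_level`). That the higher derived brackets are in `M` means
that `d_k` has level `k`, and since `d_k` is a derivation it raises levels by `k`
(`pD_comp_mem_upper`). As `Lie ⊗ O` is spanned by iterated brackets of composites of the `d_k`
(`brSpan_eq_top`), the level of these being their weight, all elements of weight zero are in `M`
(`mem_of_containsDerived`).

*Upper bound.* The free operad is spanned in arity `n` by the `n!` relabellings of the operations
given by planar trees with `n` leaves (`treeSpan_eq_top`), the degree being the number of internal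
vertices.

*Lower bound.* The commutators in a free associative algebra show that `Lie` has dimension at least
`(n - 1)!` in arity `n` (`factorial_le_finrank_lie`). For `O`, the operators `d_k` act by a sum of
derivations of a polynomial algebra with coefficients in an exterior algebra (`polyHom`); these
derivations put a letter in front of the word that a variable carries. Hence the products of `n`
words in the `d_k` are linearly independent in `O` (`exists_linearIndependent_of_words`). A planar
tree with `n` leaves is encoded by a tuple of `n` words of total weight `n - 1`, and by the cycle
lemma all the rotations of the codes are different (`Plan.enc_rotate_rotate_inj`). So the dimension
of `D_∞` is, in each degree, at least `n` times the number of trees.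

Since `(n - 1)! * n = n!`, all of these bounds are equalities (`finrank_eq`), and `freeHom` is an
isomorphism in weight zero (`freeHom_bijective`). Freeness is transported along it. The trees of
degree one are the corollas, which gives the basis of the part of degree one, and the trees are
counted by the small Schröder numbers (`Plan.card_tree`).
-/

noncomputable section

namespace HigherDerived

/-! ### Block permutations -/

theorem exists_pos {m n k : ℕ} (h : m + n = k + 1) (i : Fin m) (p : Fin k) :
    (∃ (j : Fin m) (hne : j ≠ i), outerPos h i j hne = p) ∨ ∃ l : Fin n, innerPos h i l = p := by
  have hp := p.isLt
  have hi := i.isLt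
  by_cases h1 : p.val < i.val
  · exact .inl ⟨⟨p, by omega⟩, fun e => by simp [Fin.ext_iff] at e; omega, by
      ext; simp [outerPos, h1]⟩
  · by_cases h2 : p.val < i.val + n
    · exact .inr ⟨⟨p - i, by omega⟩, by ext; simp [innerPos]; omega⟩
    · refine .inl ⟨⟨p + 1 - n, by omega⟩, fun e => by simp [Fin.ext_iff] at e; omega, ?_⟩
      ext
      simp only [outerPos]
      split <;> omega

theorem outerPos_eq_of_lt {m n k : ℕ} (h : m + n = k + 1) {i j : Fin m} (hne : j ≠ i) {p : Fin k}
    (hj : j.val < i.val) (hp : p.val = j.val) : outerPos h i j hne = p := by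
  ext; simp [outerPos, hj, hp]

theorem outerPos_eq_of_gt {m n k : ℕ} (h : m + n = k + 1) {i j : Fin m} (hne : j ≠ i) {p : Fin k}
    (hj : i.val < j.val) (hp : p.val + 1 = j.val + n) : outerPos h i j hne = p := by
  ext; simp only [outerPos, if_neg hj.asymm]; omega

theorem outerPos_injective {m n k : ℕ} (h : m + n = k + 1) (i : Fin m) {j j' : Fin m} (hj : j ≠ i)
    (hj' : j' ≠ i) (e : outerPos h i j hj = outerPos h i j' hj') : j = j' := by
  have h1 : j.val ≠ i.val := fun e => hj (Fin.ext e)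
  have h2 : j'.val ≠ i.val := fun e => hj' (Fin.ext e)
  simp only [outerPos, Fin.ext_iff] at e ⊢
  split at e <;> split at e <;> omega

theorem innerPos_injective {m n k : ℕ} (h : m + n = k + 1) (i : Fin m) {l l' : Fin n}
    (e : innerPos h i l = innerPos h i l') : l = l' := by
  simp only [innerPos, Fin.ext_iff] at e ⊢
  omega

theorem outerPos_ne_innerPos {m n k : ℕ} (h : m + n = k + 1) (i : Fin m) {j : Fin m} (hj : j ≠ i)
    (l : Fin n) : outerPos h i j hj ≠ innerPos h i l := by
  have h1 : j.val ≠ i.val := fun e => hj (Fin.ext e)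
  intro e
  have := l.isLt
  simp only [outerPos, innerPos, Fin.ext_iff] at e
  split at e <;> omega

/-- The inputs of `μ ∘ᵢ ν` are the inputs `j ≠ i` of `μ` and the inputs of `ν`. -/
def posEquiv {m n k : ℕ} (h : m + n = k + 1) (i : Fin m) : {j : Fin m // j ≠ i} ⊕ Fin n ≃ Fin k :=
  Equiv.ofBijective (Sum.elim (fun j => outerPos h i j.1 j.2) (innerPos h i)) <| by
    constructor
    · rintro (⟨j, hj⟩ | l) (⟨j', hj'⟩ | l') e
      · simpa using outerPos_injective h i hj hj' e
      · exact (outerPos_ne_innerPos h i hj l' e).elim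
      · exact (outerPos_ne_innerPos h i hj' l e.symm).elim
      · exact congrArg _ (innerPos_injective h i e)
    · intro p
      obtain ⟨j, hj, e⟩ | ⟨l, e⟩ := exists_pos h i p
      · exact ⟨.inl ⟨j, hj⟩, e⟩
      · exact ⟨.inr l, e⟩

theorem exists_isBlockPerm {m n k : ℕ} (h : m + n = k + 1) (i : Fin m)
    (σ : Equiv.Perm (Fin m)) (τ : Equiv.Perm (Fin n)) : ∃ ρ, IsBlockPerm h i σ τ ρ := by
  refine ⟨(posEquiv h i).symm.trans ((Equiv.sumCongr (σ.subtypeEquiv fun j => ?_) τ).trans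
    (posEquiv h (σ i))), ?_, ?_⟩
  · simp
  · intro j hj
    have : (posEquiv h i).symm (outerPos h i j hj) = .inl ⟨j, hj⟩ := by
      rw [Equiv.symm_apply_eq]; rfl
    simp [this]
    rfl
  · intro l
    have : (posEquiv h i).symm (innerPos h i l) = .inr l := by
      rw [Equiv.symm_apply_eq]; rfl
    simp [this]
    rfl

/-! ### Operads with a binary operation

Identities in an operad are used only up to signs and relabellings, which are not computed. -/

section Bracket

variable {K : Type u} [Field K] {Γ : Type w} [AddCommGroup Γ] {par : Γ →+ ℤ}
  (Q : GradedOperad.{u, v, w} K Γ par)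

theorem act_one_apply {n : ℕ} {a : Γ} (x : Q.obj n a) : Q.act 1 x = x := by
  rw [map_one]; rfl

theorem act_act {n : ℕ} {a : Γ} (σ τ : Equiv.Perm (Fin n)) (x : Q.obj n a) :
    Q.act σ (Q.act τ x) = Q.act (σ * τ) x := by
  rw [map_mul]; rfl

/-- Equivariance of the partial composition in the outer operation. -/
theorem comp_act_left {m n k : ℕ} {a b c : Γ} (h : m + n = k + 1) (e : a + b = c) (i : Fin m)
    (σ : Equiv.Perm (Fin m)) (x : Q.obj m a) (y : Q.obj n b) :
    ∃ ρ, IsBlockPerm h i σ 1 ρ ∧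
      Q.comp h e (σ i) (Q.act σ x) y = Q.act ρ (Q.comp h e i x y) := by
  obtain ⟨ρ, hρ⟩ := exists_isBlockPerm h i σ (1 : Equiv.Perm (Fin n))
  refine ⟨ρ, hρ, ?_⟩
  rw [← Q.act_comp h e i σ 1 ρ hρ, act_one_apply]

/-- Relabelling of the outer operation, where the position of the composition is prescribed after
the relabelling. -/
theorem comp_act_left' {m n k : ℕ} {a b c : Γ} (h : m + n = k + 1) (e : a + b = c) (i j : Fin m)
    (σ : Equiv.Perm (Fin m)) (hj : σ j = i) (x : Q.obj m a) (y : Q.obj n b) :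
    ∃ ρ : Equiv.Perm (Fin k), (∀ (p : Fin m) (hp : p ≠ j), ρ (outerPos h j p hp) =
        outerPos h i (σ p) (fun e => hp (σ.injective (e.trans hj.symm)))) ∧
      Q.comp h e i (Q.act σ x) y = Q.act ρ (Q.comp h e j x y) := by
  subst hj
  obtain ⟨ρ, hρ, e⟩ := comp_act_left Q h e j σ x y
  exact ⟨ρ, hρ.1, e⟩

/-- Equivariance of the partial composition in the inner operation. -/
theorem comp_act_right {m n k : ℕ} {a b c : Γ} (h : m + n = k + 1) (e : a + b = c) (i : Fin m)
    (τ : Equiv.Perm (Fin n)) (x : Q.obj m a) (y : Q.obj n b) :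
    ∃ ρ, IsBlockPerm h i 1 τ ρ ∧
      Q.comp h e i x (Q.act τ y) = Q.act ρ (Q.comp h e i x y) := by
  obtain ⟨ρ, hρ⟩ := exists_isBlockPerm h i (1 : Equiv.Perm (Fin m)) τ
  refine ⟨ρ, hρ, ?_⟩
  rw [← Q.act_comp h e i 1 τ ρ hρ, act_one_apply]
  rfl

/-- The axiom for parallel compositions, with a sign that is left open. -/
theorem exists_parallel {l m n p q r : ℕ} {a b c d d' f : Γ}
    (h₁ : l + m = p + 1) (h₂ : p + n = r + 1) (h₃ : l + n = q + 1) (h₄ : q + m = r + 1)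
    (e₁ : a + b = d) (e₂ : d + c = f) (e₃ : a + c = d') (e₄ : d' + b = f)
    (i j : Fin l) (s : Fin p) (t : Fin q) (hij : i < j) (hs : s.val + 1 = j.val + m)
    (ht : t.val = i.val) (x : Q.obj l a) (y : Q.obj m b) (z : Q.obj n c) :
    ∃ ε : ℤˣ, Q.comp h₂ e₂ s (Q.comp h₁ e₁ i x y) z =
      ε • Q.comp h₄ e₄ t (Q.comp h₃ e₃ j x z) y :=
  ⟨_, Q.parallel h₁ h₂ h₃ h₄ e₁ e₂ e₃ e₄ i j s t hij hs ht x y z⟩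

theorem exists_parallel_symm {l m n p q r : ℕ} {a b c d d' f : Γ}
    (h₁ : l + m = p + 1) (h₂ : p + n = r + 1) (h₃ : l + n = q + 1) (h₄ : q + m = r + 1)
    (e₁ : a + b = d) (e₂ : d + c = f) (e₃ : a + c = d') (e₄ : d' + b = f)
    (i j : Fin l) (s : Fin p) (t : Fin q) (hij : i < j) (hs : s.val + 1 = j.val + m)
    (ht : t.val = i.val) (x : Q.obj l a) (y : Q.obj m b) (z : Q.obj n c) :
    ∃ ε : ℤˣ, Q.comp h₄ e₄ t (Q.comp h₃ e₃ j x z) y =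
      ε • Q.comp h₂ e₂ s (Q.comp h₁ e₁ i x y) z := by
  obtain ⟨ε, hε⟩ := exists_parallel Q h₁ h₂ h₃ h₄ e₁ e₂ e₃ e₄ i j s t hij hs ht x y z
  exact ⟨ε⁻¹, by rw [hε, inv_smul_smul]⟩

theorem comp_units_smul_left {m n k : ℕ} {a b c : Γ} (h : m + n = k + 1) (e : a + b = c) (i : Fin m)
    (ε : ℤˣ) (x : Q.obj m a) (y : Q.obj n b) :
    Q.comp h e i (ε • x) y = ε • Q.comp h e i x y := by
  rw [Units.smul_def, Units.smul_def, map_zsmul, LinearMap.smul_apply]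

theorem comp_units_smul_right {m n k : ℕ} {a b c : Γ} (h : m + n = k + 1) (e : a + b = c)
    (i : Fin m) (ε : ℤˣ) (x : Q.obj m a) (y : Q.obj n b) :
    Q.comp h e i x (ε • y) = ε • Q.comp h e i x y := by
  rw [Units.smul_def, Units.smul_def, map_zsmul]

theorem act_units_smul {n : ℕ} {a : Γ} (σ : Equiv.Perm (Fin n)) (ε : ℤˣ) (x : Q.obj n a) :
    Q.act σ (ε • x) = ε • Q.act σ x := by
  rw [Units.smul_def, Units.smul_def, map_zsmul]

/-- The degree of an intermediate result is determined. -/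
theorem comp_comp_deg {l m n p r : ℕ} {a b c d d' f : Γ} (h₁ : l + m = p + 1) (h₂ : p + n = r + 1)
    (e₁ : a + b = d) (e₂ : d + c = f) (e₁' : a + b = d') (e₂' : d' + c = f) (i : Fin l) (s : Fin p)
    (x : Q.obj l a) (y : Q.obj m b) (z : Q.obj n c) :
    Q.comp h₂ e₂ s (Q.comp h₁ e₁ i x y) z = Q.comp h₂ e₂' s (Q.comp h₁ e₁' i x y) z := by
  subst e₁ e₁'
  rfl

variable {b₀ : Γ} (β : Q.obj 2 b₀)

/-- The operation `β(u, v)`, for a binary operation `β` of an operad: the inputs of `u` come first,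
then those of `v`. -/
def brk {m n k : ℕ} (h : m + n = k) {a b c : Γ} (e : b₀ + b + a = c) :
    Q.obj m a →ₗ[K] Q.obj n b →ₗ[K] Q.obj k c :=
  ((Q.comp (m := n + 1) (n := m) (by omega) e 0).comp
    (Q.comp (m := 2) (n := n) (k := n + 1) (by omega) rfl 1 β)).flip

theorem brk_apply {m n k : ℕ} (h : m + n = k) {a b c : Γ} (e : b₀ + b + a = c)
    (x : Q.obj m a) (y : Q.obj n b) :
    brk Q β h e x y = Q.comp (m := n + 1) (n := m) (by omega) e 0
      (Q.comp (m := 2) (n := n) (k := n + 1) (by omega) rfl 1 β y) x := rfl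

variable {Q} in
/-- Equivariance of the bracket, with a relabelling that is left open. -/
theorem brk_act {m n k : ℕ} (h : m + n = k) {a b c : Γ} (e : b₀ + b + a = c)
    (σ : Equiv.Perm (Fin m)) (τ : Equiv.Perm (Fin n)) (x : Q.obj m a) (y : Q.obj n b) :
    ∃ ρ, brk Q β h e (Q.act σ x) (Q.act τ y) = Q.act ρ (brk Q β h e x y) := by
  rw [brk_apply, brk_apply]
  obtain ⟨ρ, hρ, e1⟩ := comp_act_right Q (m := 2) (n := n) (k := n + 1) (by omega)
    (rfl : b₀ + b = b₀ + b) 1 τ β y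
  rw [e1]
  have h0 : ρ 0 = 0 := by
    exact hρ.1 0 (by decide)
  obtain ⟨ρ', hρ'⟩ := exists_isBlockPerm (m := n + 1) (n := m) (k := k) (by omega) 0 ρ σ
  refine ⟨ρ', ?_⟩
  rw [← Q.act_comp _ e 0 ρ σ ρ' hρ', h0]

variable {Q} in
theorem brk_comp_left {m n p k r q : ℕ} {a b c d f g : Γ} (h : m + n = k) (e : b₀ + b + a = d)
    (h₁ : k + p = r + 1) (e₁ : d + c = f) (h₂ : m + p = q + 1) (e₂ : a + c = g) (h₃ : q + n = r)
    (e₃ : b₀ + b + g = f)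
    (i : Fin k) (j : Fin m) (hij : i.val = j.val)
    (x : Q.obj m a) (y : Q.obj n b) (z : Q.obj p c) :
    Q.comp h₁ e₁ i (brk Q β h e x y) z = brk Q β h₃ e₃ (Q.comp h₂ e₂ j x z) y := by
  rw [brk_apply, brk_apply]
  exact Q.assoc _ _ _ _ _ _ _ _ _ _ _ (by simp [hij]) _ _ _

variable {Q} in
theorem brk_comp_right {m n p k r q : ℕ} {a b c d f g : Γ} (h : m + n = k) (e : b₀ + b + a = d)
    (h₁ : k + p = r + 1) (e₁ : d + c = f) (h₂ : n + p = q + 1) (e₂ : b + c = g) (h₃ : m + q = r)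
    (e₃ : b₀ + g + a = f)
    (i : Fin k) (j : Fin n) (hij : i.val = m + j.val)
    (x : Q.obj m a) (y : Q.obj n b) (z : Q.obj p c) :
    ∃ ε : ℤˣ, Q.comp h₁ e₁ i (brk Q β h e x y) z = ε • brk Q β h₃ e₃ x (Q.comp h₂ e₂ j y z) := by
  subst e₂
  rw [brk_apply, brk_apply]
  obtain ⟨ε, hε⟩ := exists_parallel Q (l := n + 1) (m := m) (n := p) (p := k) (q := q + 1) (r := r)
    (by omega) h₁ (by omega) (by omega) e e₁ (add_assoc _ _ _ : b₀ + b + c = b₀ + (b + c))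
    e₃ 0 ⟨j + 1, by omega⟩ i 0 (by simp [Fin.lt_def]) (by simp; omega) rfl
    (Q.comp (m := 2) (n := n) (k := n + 1) (by omega) rfl 1 β y) x z
  refine ⟨ε, ?_⟩
  rw [hε, Q.assoc (l := 2) (m := n) (n := p) (p := n + 1) (q := q) (r := q + 1) (by omega) (by omega)
    h₂ (by omega) _ _ rfl rfl 1 j _ (by simp; omega)]

variable {Q} in
/-- Antisymmetry of the bracket, up to signs and relabellings. -/
theorem brk_antisymm (hβ : Q.act (Equiv.swap 0 1) β = -β) {m n k : ℕ} (h : m + n = k)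
    (h' : n + m = k) {a b c : Γ} (e : b₀ + b + a = c) (e' : b₀ + a + b = c)
    (x : Q.obj m a) (y : Q.obj n b) :
    ∃ (ε : ℤˣ) (ρ : Equiv.Perm (Fin k)), brk Q β h e x y = ε • Q.act ρ (brk Q β h' e' y x) := by
  rw [brk_apply, brk_apply]
  have hβ' : β = (-1 : ℤˣ) • Q.act (Equiv.swap 0 1) β := by rw [hβ]; simp
  obtain ⟨ρ, hρ, e1⟩ := comp_act_left' Q (m := 2) (n := n) (k := n + 1) (by omega)
    (rfl : b₀ + b = b₀ + b) 1 0 (Equiv.swap 0 1) (by simp) β y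
  have h1 : ρ (Fin.last n) = 0 := by
    refine (congrArg ρ (outerPos_eq_of_gt _ (by decide) ?_ ?_).symm).trans
      ((hρ 1 (by decide)).trans (outerPos_eq_of_lt _ _ ?_ ?_)) <;> simp; omega
  obtain ⟨ρ', -, e2⟩ := comp_act_left' Q (m := n + 1) (n := m) (k := k) (by omega) e
    0 (Fin.last n) ρ h1
    (Q.comp (m := 2) (n := n) (k := n + 1) (by omega) rfl 0 β y) x
  obtain ⟨ε, e3⟩ := exists_parallel Q (l := 2) (m := n) (n := m) (p := n + 1) (q := m + 1) (r := k)
    (by omega) (by omega) (by omega) (by omega)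
    (rfl : b₀ + b = b₀ + b) e (rfl : b₀ + a = b₀ + a) e' 0 1 (Fin.last n) 0 (by decide)
    (by simp; omega) rfl β y x
  refine ⟨-ε, ρ', ?_⟩
  conv_lhs => rw [hβ']
  rw [comp_units_smul_left, comp_units_smul_left, e1, e2, e3, act_units_smul, smul_smul,
    neg_one_mul]

/-- The composite `x(u, v, w)` of a ternary operation `x`. -/
def ternComp {m n p k : ℕ} (h : m + n + p = k) {t a b c d : Γ} (e : t + c + b + a = d)
    (x : Q.obj 3 t) (u : Q.obj m a) (v : Q.obj n b) (w : Q.obj p c) : Q.obj k d :=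
  Q.comp (m := n + p + 1) (n := m) (by omega) e 0
    (Q.comp (m := p + 2) (n := n) (k := n + p + 1) (by omega) rfl 1
      (Q.comp (m := 3) (n := p) (k := p + 2) (by omega) rfl 2 x w) v) u

theorem ternComp_eq {m n p k q : ℕ} (h : m + n + p = k) {t a b c d : Γ} (e : t + c + b + a = d)
    (x : Q.obj 3 t) (u : Q.obj m a) (v : Q.obj n b) (w : Q.obj p c) {f g : Γ}
    (e₁ : t + c = f) (e₂ : f + b = g) (e₃ : g + a = d) (h₁ : p + 2 + n = q + 1)
    (h₂ : q + m = k + 1) (i : Fin q) (hi : i.val = 0) :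
    ternComp Q h e x u v w = Q.comp h₂ e₃ i (Q.comp (m := p + 2) (n := n) h₁ e₂ 1
        (Q.comp (m := 3) (n := p) (k := p + 2) (by omega) e₁ 2 x w) v) u := by
  subst e₁ e₂
  obtain rfl : q = n + p + 1 := by omega
  obtain rfl : i = 0 := Fin.ext hi
  rfl

/-- Inserting `u`, `v`, `w` into `β(1, β(2, 3))` gives `β(u, β(v, w))`. -/
theorem ternComp_brk_right {m n p k q : ℕ} (h : m + n + p = k) {a b c d f : Γ}
    (e : b₀ + b₀ + c + b + a = d) (h' : m + q = k) (h₂ : n + p = q)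
    (e₂ : b₀ + c + b = f) (e₁ : b₀ + f + a = d)
    (u : Q.obj m a) (v : Q.obj n b) (w : Q.obj p c) :
    ternComp Q h e (Q.comp (m := 2) (n := 2) (by omega) rfl 1 β β) u v w =
      brk Q β h' e₁ u (brk Q β h₂ e₂ v w) := by
  subst h₂ e₂
  rw [brk_apply, brk_apply, ternComp_eq (f := b₀ + (b₀ + c)) (g := b₀ + (b₀ + c + b)) (e₃ := e₁)
    (h₁ := (by omega : p + 2 + n = n + p + 1 + 1)) (h₂ := by omega) (i := 0) (hi := rfl)]
  · rw [Q.assoc (l := 2) (m := 2) (n := p) (q := p + 1) (by omega) (by omega) (by omega) (by omega)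
      _ _ rfl rfl 1 1 2 (by simp) β β w]
    rw [Q.assoc (l := 2) (m := p + 1) (n := n) (q := n + p) (by omega) (by omega) (by omega)
      (by omega) _ _ rfl rfl 1 0 1 (by simp) β _ v]
  · abel
  · abel

/-- Inserting `u`, `v`, `w` into `β(β(1, 2), 3)` gives `β(β(u, v), w)`, up to sign. -/
theorem ternComp_brk_left {m n p k q : ℕ} (h : m + n + p = k) {a b c d f : Γ}
    (e : b₀ + b₀ + c + b + a = d) (h' : q + p = k) (h₂ : m + n = q)
    (e₂ : b₀ + b + a = f) (e₁ : b₀ + c + f = d)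
    (u : Q.obj m a) (v : Q.obj n b) (w : Q.obj p c) :
    ∃ ε : ℤˣ, ternComp Q h e (Q.comp (m := 2) (n := 2) (by omega) rfl 0 β β) u v w =
      ε • brk Q β h' e₁ (brk Q β h₂ e₂ u v) w := by
  subst h₂ e₂
  obtain ⟨ε, hε⟩ := exists_parallel Q (l := 2) (m := 2) (n := p) (p := 3) (q := p + 1) (r := p + 2)
    (by omega) (by omega) (by omega) (by omega) (rfl : b₀ + b₀ = _) rfl rfl
    (by abel : b₀ + c + b₀ = b₀ + b₀ + c) 0 1 2 0 (by decide) (by simp) rfl β β w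
  refine ⟨ε, ?_⟩
  rw [brk_apply, brk_apply, ternComp_eq (g := b₀ + c + (b₀ + b)) (e₁ := rfl)
    (h₁ := (by omega : p + 2 + n = n + p + 1 + 1)) (h₂ := by omega) (i := 0) (hi := rfl)]
  · rw [hε, comp_units_smul_left, comp_units_smul_left,
      Q.assoc (l := p + 1) (m := 2) (n := n) (q := n + 1) (by omega) (by omega) (by omega) (by omega)
      _ _ rfl rfl 0 1 1 (by simp) _ β v, Q.assoc (l := p + 1) (m := n + 1) (n := m) (q := m + n)
        (by omega) (by omega) (by omega) (by omega) _ _ rfl e₁ 0 0 0 (by simp) _ _ u]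
  · abel
  · rw [← e]; abel

/-- Relabelling the ternary operation amounts to exchanging the operations that are inserted. -/
theorem ternComp_swap {m n p k : ℕ} (h : m + n + p = k) (h' : m + p + n = k) {t a b c d : Γ}
    (e : t + c + b + a = d) (e' : t + b + c + a = d)
    (x : Q.obj 3 t) (u : Q.obj m a) (v : Q.obj n b) (w : Q.obj p c) :
    ∃ (ε : ℤˣ) (ρ : Equiv.Perm (Fin k)), ternComp Q h e (Q.act (Equiv.swap 1 2) x) u v w =
      ε • Q.act ρ (ternComp Q h' e' x u w v) := by
  obtain ⟨ρ₁, hρ₁, e1⟩ := comp_act_left' Q (m := 3) (n := p) (k := p + 2) (by omega)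
    (rfl : t + c = _) 2 1 (Equiv.swap 1 2) (by simp) x w
  have h1 : ρ₁ (Fin.last (p + 1)) = 1 := by
    refine (congrArg ρ₁ (outerPos_eq_of_gt _ (by decide) ?_ ?_).symm).trans
      ((hρ₁ 2 (by decide)).trans (outerPos_eq_of_lt _ _ ?_ ?_)) <;> simp; omega
  have h1' : ρ₁ 0 = 0 := hρ₁ 0 (by decide)
  obtain ⟨ρ₂, hρ₂, e2⟩ := comp_act_left' Q (m := p + 2) (n := n) (k := n + p + 1) (by omega)
    (rfl : t + c + b = _) 1 (Fin.last (p + 1)) ρ₁ h1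
    (Q.comp (m := 3) (n := p) (k := p + 2) (by omega) rfl 1 x w) v
  have h2 : ρ₂ 0 = 0 := by
    refine (congrArg ρ₂ (outerPos_eq_of_lt _ Fin.last_pos.ne ?_ ?_).symm).trans
      ((hρ₂ 0 Fin.last_pos.ne).trans (outerPos_eq_of_lt _ _ ?_ ?_)) <;> simp [h1']
  obtain ⟨ρ₃, -, e3⟩ := comp_act_left' Q (m := n + p + 1) (n := m) (k := k) (by omega)
    e 0 0 ρ₂ h2
    (Q.comp (m := p + 2) (n := n) (k := n + p + 1) (by omega) rfl (Fin.last (p + 1))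
      (Q.comp (m := 3) (n := p) (k := p + 2) (by omega) rfl 1 x w) v) u
  obtain ⟨ε, hε⟩ := exists_parallel Q (l := 3) (m := p) (n := n) (p := p + 2) (q := n + 2)
    (r := n + p + 1) (by omega) (by omega) (by omega) (by omega) (rfl : t + c = _) rfl rfl
    (by abel : t + b + c = t + c + b) 1 2 (Fin.last (p + 1)) 1 (by decide) (by simp; omega)
    (by simp) x w v
  refine ⟨ε, ρ₃, ?_⟩
  rw [ternComp, e1, e2, e3, hε, comp_units_smul_left, act_units_smul,
    ternComp_eq (e₁ := rfl) (e₂ := (by abel : t + b + c = t + c + b)) (e₃ := e)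
      (h₁ := (by omega : n + 2 + p = n + p + 1 + 1)) (i := 0) (hi := rfl)]

variable {Q β} in
/-- The Jacobi identity. -/
theorem brk_jacobi (hJ : ∃ ε ε' : ℤˣ, Q.comp (m := 2) (n := 2) (k := 3) (by omega) rfl 1 β β =
      ε • Q.comp (m := 2) (n := 2) (k := 3) (by omega) rfl 0 β β +
      ε' • Q.act (Equiv.swap 1 2) (Q.comp (m := 2) (n := 2) (k := 3) (by omega) rfl 0 β β))
    {m n p k q r s : ℕ} {a b c d f f' f'' : Γ} (h₁ : m + q = k) (h₂ : n + p = q)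
    (h₃ : r + p = k) (h₄ : m + n = r) (h₅ : s + n = k) (h₆ : m + p = s)
    (e₁ : b₀ + f + a = d) (e₂ : b₀ + c + b = f) (e₃ : b₀ + c + f' = d) (e₄ : b₀ + b + a = f')
    (e₅ : b₀ + b + f'' = d) (e₆ : b₀ + c + a = f'')
    (u : Q.obj m a) (v : Q.obj n b) (w : Q.obj p c) :
    ∃ (ε ε' : ℤˣ) (ρ : Equiv.Perm (Fin k)), brk Q β h₁ e₁ u (brk Q β h₂ e₂ v w) =
      ε • brk Q β h₃ e₃ (brk Q β h₄ e₄ u v) w +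
      ε' • Q.act ρ (brk Q β h₅ e₅ (brk Q β h₆ e₆ u w) v) := by
  obtain ⟨ε₁, ε₂, hJ⟩ := hJ
  have e : b₀ + b₀ + c + b + a = d := by rw [← e₁, ← e₂]; abel
  have hk : m + n + p = k := by omega
  have hk' : m + p + n = k := by omega
  have e' : b₀ + b₀ + b + c + a = d := by rw [← e]; abel
  obtain ⟨ε₃, h3⟩ := ternComp_brk_left Q β hk e h₃ h₄ e₄ e₃ u v w
  obtain ⟨ε₄, h4⟩ := ternComp_brk_left Q β hk' e' h₅ h₆ e₆ e₅ u w v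
  obtain ⟨ε₅, ρ, h5⟩ := ternComp_swap Q hk hk' e e'
    (Q.comp (m := 2) (n := 2) (k := 3) (by omega) rfl 0 β β) u v w
  refine ⟨ε₁ * ε₃, ε₂ * ε₅ * ε₄, ρ, ?_⟩
  rw [← ternComp_brk_right Q β hk e h₁ h₂ e₂ e₁, hJ]
  have add : ∀ x y, ternComp Q hk e (x + y) u v w =
      ternComp Q hk e x u v w + ternComp Q hk e y u v w := by
    intro x y; simp [ternComp]
  have smul : ∀ (ε : ℤˣ) x, ternComp Q hk e (ε • x) u v w =
      ε • ternComp Q hk e x u v w := by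
    intro ε x; simp only [ternComp, comp_units_smul_left]
  rw [add, smul, smul, h3, h5, h4, act_units_smul, smul_smul, smul_smul, smul_smul]

variable {Q β} in
/-- A unary operation that is a derivation of `β` is a derivation of the bracket. -/
theorem comp_brk_of_derivation {δ : Γ} (D : Q.obj 1 δ) {g : Γ} (eg : δ + b₀ = g) (eg' : b₀ + δ = g)
    (hD : Q.comp (m := 1) (n := 2) (k := 2) (by omega) eg 0 D β =
      Q.comp (m := 2) (n := 1) (k := 2) (by omega) eg' 0 β D +
      Q.comp (m := 2) (n := 1) (k := 2) (by omega) eg' 1 β D)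
    {m n k : ℕ} {a b c d a' b' : Γ} (h : m + n = k) (hm : 1 + m = m + 1) (hn : 1 + n = n + 1)
    (hk : 1 + k = k + 1) (e : b₀ + b + a = c) (e₁ : δ + c = d) (e₂ : δ + a = a') (e₃ : δ + b = b')
    (e₄ : b₀ + b + a' = d) (e₅ : b₀ + b' + a = d) (u : Q.obj m a) (v : Q.obj n b) :
    ∃ ε : ℤˣ, Q.comp hk e₁ 0 D (brk Q β h e u v) =
      ε • brk Q β h e₄ (Q.comp hm e₂ 0 D u) v + brk Q β h e₅ u (Q.comp hn e₃ 0 D v) := by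
  subst e₂ e₃ eg
  obtain ⟨ε, hε⟩ := exists_parallel Q (l := 2) (m := 1) (n := n) (p := 2) (q := n + 1) (r := n + 1)
    (by omega) (by omega) (by omega) (by omega) eg' rfl rfl
    (by rw [add_assoc δ, add_comm δ] : b₀ + b + δ = δ + b₀ + b) 0 1 1 0 (by decide) (by simp) rfl β D v
  refine ⟨ε, ?_⟩
  rw [brk_apply, ← Q.assoc (l := 1) (m := n + 1) (n := m) (p := n + 1) (q := k) (r := k)
    (d := δ + b₀ + b) (by omega) (by omega)
    (by omega) hk (by rw [add_assoc]) (by rw [← e₁, ← e]; abel) _ _ 0 0 0 (by simp) D _ u,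
    ← Q.assoc (l := 1) (m := 2) (n := n) (p := 2) (q := n + 1) (r := n + 1) (by omega) (by omega)
    (by omega) (by omega) rfl rfl rfl (add_assoc _ _ _).symm 0 1 1 (by simp) D _ v, hD, LinearMap.map_add₂,
    map_add, LinearMap.add_apply, hε, comp_units_smul_left, brk_apply, brk_apply]
  congr 1
  · congr 1
    exact Q.assoc _ _ _ _ _ _ _ _ _ _ _ (by simp) _ _ _
  · rw [comp_comp_deg Q (d' := b₀ + (δ + b)) (e₂' := e₅), Q.assoc (l := 2) (m := 1) (n := n) (p := 2)
      (q := n) (by omega) (by omega) hn (by omega) _ _ rfl _ 1 0 1 (by simp) β D v]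
    rw [← eg', add_assoc]

end Bracket

/-! ### The universal property of an operad given by generators and relations -/

section Lift

variable {K : Type u} [Field K] {Γ : Type w} [AddCommGroup Γ] {par : Γ →+ ℤ} {G : ℕ → Γ → Type w}
  (Q : GradedOperad.{u, v, w} K Γ par) (φ : ∀ {n : ℕ} {g : Γ}, G n g → Q.obj n g)

/-- The value of a formal composite in an operad, given the values of the generators. -/
def evalMon : ∀ {n : ℕ} {g : Γ}, Mon G n g → Q.obj n g
  | _, _, .gen x => φ x
  | _, _, .one => Q.one
  | _, _, .act σ x => Q.act σ (evalMon x)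
  | _, _, .comp h e i x y => Q.comp h e i (evalMon x) (evalMon y)

/-- The linear extension of `evalMon`. -/
def evalLin {n : ℕ} {g : Γ} : Lin K G n g →ₗ[K] Q.obj n g :=
  Finsupp.linearCombination K (evalMon Q φ)

theorem evalLin_mon {n : ℕ} {g : Γ} (x : Mon G n g) : evalLin Q φ (mon x) = evalMon Q φ x := by
  simp [evalLin]

theorem evalLin_act {n : ℕ} {g : Γ} (σ : Equiv.Perm (Fin n)) (x : Lin K G n g) :
    evalLin Q φ (linAct σ x) = Q.act σ (evalLin Q φ x) := by
  induction x using Finsupp.induction_linear with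
  | zero => simp
  | add x y hx hy => simp [hx, hy]
  | single x r => simp [evalLin, linAct, evalMon]

theorem evalLin_comp {m n k : ℕ} {a b c : Γ} (h : m + n = k + 1) (e : a + b = c) (i : Fin m)
    (x : Lin K G m a) (y : Lin K G n b) :
    evalLin Q φ (linComp h e i x y) = Q.comp h e i (evalLin Q φ x) (evalLin Q φ y) := by
  induction x using Finsupp.induction_linear with
  | zero => simp
  | add x y hx hy => simp [hx, hy]
  | single x r =>
    induction y using Finsupp.induction_linear with
    | zero => simp
    | add x y hx hy => simp [hx, hy]
    | single y s =>
      have h1 : ∀ {n : ℕ} {g : Γ} (x : Mon G n g) (r : K), Finsupp.single x r = r • mon x := by simp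
      rw [h1 x, h1 y]
      simp only [map_smul, LinearMap.smul_apply, linComp_mon, evalLin_mon, evalMon]

theorem evalLin_eq_zero {R : ∀ {n : ℕ} {g : Γ}, Lin K G n g → Prop}
    (hR : ∀ {n : ℕ} {g : Γ} (x : Lin K G n g), R x → evalLin Q φ x = 0) {n : ℕ} {g : Γ}
    {x : Lin K G n g} (hx : InIdeal par R x) : evalLin Q φ x = 0 := by
  induction hx with
  | rel h => exact hR _ h
  | zero => exact map_zero _
  | add _ _ hx hy => rw [map_add, hx, hy, add_zero]
  | smul c _ hx => rw [map_smul, hx, smul_zero]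
  | act σ _ hx => rw [evalLin_act, hx, map_zero]
  | comp_left h e i y _ hx => rw [evalLin_comp, hx, map_zero, LinearMap.zero_apply]
  | comp_right h e i x _ hy => rw [evalLin_comp, hy, map_zero]
  | act_one x => rw [map_sub, evalLin_mon, evalLin_mon, evalMon, act_one_apply, sub_self]
  | act_mul σ τ x =>
    rw [map_sub, evalLin_mon, evalLin_mon, evalMon, evalMon, evalMon, act_act, sub_self]
  | one_comp h e y =>
    rw [map_sub, evalLin_mon, evalLin_mon, evalMon, evalMon, Q.one_comp, sub_self]
  | comp_one h e i y =>
    rw [map_sub, evalLin_mon, evalLin_mon, evalMon, evalMon, Q.comp_one, sub_self]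
  | act_comp h e i σ τ ρ hρ x y =>
    rw [map_sub, evalLin_mon, evalLin_mon]
    simp only [evalMon]
    rw [Q.act_comp h e i σ τ ρ hρ, sub_self]
  | assoc h₁ h₂ h₃ h₄ e₁ e₂ e₃ e₄ i j s hs x y z =>
    rw [map_sub, evalLin_mon, evalLin_mon]
    simp only [evalMon]
    rw [Q.assoc h₁ h₂ h₃ h₄ e₁ e₂ e₃ e₄ i j s hs, sub_self]
  | parallel h₁ h₂ h₃ h₄ e₁ e₂ e₃ e₄ i j s t hij hs ht x y z =>
    rw [map_sub, Units.smul_def, map_zsmul, evalLin_mon, evalLin_mon]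
    simp only [evalMon]
    rw [Q.parallel h₁ h₂ h₃ h₄ e₁ e₂ e₃ e₄ i j s t hij hs ht, Units.smul_def, sub_self]

/-- The morphism from an operad given by generators and relations that is determined by values of
the generators that satisfy the relations. -/
def presentedLift {R : ∀ {n : ℕ} {g : Γ}, Lin K G n g → Prop}
    (hR : ∀ {n : ℕ} {g : Γ} (x : Lin K G n g), R x → evalLin Q φ x = 0) :
    OperadHom (presented K G par R) Q where
  map {n g} := (ideal par R n g).liftQ (evalLin Q φ) fun _ hx => evalLin_eq_zero Q φ hR hx
  map_act σ x := by
    obtain ⟨x, rfl⟩ := Submodule.Quotient.mk_surjective _ x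
    exact evalLin_act Q φ σ x
  map_one := evalLin_mon Q φ .one
  map_comp h e i x y := by
    obtain ⟨x, rfl⟩ := Submodule.Quotient.mk_surjective _ x
    obtain ⟨y, rfl⟩ := Submodule.Quotient.mk_surjective _ y
    exact evalLin_comp Q φ h e i x y

theorem presentedLift_gen {R : ∀ {n : ℕ} {g : Γ}, Lin K G n g → Prop}
    (hR : ∀ {n : ℕ} {g : Γ} (x : Lin K G n g), R x → evalLin Q φ x = 0) {n : ℕ} {g : Γ}
    (x : G n g) : (presentedLift Q φ hR).map (presentedGen K par R x) = φ x :=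
  evalLin_mon Q φ (.gen x)

/-- Induction over an operad given by generators and relations. -/
theorem presented_induction {R : ∀ {n : ℕ} {g : Γ}, Lin K G n g → Prop}
    (S : ∀ n g, Submodule K ((presented K G par R).obj n g))
    (gen : ∀ {n : ℕ} {g : Γ} (x : G n g), presentedGen K par R x ∈ S n g)
    (one : (presented K G par R).one ∈ S 1 0)
    (act : ∀ {n : ℕ} {g : Γ} (σ : Equiv.Perm (Fin n)) (x : (presented K G par R).obj n g),
      x ∈ S n g → (presented K G par R).act σ x ∈ S n g)
    (comp : ∀ {m n k : ℕ} {a b c : Γ} (h : m + n = k + 1) (e : a + b = c) (i : Fin m)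
      (x : (presented K G par R).obj m a) (y : (presented K G par R).obj n b),
      x ∈ S m a → y ∈ S n b → (presented K G par R).comp h e i x y ∈ S k c)
    {n : ℕ} {g : Γ} (x : (presented K G par R).obj n g) : x ∈ S n g := by
  refine quot_induction (p := (· ∈ S n g)) (zero_mem _) (fun x y => add_mem)
    (fun r x => Submodule.smul_mem _ r) (fun y => ?_) x
  clear x
  induction y with
  | gen x => exact gen x
  | one => exact one
  | act σ x hx =>
    rw [← quotAct_mon]
    exact act σ _ hx
  | comp h e i x y hx hy =>
    rw [← quotComp_mon]
    exact comp h e i _ _ hx hy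

theorem presented_rel {R : ∀ {n : ℕ} {g : Γ}, Lin K G n g → Prop} {n : ℕ} {g : Γ}
    {x y : Lin K G n g} (h : R (x - y)) :
    (Submodule.Quotient.mk x : (presented K G par R).obj n g) = Submodule.Quotient.mk y :=
  (Submodule.Quotient.eq _).2 (InIdeal.rel h)

end Lift

/-! ### The relations of `Lie` and of `O` -/

section Relations

variable (K : Type u) [Field K]

/-- The bracket of `Lie`. -/
def lieBr : (Lie K).obj 2 () := presentedGen K 0 (LieRel K) .bracket

theorem lieBr_swap : (Lie K).act (Equiv.swap 0 1) (lieBr K) = -lieBr K := by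
  rw [eq_neg_iff_add_eq_zero, add_comm]
  exact (Submodule.Quotient.mk_eq_zero _).2 (InIdeal.rel (LieRel.skew))

/-- The Jacobi identity in the form `{1,{2,3}} = {{1,2},3} - {{1,3},2}`. -/
theorem lieBr_jacobi : (Lie K).comp (m := 2) (n := 2) (k := 3) (a := ()) (b := ()) rfl rfl 1
      (lieBr K) (lieBr K) =
    (Lie K).comp (m := 2) (n := 2) (k := 3) (a := ()) (b := ()) rfl rfl 0 (lieBr K) (lieBr K) -
    (Lie K).act (Equiv.swap 1 2)
      ((Lie K).comp (m := 2) (n := 2) (k := 3) (a := ()) (b := ()) rfl rfl 0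
        (lieBr K) (lieBr K)) := by
  set x := (Lie K).comp (m := 2) (n := 2) (k := 3) (a := ()) (b := ()) (c := ()) rfl rfl 0
        (lieBr K) (lieBr K) with hx
  have h0 : x + (Lie K).act (finRotate 3) x +
      (Lie K).act (finRotate 3) ((Lie K).act (finRotate 3) x) = 0 :=
    (Submodule.Quotient.mk_eq_zero _).2 (InIdeal.rel (LieRel.jacobi rfl rfl _ rfl))
  have h1 := (Lie K).act_comp (m := 2) (n := 2) (k := 3) (a := ()) (b := ()) (c := ()) rfl rfl 0
    (Equiv.swap 0 1) 1 (finRotate 3) (by constructor <;> decide) (lieBr K) (lieBr K)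
  have h2 := (Lie K).act_comp (m := 2) (n := 2) (k := 3) (a := ()) (b := ()) (c := ()) rfl rfl 0
    1 (Equiv.swap 0 1) (Equiv.swap 0 1) (by constructor <;> decide) (lieBr K) (lieBr K)
  rw [lieBr_swap, act_one_apply, ← hx, map_neg, LinearMap.neg_apply, Equiv.swap_apply_left] at h1
  rw [lieBr_swap, act_one_apply, map_neg, Equiv.Perm.one_apply, ← hx] at h2
  have h3 : finRotate 3 * finRotate 3 = Equiv.swap 1 2 * Equiv.swap (0 : Fin 3) 1 := by decide
  rw [act_act, h3, ← act_act, ← h2, ← h1, map_neg] at h0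
  rw [← sub_eq_zero, ← neg_eq_zero, ← h0]
  abel

/-- The product of `O`. -/
def oMul : (OOperad K).obj 2 (0, -1) := presentedGen K degreeHom (ORel K) .mul

/-- The operator `d_{n+1}` of `O`. -/
def oD (n : ℕ) : (OOperad K).obj 1 (1, ((n + 1 : ℕ) : ℤ)) :=
  presentedGen K degreeHom (ORel K) (.d (n + 1) (by omega))

theorem oMul_swap : (OOperad K).act (Equiv.swap 0 1) (oMul K) = oMul K :=
  (presented_rel (.comm)).symm

theorem oMul_assoc {c : ℤ × ℤ} (h : 2 + 2 = 3 + 1) (e : ((0, -1) : ℤ × ℤ) + (0, -1) = c) :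
    (OOperad K).comp h e 0 (oMul K) (oMul K) = (OOperad K).comp h e 1 (oMul K) (oMul K) := by
  obtain rfl : c = (0, -2) := e.symm
  exact presented_rel (.assoc h e)

theorem oD_mul (n : ℕ) {c : ℤ × ℤ} (h : 1 + 2 = 2 + 1) (h' : 2 + 1 = 2 + 1)
    (e : ((1, ((n + 1 : ℕ) : ℤ)) : ℤ × ℤ) + (0, -1) = c)
    (e' : ((0, -1) : ℤ × ℤ) + (1, ((n + 1 : ℕ) : ℤ)) = c) :
    (OOperad K).comp h e 0 (oD K n) (oMul K) =
      (OOperad K).comp h' e' 0 (oMul K) (oD K n) + (OOperad K).comp h' e' 1 (oMul K) (oD K n) := by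
  obtain rfl : c = (1, ((n + 1 : ℕ) : ℤ) - 1) := by rw [← e]; rfl
  exact presented_rel (.deriv (n + 1) _ h h' e e')

end Relations

/-! ### Membership in spans and brackets with the identity -/

theorem bilin_mem_of_span {K A B C : Type*} [Field K] [AddCommGroup A] [AddCommGroup B]
    [AddCommGroup C] [Module K A] [Module K B] [Module K C] (f : A →ₗ[K] B →ₗ[K] C) {s : Set A}
    {t : Set B} {S : Submodule K C} (h : ∀ x ∈ s, ∀ y ∈ t, f x y ∈ S) {x : A} {y : B}
    (hx : x ∈ Submodule.span K s) (hy : y ∈ Submodule.span K t) : f x y ∈ S := by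
  induction hx using Submodule.span_induction with
  | zero => simp
  | add x x' _ _ hx hx' => simpa using add_mem hx hx'
  | smul r x _ hx => simpa using S.smul_mem r hx
  | mem x hx =>
    induction hy using Submodule.span_induction with
    | zero => simp
    | add x x' _ _ hx hx' => simpa using add_mem hx hx'
    | smul r x _ hx => simpa using S.smul_mem r hx
    | mem y hy => exact h x hx y hy

theorem units_smul_mem {K A : Type*} [Field K] [AddCommGroup A] [Module K A] (S : Submodule K A)
    (ε : ℤˣ) {x : A} (hx : x ∈ S) : ε • x ∈ S := by
  rw [Units.smul_def]; exact zsmul_mem hx _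

section Unit

variable {K : Type u} [Field K] {Γ : Type w} [AddCommGroup Γ] {par : Γ →+ ℤ}
  (Q : GradedOperad.{u, v, w} K Γ par) {b₀ : Γ} (β : Q.obj 2 b₀)

/-- The partial composition `x ∘ᵢ y` as a linear map in `x`. -/
def compRight {m n k : ℕ} {a b c : Γ} (h : m + n = k + 1) (e : a + b = c) (i : Fin m)
    (y : Q.obj n b) : Q.obj m a →ₗ[K] Q.obj k c :=
  (Q.comp h e i).flip y

/-- The operation `β(x, y)` as a linear map in `x`. -/
def brkRight {m n k : ℕ} (h : m + n = k) {a b c : Γ} (e : b₀ + b + a = c) (y : Q.obj n b) :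
    Q.obj m a →ₗ[K] Q.obj k c :=
  (brk Q β h e).flip y

theorem brk_units_smul_left {m n k : ℕ} (h : m + n = k) {a b c : Γ} (e : b₀ + b + a = c)
    (ε : ℤˣ) (x : Q.obj m a) (y : Q.obj n b) :
    brk Q β h e (ε • x) y = ε • brk Q β h e x y := by
  rw [Units.smul_def, Units.smul_def, map_zsmul, LinearMap.smul_apply]

theorem brk_one {m k : ℕ} {a c : Γ} (h : m + 1 = k) (e : b₀ + 0 + a = c) (h' : 2 + m = k + 1)
    (e' : b₀ + a = c) (x : Q.obj m a) : brk Q β h e x Q.one = Q.comp h' e' 0 β x := by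
  rw [brk_apply, comp_comp_deg Q (d' := b₀) (e₁' := add_zero _) (e₂' := e')]
  rw [Q.comp_one]

/-- Inserting `y` at the last input of `β(x, 1)` gives `β(x, y)`, up to sign. -/
theorem comp_brk_one {m n k q : ℕ} {a b c d : Γ} (h : m + 1 = q) (e : b₀ + 0 + a = d)
    (h' : m + n = k) (e' : b₀ + b + a = c) (h₁ : q + n = k + 1) (e₁ : d + b = c)
    (i : Fin q) (hi : i.val = m) (x : Q.obj m a) (y : Q.obj n b) :
    ∃ ε : ℤˣ, Q.comp h₁ e₁ i (brk Q β h e x Q.one) y = ε • brk Q β h' e' x y := by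
  obtain ⟨ε, hε⟩ := brk_comp_right β h e h₁ e₁ (by omega : 1 + n = n + 1) (zero_add b) h' e' i 0
    (by simp [hi]) x Q.one y
  exact ⟨ε, by rw [hε, Q.one_comp]⟩

end Unit

/-! ### `Lie` is spanned by left-normed brackets -/

section LieSpan

variable (K : Type u) [Field K]

/-- The span of the relabelled left-normed brackets. -/
def lieSpan (n : ℕ) : Submodule K ((Lie K).obj n ()) :=
  Submodule.span K {x | ∃ (k : ℕ) (σ : Equiv.Perm (Fin (k + 1))),
    (⟨n, x⟩ : Σ n, (Lie K).obj n ()) = ⟨k + 1, (Lie K).act σ (leftNormed K k)⟩}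

variable {K}

theorem leftNormed_mem_lieSpan (k : ℕ) (σ : Equiv.Perm (Fin (k + 1))) :
    (Lie K).act σ (leftNormed K k) ∈ lieSpan K (k + 1) :=
  Submodule.subset_span ⟨k, σ, rfl⟩

theorem leftNormed_mem_lieSpan' (k : ℕ) : leftNormed K k ∈ lieSpan K (k + 1) := by
  have := leftNormed_mem_lieSpan (K := K) k 1
  rwa [act_one_apply] at this

theorem lieSpan_induction {n : ℕ} {S : Submodule K ((Lie K).obj n ())}
    (hS : ∀ (k : ℕ) (σ : Equiv.Perm (Fin (k + 1))) (h : n = k + 1),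
      (h ▸ (Lie K).act σ (leftNormed K k) : (Lie K).obj n ()) ∈ S) : lieSpan K n ≤ S := by
  refine Submodule.span_le.2 ?_
  rintro x ⟨k, σ, h⟩
  cases h
  exact hS k σ rfl

theorem act_mem_lieSpan {n : ℕ} (σ : Equiv.Perm (Fin n)) {x : (Lie K).obj n ()}
    (hx : x ∈ lieSpan K n) : (Lie K).act σ x ∈ lieSpan K n := by
  revert x
  change lieSpan K n ≤ (lieSpan K n).comap ((Lie K).act σ)
  refine lieSpan_induction fun k τ h => ?_
  subst h
  rw [Submodule.mem_comap]
  simp only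
  rw [act_act]
  exact leftNormed_mem_lieSpan k _

theorem leftNormed_succ (k : ℕ) : leftNormed K (k + 1) =
    brk (Lie K) (lieBr K) (a := ()) (b := ()) rfl rfl (leftNormed K k) (Lie K).one :=
  (brk_one (Lie K) (lieBr K) (a := ()) (c := ()) rfl rfl (by omega) rfl _).symm

/-- The Jacobi identity in the form in which `brk_jacobi` needs it. -/
theorem lieBr_hJ : ∃ ε ε' : ℤˣ, (Lie K).comp (m := 2) (n := 2) (k := 3) (by omega) rfl 1
      (lieBr K) (lieBr K) =
      ε • (Lie K).comp (m := 2) (n := 2) (k := 3) (by omega) rfl 0 (lieBr K) (lieBr K) +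
      ε' • (Lie K).act (Equiv.swap 1 2)
        ((Lie K).comp (m := 2) (n := 2) (k := 3) (by omega) rfl 0 (lieBr K) (lieBr K)) :=
  ⟨1, -1, by
    rw [one_smul, Units.neg_smul, one_smul]
    exact (lieBr_jacobi K).trans (sub_eq_add_neg _ _)⟩

theorem brk_one_mem_lieSpan {m k : ℕ} (h : m + 1 = k) {x : (Lie K).obj m ()}
    (hx : x ∈ lieSpan K m) :
    brk (Lie K) (lieBr K) (a := ()) (b := ()) (c := ()) h rfl x (Lie K).one ∈ lieSpan K k := by
  subst h
  let f : (Lie K).obj m () →ₗ[K] (Lie K).obj (m + 1) () :=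
    brkRight (Lie K) (lieBr K) (a := ()) (b := ()) (c := ()) rfl rfl (Lie K).one
  suffices lieSpan K m ≤ (lieSpan K (m + 1)).comap f from this hx
  refine lieSpan_induction fun k τ h => ?_
  subst h
  rw [Submodule.mem_comap]
  simp only [f, brkRight, LinearMap.flip_apply]
  obtain ⟨ρ, hρ⟩ := brk_act (lieBr K) (a := ()) (b := ()) (c := ()) (rfl : k + 1 + 1 = _) rfl τ 1
    (leftNormed K k) (Lie K).one
  rw [act_one_apply] at hρ
  rw [hρ, ← leftNormed_succ]
  exact leftNormed_mem_lieSpan _ _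

/-- By the Jacobi identity, a bracket with `{y, 1}` in its second argument is reduced to brackets
with `y` and with `1`. -/
theorem brk_leftNormed_mem_lieSpan (k : ℕ) : ∀ {m q : ℕ} (h : m + (k + 1) = q)
    {x : (Lie K).obj m ()}, x ∈ lieSpan K m →
    brk (Lie K) (lieBr K) (a := ()) (b := ()) (c := ()) h rfl x (leftNormed K k) ∈
      lieSpan K q := by
  induction k with
  | zero =>
    intro m q h x hx
    exact brk_one_mem_lieSpan h hx
  | succ k ih =>
    intro m q h x hx
    subst h
    obtain ⟨ε, ε', ρ, e⟩ := brk_jacobi lieBr_hJ (a := ()) (b := ()) (c := ()) (d := ()) (f := ())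
      (f' := ()) (f'' := ()) (rfl : m + (k + 1 + 1) = _) rfl (by omega) (rfl : m + (k + 1) = _)
      (by omega) rfl rfl rfl rfl rfl rfl rfl x (leftNormed K k) (Lie K).one
    rw [leftNormed_succ, e]
    refine add_mem (units_smul_mem _ _ ?_) (units_smul_mem _ _ (act_mem_lieSpan _ ?_))
    · exact brk_one_mem_lieSpan _ (ih _ hx)
    · exact ih _ (brk_one_mem_lieSpan _ hx)

theorem brk_mem_lieSpan {m n q : ℕ} (h : m + n = q) {x : (Lie K).obj m ()} {y : (Lie K).obj n ()}
    (hx : x ∈ lieSpan K m) (hy : y ∈ lieSpan K n) :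
    brk (Lie K) (lieBr K) (a := ()) (b := ()) (c := ()) h rfl x y ∈ lieSpan K q := by
  let f : (Lie K).obj n () →ₗ[K] (Lie K).obj q () :=
    brk (Lie K) (lieBr K) (a := ()) (b := ()) (c := ()) h rfl x
  suffices lieSpan K n ≤ (lieSpan K q).comap f from this hy
  refine lieSpan_induction fun k τ h' => ?_
  subst h'
  rw [Submodule.mem_comap]
  simp only [f]
  obtain ⟨ρ, hρ⟩ := brk_act (lieBr K) (a := ()) (b := ()) (c := ()) h rfl 1 τ x (leftNormed K k)
  rw [act_one_apply] at hρ
  rw [hρ]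
  exact act_mem_lieSpan _ (brk_leftNormed_mem_lieSpan k h hx)

theorem leftNormed_comp_mem_lieSpan (k : ℕ) : ∀ {n q : ℕ} (h : k + 1 + n = q + 1) (i : Fin (k + 1))
    {y : (Lie K).obj n ()}, y ∈ lieSpan K n →
    (Lie K).comp (a := ()) (b := ()) (c := ()) h rfl i (leftNormed K k) y ∈ lieSpan K q := by
  induction k with
  | zero =>
    intro n q h i y hy
    obtain rfl : q = n := by omega
    obtain rfl : i = 0 := by omega
    have := (Lie K).one_comp (b := ()) (by omega : 1 + q = q + 1) rfl y
    exact (congrArg (· ∈ lieSpan K q) this).mpr hy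
  | succ k ih =>
    intro n q h i y hy
    rw [leftNormed_succ]
    by_cases hi : i.val < k + 1
    · rw [brk_comp_left (lieBr K) (a := ()) (b := ()) (c := ()) (g := ()) _ _ h rfl
        (by omega : k + 1 + n = k + n + 1) rfl (by omega) rfl i ⟨i, hi⟩ rfl]
      exact brk_one_mem_lieSpan _ (ih _ _ hy)
    · obtain ⟨ε, e⟩ := comp_brk_one (Lie K) (lieBr K) (a := ()) (b := ()) (c := ()) (d := ())
        (rfl : k + 1 + 1 = _) rfl (by omega) rfl h rfl i (by omega) (leftNormed K k) y
      rw [e]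
      exact units_smul_mem _ _ (brk_mem_lieSpan _ (leftNormed_mem_lieSpan' k) hy)

theorem comp_mem_lieSpan {m n k : ℕ} (h : m + n = k + 1) (i : Fin m) {x : (Lie K).obj m ()}
    {y : (Lie K).obj n ()} (hx : x ∈ lieSpan K m) (hy : y ∈ lieSpan K n) :
    (Lie K).comp (a := ()) (b := ()) (c := ()) h rfl i x y ∈ lieSpan K k := by
  let f : (Lie K).obj m () →ₗ[K] (Lie K).obj k () :=
    compRight (Lie K) (a := ()) (b := ()) (c := ()) h rfl i y
  suffices lieSpan K m ≤ (lieSpan K k).comap f from this hx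
  refine lieSpan_induction fun k' τ h' => ?_
  subst h'
  rw [Submodule.mem_comap]
  simp only [f, compRight, LinearMap.flip_apply]
  obtain ⟨ρ, -, e⟩ := comp_act_left' (Lie K) (a := ()) (b := ()) (c := ()) h rfl i (τ⁻¹ i) τ
    (by simp) (leftNormed K k') y
  rw [e]
  exact act_mem_lieSpan _ (leftNormed_comp_mem_lieSpan k' h _ hy)

/-- `Lie` is spanned by the relabelled left-normed brackets, since their span contains the
generator and is closed under partial compositions. -/
theorem lieSpan_eq_top (n : ℕ) : lieSpan K n = ⊤ := by
  refine eq_top_iff.2 fun x _ => ?_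
  have key := presented_induction (K := K) (G := LieGen) (par := 0) (R := LieRel K)
    (fun n _ => lieSpan K n)
  refine key ?_ ?_ ?_ ?_ x
  · rintro _ _ ⟨⟩
    have : leftNormed K 1 = lieBr K := (Lie K).comp_one (a := ()) (m := 2) _ _ 0 (lieBr K)
    have h1 := leftNormed_mem_lieSpan' (K := K) 1
    rw [this] at h1
    exact h1
  · exact leftNormed_mem_lieSpan' (K := K) 0
  · intro n g σ x hx
    exact act_mem_lieSpan σ hx
  · intro m n k a b c h e i x y hx hy
    exact comp_mem_lieSpan h i hx hy

end LieSpan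

/-! ### `O` is spanned by iterated products of composites of operators -/

section OSpan

variable {K : Type u} [Field K]

theorem iteratedMul_succ (k : ℕ)
    (e : ((0, -1) : ℤ × ℤ) + 0 + (0, -(k : ℤ)) = (0, -((k + 1 : ℕ) : ℤ))) :
    brk (OOperad K) (oMul K) rfl e (iteratedMul K k) (OOperad K).one = iteratedMul K (k + 1) :=
  brk_one (OOperad K) (oMul K) _ _ _ (by ext <;> simp) _

theorem iteratedMul_one : iteratedMul K 1 = oMul K :=
  (OOperad K).comp_one (m := 2) _ _ 0 (oMul K)

/-- Associativity of the product of operations, up to sign. -/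
theorem brk_brk_oMul {m n p k q r : ℕ} {a b c d f f' : ℤ × ℤ} (h₁ : m + q = k) (h₂ : n + p = q)
    (h₃ : r + p = k) (h₄ : m + n = r) (e₁ : (0, -1) + f + a = d) (e₂ : (0, -1) + c + b = f)
    (e₃ : (0, -1) + c + f' = d) (e₄ : (0, -1) + b + a = f') (x : (OOperad K).obj m a)
    (y : (OOperad K).obj n b) (z : (OOperad K).obj p c) :
    ∃ ε : ℤˣ, brk (OOperad K) (oMul K) h₁ e₁ x (brk (OOperad K) (oMul K) h₂ e₂ y z) =
      ε • brk (OOperad K) (oMul K) h₃ e₃ (brk (OOperad K) (oMul K) h₄ e₄ x y) z := by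
  have hk : m + n + p = k := by omega
  have e : ((0, -1) : ℤ × ℤ) + (0, -1) + c + b + a = d := by rw [← e₁, ← e₂]; abel
  obtain ⟨ε, hε⟩ := ternComp_brk_left (OOperad K) (oMul K) hk e h₃ h₄ e₄ e₃ x y z
  exact ⟨ε, by rw [← hε, ← ternComp_brk_right (OOperad K) (oMul K) hk e h₁ h₂ e₂ e₁, oMul_assoc]⟩

theorem brk_iteratedMul (n : ℕ) : ∀ (m k : ℕ) (h : m + 1 + (n + 1) = k + 1)
    (e : ((0, -1) : ℤ × ℤ) + (0, -(n : ℤ)) + (0, -(m : ℤ)) = (0, -(k : ℤ))),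
    ∃ ε : ℤˣ, brk (OOperad K) (oMul K) h e (iteratedMul K m) (iteratedMul K n) =
      ε • iteratedMul K k := by
  induction n with
  | zero =>
    intro m k h e
    obtain rfl : k = m + 1 := by omega
    exact ⟨1, by rw [one_smul]; exact iteratedMul_succ m e⟩
  | succ n ih =>
    intro m k h e
    obtain rfl : k = m + n + 2 := by omega
    obtain ⟨ε, hε⟩ := brk_brk_oMul (K := K) (a := (0, -(m : ℤ))) (b := (0, -(n : ℤ)))
      (c := 0) (f := (0, -((n + 1 : ℕ) : ℤ))) (f' := (0, -((m + n + 1 : ℕ) : ℤ))) h rfl rfl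
      (by omega : m + 1 + (n + 1) = m + n + 1 + 1) e
      (by ext <;> simp) (by ext <;> simp; omega) (by ext <;> simp; omega)
      (iteratedMul K m) (iteratedMul K n) (OOperad K).one
    obtain ⟨ε', hε'⟩ := ih m (m + n + 1) (by omega) (by ext <;> simp; omega)
    refine ⟨ε * ε', ?_⟩
    rw [iteratedMul_succ n] at hε
    refine hε.trans ?_
    rw [hε', brk_units_smul_left, iteratedMul_succ, smul_smul]

theorem iteratedMul_comp (m : ℕ) : ∀ (n k : ℕ) (h : m + 1 + (n + 1) = k + 1 + 1)
    (e : ((0, -(m : ℤ)) : ℤ × ℤ) + (0, -(n : ℤ)) = (0, -(k : ℤ))) (i : Fin (m + 1)),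
    ∃ ε : ℤˣ, (OOperad K).comp h e i (iteratedMul K m) (iteratedMul K n) =
      ε • iteratedMul K k := by
  induction m with
  | zero =>
    intro n k h e i
    obtain rfl : k = n := by omega
    obtain rfl : i = 0 := by omega
    exact ⟨1, by rw [one_smul]; exact (OOperad K).one_comp (by omega) (zero_add _) _⟩
  | succ m ih =>
    intro n k h e i
    rw [← iteratedMul_succ m (by ext <;> simp)]
    obtain rfl : k = m + n + 1 := by omega
    by_cases hi : i.val < m + 1
    · obtain ⟨ε, hε⟩ := ih n (m + n) (by omega) (by ext <;> simp; omega) ⟨i, hi⟩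
      rw [brk_comp_left (a := (0, -(m : ℤ))) (b := 0) (c := (0, -(n : ℤ)))
        (g := (0, -((m + n : ℕ) : ℤ))) (oMul K) _ _ h e
        (by omega : m + 1 + (n + 1) = m + n + 1 + 1) (by ext <;> simp; omega) (by omega)
        (by ext <;> simp) i ⟨i, hi⟩ rfl, hε]
      refine ⟨ε, ?_⟩
      rw [brk_units_smul_left, iteratedMul_succ]
    · obtain ⟨ε, hε⟩ := comp_brk_one (a := (0, -(m : ℤ))) (b := (0, -(n : ℤ)))
        (d := (0, -((m + 1 : ℕ) : ℤ))) (OOperad K) (oMul K) (rfl : m + 1 + 1 = _)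
        (by ext <;> simp)
        (by omega : m + 1 + (n + 1) = m + n + 1 + 1) (by ext <;> simp; omega) h e i (by omega)
        (iteratedMul K m) (iteratedMul K n)
      obtain ⟨ε', hε'⟩ := brk_iteratedMul (K := K) n m (m + n + 1) (by omega)
        (by ext <;> simp; omega)
      exact ⟨ε * ε', by rw [hε, hε', smul_smul]⟩

theorem isBlockPerm_swap {k : ℕ} (h : k + 1 + 2 = k + 2 + 1) (i : Fin (k + 1)) :
    IsBlockPerm h i 1 (Equiv.swap 0 1) (Equiv.swap i.castSucc i.succ) := by
  constructor
  · intro j hne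
    have hne' : j.val ≠ i.val := fun e => hne (Fin.ext e)
    refine Equiv.swap_apply_of_ne_of_ne (fun e => ?_) (fun e => ?_) <;>
    · simp only [outerPos, Fin.ext_iff, Fin.val_castSucc, Fin.val_succ] at e
      split at e <;> omega
  · intro l
    have h0 : innerPos h i 0 = i.castSucc := by ext; simp [innerPos]
    have h1 : innerPos h i 1 = i.succ := by ext; simp [innerPos]
    fin_cases l
    · simp only [Fin.zero_eta, Equiv.swap_apply_left, Equiv.Perm.one_apply]
      rw [h0, h1, Equiv.swap_apply_left]
    · simp only [Fin.mk_one, Equiv.swap_apply_right, Equiv.Perm.one_apply]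
      rw [h0, h1, Equiv.swap_apply_right]

/-- The iterated product is symmetric, up to sign. It suffices to check this on the transpositions of
neighbours. -/
theorem act_iteratedMul (k : ℕ) (σ : Equiv.Perm (Fin (k + 1))) :
    ∃ ε : ℤˣ, (OOperad K).act σ (iteratedMul K k) = ε • iteratedMul K k := by
  have hσ : σ ∈ Submonoid.closure
      (Set.range fun i : Fin k => Equiv.swap i.castSucc i.succ) := by
    rw [Equiv.Perm.mclosure_swap_castSucc_succ]; trivial
  induction hσ using Submonoid.closure_induction with
  | one => exact ⟨1, by rw [act_one_apply, one_smul]⟩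
  | mul σ τ _ _ hσ hτ =>
    obtain ⟨ε, hε⟩ := hσ
    obtain ⟨ε', hε'⟩ := hτ
    exact ⟨ε' * ε, by rw [← act_act, hε', act_units_smul, hε, smul_smul]⟩
  | mem σ hσ =>
    obtain ⟨i, rfl⟩ := hσ
    obtain _ | k := k
    · exact i.elim0
    obtain ⟨ε, hε⟩ := iteratedMul_comp (K := K) k 1 (k + 1) (by omega) (by ext <;> simp; omega) i
    have hc := (OOperad K).act_comp (by omega) (by ext <;> simp; omega) i 1 (Equiv.swap 0 1) _
      (isBlockPerm_swap (by omega) i) (iteratedMul K k) (iteratedMul K 1)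
      (c := (0, -((k + 1 : ℕ) : ℤ)))
    have h1 : (OOperad K).act (Equiv.swap 0 1) (iteratedMul K 1) = iteratedMul K 1 := by
      rw [iteratedMul_one]; exact oMul_swap K
    rw [act_one_apply, h1] at hc
    refine ⟨1, ?_⟩
    have h2 : iteratedMul K (k + 1) = ε⁻¹ • (OOperad K).comp (m := k + 1) (n := 2) (by omega)
        (by ext <;> simp; omega) i (iteratedMul K k) (iteratedMul K 1) := by
      rw [hε, inv_smul_smul]
    rw [one_smul]
    conv_lhs => rw [h2]
    rw [act_units_smul]
    refine (congrArg (ε⁻¹ • ·) hc.symm).trans ?_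
    exact h2.symm

variable (K) in
/-- The elements of `O` that are built from iterated products by linear combinations and by
inserting operators `d n` at inputs. -/
inductive IsMulD : ∀ {n : ℕ} {g : ℤ × ℤ}, (OOperad K).obj n g → Prop
  | mul (k : ℕ) : IsMulD (iteratedMul K k)
  | zero {n : ℕ} {g : ℤ × ℤ} : IsMulD (0 : (OOperad K).obj n g)
  | add {n : ℕ} {g : ℤ × ℤ} {x y : (OOperad K).obj n g} : IsMulD x → IsMulD y → IsMulD (x + y)
  | smul {n : ℕ} {g : ℤ × ℤ} (r : K) {x : (OOperad K).obj n g} : IsMulD x → IsMulD (r • x)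
  | comp {n k : ℕ} {a c : ℤ × ℤ} (h : n + 1 = k + 1) {j : ℕ} (e : a + (1, ((j + 1 : ℕ) : ℤ)) = c)
      (i : Fin n) {x : (OOperad K).obj n a} : IsMulD x → IsMulD ((OOperad K).comp h e i x (oD K j))

theorem IsMulD.units_smul {n : ℕ} {g : ℤ × ℤ} (ε : ℤˣ) {x : (OOperad K).obj n g}
    (hx : IsMulD K x) : IsMulD K (ε • x) := by
  rw [Units.smul_def, ← Int.cast_smul_eq_zsmul K]
  exact hx.smul _

/-- The block permutation for the insertion of a unary operation. -/
theorem isBlockPerm_unary {m : ℕ} (h : m + 1 = m + 1) (i : Fin m) (σ : Equiv.Perm (Fin m)) :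
    IsBlockPerm h i σ 1 σ := by
  have h1 : ∀ (i j : Fin m) (hne : j ≠ i), outerPos h i j hne = j := by
    intro i j hne; ext; simp only [outerPos]; split <;> omega
  have h2 : ∀ (i : Fin m) (l : Fin 1), innerPos h i l = i := by
    intro i l; ext; simp [innerPos]
  exact ⟨fun j hne => by rw [h1, h1], fun l => by rw [h2, h2]⟩

theorem IsMulD.act {n : ℕ} {g : ℤ × ℤ} {x : (OOperad K).obj n g} (hx : IsMulD K x)
    (σ : Equiv.Perm (Fin n)) : IsMulD K ((OOperad K).act σ x) := by
  induction hx with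
  | mul k =>
    obtain ⟨ε, hε⟩ := act_iteratedMul (K := K) k σ
    rw [hε]
    exact .units_smul _ (.mul k)
  | zero => rw [map_zero]; exact .zero
  | add _ _ hx hy => rw [map_add]; exact (hx σ).add (hy σ)
  | smul r _ hx => rw [map_smul]; exact (hx σ).smul r
  | @comp n k a c h j e i x hx ih =>
    obtain rfl : k = n := by omega
    have := (OOperad K).act_comp h e i σ 1 σ (isBlockPerm_unary h i σ) x (oD K j)
    rw [act_one_apply] at this
    rw [← this]
    exact .comp h e _ (ih σ)

theorem IsMulD.brk_one {n k : ℕ} {a c : ℤ × ℤ} (h : n + 1 = k) (e : (0, -1) + 0 + a = c)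
    {x : (OOperad K).obj n a} (hx : IsMulD K x) :
    IsMulD K (brk (OOperad K) (oMul K) h e x (OOperad K).one) := by
  induction hx generalizing k c with
  | mul m =>
    subst h
    obtain rfl : c = (0, -((m + 1 : ℕ) : ℤ)) := by rw [← e]; ext <;> simp
    rw [iteratedMul_succ m e]
    exact .mul _
  | zero => rw [map_zero, LinearMap.zero_apply]; exact .zero
  | add _ _ hx hy => rw [map_add, LinearMap.add_apply]; exact (hx h e).add (hy h e)
  | smul r _ hx => rw [map_smul, LinearMap.smul_apply]; exact (hx h e).smul r
  | @comp n k' a c' h' j e' i x hx ih =>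
    rw [← brk_comp_left (oMul K) (rfl : n + 1 = _) rfl (by omega) (by rw [← e, ← e']; abel) h' e'
      h e ⟨i, by omega⟩ i rfl]
    exact .comp _ _ _ (ih rfl rfl)

/-- An operator applied to the output is moved to the inputs by the derivation rule. -/
theorem IsMulD.oD_comp (j : ℕ) {n k : ℕ} {a c : ℤ × ℤ} (h : 1 + n = k + 1)
    (e : (1, ((j + 1 : ℕ) : ℤ)) + a = c) {x : (OOperad K).obj n a} (hx : IsMulD K x) :
    IsMulD K ((OOperad K).comp h e 0 (oD K j) x) := by
  induction hx generalizing k c with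
  | mul m =>
    obtain rfl : k = m + 1 := by omega
    induction m generalizing c with
    | zero =>
      obtain rfl : c = (1, ((j + 1 : ℕ) : ℤ)) := by rw [← e]; ext <;> simp
      have h1 : (OOperad K).comp h e 0 (oD K j) (iteratedMul K 0) = oD K j :=
        (OOperad K).comp_one _ _ _ _
      have h2 : (OOperad K).comp (m := 1) (n := 1) rfl (zero_add _) 0 (iteratedMul K 0) (oD K j) =
        oD K j := (OOperad K).one_comp _ _ _
      rw [h1, ← h2]
      exact .comp _ _ _ (.mul 0)
    | succ m ih =>
      rw [← iteratedMul_succ m (by ext <;> simp)]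
      obtain ⟨ε, hε⟩ := comp_brk_of_derivation (oD K j) rfl (by ext <;> simp)
        (oD_mul K j rfl rfl rfl (by ext <;> simp)) (rfl : m + 1 + 1 = _)
        (by omega : 1 + (m + 1) = m + 1 + 1) (rfl : 1 + 1 = 1 + 1) h (by ext <;> simp) e rfl
        (add_zero _) (by rw [← e]; ext <;> simp; omega) (by rw [← e]; ext <;> simp)
        (iteratedMul K m) (OOperad K).one
      rw [hε, (OOperad K).comp_one]
      refine (IsMulD.brk_one _ _ (ih _ _)).units_smul ε |>.add ?_
      obtain ⟨ε', hε'⟩ := comp_brk_one (a := (0, -(m : ℤ))) (c := c)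
        (d := (0, -((m + 1 : ℕ) : ℤ))) (OOperad K) (oMul K) (rfl : m + 1 + 1 = _) (by ext <;> simp) (rfl : m + 1 + 1 = _)
        (by rw [← e]; ext <;> simp) (by omega) (by rw [← e, add_comm]) (Fin.last (m + 1)) rfl
        (iteratedMul K m) (oD K j)
      have : brk (OOperad K) (oMul K) _ _ (iteratedMul K m) (oD K j) = _ :=
        (inv_smul_eq_iff.2 hε').symm
      rw [this]
      refine .units_smul _ (.comp _ _ _ (.brk_one _ _ (.mul m)))
  | zero => rw [map_zero]; exact .zero
  | add _ _ hx hy => rw [map_add]; exact (hx h e).add (hy h e)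
  | smul r _ hx => rw [map_smul]; exact (hx h e).smul r
  | @comp n k' a c' h' j' e' i x hx ih =>
    rw [← (OOperad K).assoc (by omega : 1 + n = n + 1) (by omega) h' h rfl
      (by rw [← e, ← e']; abel) e' e 0 i i (by simp)]
    exact .comp _ _ _ (ih _ _)

theorem IsMulD.comp_mul {m n k : ℕ} {b c : ℤ × ℤ} (h : m + 1 + n = k + 1)
    (e : (0, -(m : ℤ)) + b = c) (i : Fin (m + 1)) {y : (OOperad K).obj n b} (hy : IsMulD K y) :
    IsMulD K ((OOperad K).comp h e i (iteratedMul K m) y) := by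
  induction hy generalizing k c with
  | mul n =>
    obtain rfl : k = m + n + 1 := by omega
    obtain rfl : c = (0, -((m + n : ℕ) : ℤ)) := by rw [← e]; ext <;> simp; omega
    obtain ⟨ε, hε⟩ := iteratedMul_comp (K := K) m n (m + n) h e i
    rw [hε]
    exact .units_smul _ (.mul _)
  | zero => rw [map_zero]; exact .zero
  | add _ _ hx hy => rw [map_add]; exact (hx h e).add (hy h e)
  | smul r _ hx => rw [map_smul]; exact (hx h e).smul r
  | @comp n k' a c' h' j' e' l x hx ih =>
    rw [← (OOperad K).assoc (p := k) (by omega) (by omega) h' h rfl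
      (by rw [← e, ← e']; abel) e' e i l ⟨i + l, by omega⟩ (by simp)]
    exact .comp _ _ _ (ih _ _)

theorem IsMulD.comp_isMulD {m n k : ℕ} {a b c : ℤ × ℤ} (h : m + n = k + 1) (e : a + b = c)
    (i : Fin m) {x : (OOperad K).obj m a} {y : (OOperad K).obj n b} (hx : IsMulD K x)
    (hy : IsMulD K y) : IsMulD K ((OOperad K).comp h e i x y) := by
  induction hx generalizing n k b c with
  | mul m => exact .comp_mul h e i hy
  | zero => rw [map_zero, LinearMap.zero_apply]; exact .zero
  | add _ _ hx hx' =>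
    rw [map_add, LinearMap.add_apply]; exact (hx h e i hy).add (hx' h e i hy)
  | smul r _ hx => rw [map_smul, LinearMap.smul_apply]; exact (hx h e i hy).smul r
  | @comp m k' a c' h' j' e' l x hx ih =>
    obtain rfl : k' = m := by omega
    rcases lt_trichotomy l.val i.val with hl | hl | hl
    · obtain ⟨ε, hε⟩ := exists_parallel (OOperad K) h' h (by omega : k' + n = k + 1) rfl e' e rfl
        (by rw [← e, ← e']; abel) l i i ⟨l, by omega⟩ hl (by omega) rfl x (oD K j') y
      rw [hε]
      exact .units_smul _ (.comp _ _ _ (ih _ _ _ hy))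
    · obtain rfl : l = i := Fin.ext hl
      rw [(OOperad K).assoc h' h (by omega : 1 + n = n + 1) h e' e rfl
        (by rw [← e, ← e']; abel) l 0 l (by simp)]
      exact ih _ _ _ (.oD_comp _ _ _ hy)
    · obtain ⟨ε, hε⟩ := exists_parallel_symm (OOperad K) (by omega : k' + n = k + 1)
        (by omega : k + 1 = k + 1) h' h rfl (by rw [← e, ← e']; abel) e' e i l ⟨l + n - 1, by omega⟩
        i hl (by simp; omega) rfl x y (oD K j')
      rw [hε]
      exact .units_smul _ (.comp _ _ _ (ih _ _ _ hy))

/-- Every element of `O` is a linear combination of iterated products with operators inserted at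
inputs. -/
theorem isMulD {n : ℕ} {g : ℤ × ℤ} (x : (OOperad K).obj n g) : IsMulD K x := by
  have key := presented_induction (K := K) (G := OGen) (par := degreeHom) (R := ORel K)
    (fun n g => { carrier := {x | IsMulD K x}
                  zero_mem' := .zero
                  add_mem' := .add
                  smul_mem' := fun r _ hx => .smul r hx })
  refine key ?_ ?_ ?_ ?_ x
  · intro n g y
    cases y with
    | d n hn =>
      obtain ⟨n, rfl⟩ : ∃ m, n = m + 1 := ⟨n - 1, by omega⟩
      have h2 : (OOperad K).comp (m := 1) (n := 1) rfl (zero_add _) 0 (iteratedMul K 0) (oD K n) =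
        oD K n := (OOperad K).one_comp _ _ _
      change IsMulD K (oD K n)
      rw [← h2]
      exact .comp _ _ _ (.mul 0)
    | mul =>
      have := IsMulD.mul (K := K) 1
      rw [iteratedMul_one] at this
      exact this
  · exact IsMulD.mul (K := K) 0
  · intro n g σ x hx
    exact IsMulD.act hx σ
  · intro m n k a b c h e i x y hx hy
    exact IsMulD.comp_isMulD h e i hx hy

end OSpan

/-! ### Iterated brackets in `Lie ⊗ O` -/

/-- The bilinear map `x, y ↦ x ⊗ y` into the tensor product of two operads. -/
def tensorMk {K : Type u} [Field K] {Γ : Type w} [AddCommGroup Γ] {par : Γ →+ ℤ}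
    (P : Operad.{u, v} K) (Q : GradedOperad.{u, v', w} K Γ par) {n : ℕ} {g : Γ} :
    P.obj n () →ₗ[K] Q.obj n g →ₗ[K] (tensorOperad P Q).obj n g :=
  TensorProduct.mk K _ _

section Generation

variable (K : Type u) [Field K]

/-- The operad `Lie ⊗ O`, graded by degree and weight, whose part of weight `0` is
`Lie ⊗ D_∞`. -/
def LieO : GradedOperad.{u, u, 0} K (ℤ × ℤ) degreeHom := tensorOperad (Lie K) (OOperad K)

variable {K} in
/-- The element `x ⊗ y` of `Lie ⊗ O`, as a bilinear map. -/
def tm {n : ℕ} {g : ℤ × ℤ} :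
    (Lie K).obj n () →ₗ[K] (OOperad K).obj n g →ₗ[K] (LieO K).obj n g :=
  tensorMk (Lie K) (OOperad K)

/-- The bracket `{1,2} ⊗ (1 ⊗ 1)` of `Lie ⊗ O`. -/
def pBr : (LieO K).obj 2 (0, -1) := tm (lieBr K) (oMul K)

/-- The operator `1 ⊗ d_{n+1}` of `Lie ⊗ O`. -/
def pD (n : ℕ) : (LieO K).obj 1 (1, ((n + 1 : ℕ) : ℤ)) := tm (Lie K).one (oD K n)

/-- The higher derived bracket `{d_{n+1}(1), 2, ..., n+2}` as an element of `Lie ⊗ O`. -/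
def derivedBracket (n : ℕ) : (LieO K).obj (n + 2) (1, 0) := tm (leftNormed K (n + 1)) (dFirst K n)

variable {K}

theorem comp_tm {m n k : ℕ} {a b c : ℤ × ℤ} (h : m + n = k + 1) (e : a + b = c) (i : Fin m)
    (x : (Lie K).obj m ()) (y : (OOperad K).obj m a) (x' : (Lie K).obj n ())
    (y' : (OOperad K).obj n b) :
    (LieO K).comp h e i (tm x y) (tm x' y') =
      tm ((Lie K).comp (a := ()) (b := ()) (c := ()) h rfl i x x')
        ((OOperad K).comp h e i y y') := rfl

theorem act_tm {n : ℕ} {a : ℤ × ℤ} (σ : Equiv.Perm (Fin n))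
    (x : (Lie K).obj n ()) (y : (OOperad K).obj n a) :
    (LieO K).act σ (tm x y) = tm ((Lie K).act σ x) ((OOperad K).act σ y) := rfl

theorem brk_tm {m n k : ℕ} {a b c : ℤ × ℤ} (h : m + n = k) (e : (0, -1) + b + a = c)
    (x : (Lie K).obj m ()) (y : (OOperad K).obj m a) (x' : (Lie K).obj n ())
    (y' : (OOperad K).obj n b) :
    brk (LieO K) (pBr K) h e (tm x y) (tm x' y') =
      tm (brk (Lie K) (lieBr K) (a := ()) (b := ()) (c := ()) h rfl x x')
        (brk (OOperad K) (oMul K) h e y y') := rfl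

theorem tm_units_smul {n : ℕ} {a : ℤ × ℤ} (ε : ℤˣ) (x : (Lie K).obj n ())
    (y : (OOperad K).obj n a) : tm x (ε • y) = ε • tm x y := by
  rw [Units.smul_def, Units.smul_def, map_zsmul]

variable (K) in
/-- The element `x ⊗ y` of `Lie ⊗ O`, as a linear map in `x`. -/
def tmRight {n : ℕ} {g : ℤ × ℤ} (y : (OOperad K).obj n g) :
    (Lie K).obj n () →ₗ[K] (LieO K).obj n g where
  toFun x := tm x y
  map_add' x x' := by rw [map_add, LinearMap.add_apply]
  map_smul' r x := by rw [map_smul, LinearMap.smul_apply]; rfl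

theorem LieO_induction {n : ℕ} {g : ℤ × ℤ} {S : Submodule K ((LieO K).obj n g)}
    (h : ∀ (x : (Lie K).obj n ()) (y : (OOperad K).obj n g), tm x y ∈ S) : S = ⊤ := by
  refine eq_top_iff.2 fun x _ => ?_
  induction x using TensorProduct.induction_on with
  | zero => exact zero_mem _
  | add x y hx hy => exact add_mem (hx trivial) (hy trivial)
  | tmul x y => exact h x y

theorem pBr_swap : (LieO K).act (Equiv.swap 0 1) (pBr K) = -pBr K := by
  rw [pBr, act_tm, lieBr_swap, oMul_swap, map_neg, LinearMap.neg_apply]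

theorem oMul_oMul_swap {c : ℤ × ℤ} (h : 2 + 2 = 3 + 1) (e : ((0, -1) : ℤ × ℤ) + (0, -1) = c) :
    (OOperad K).act (Equiv.swap 1 2) ((OOperad K).comp h e 0 (oMul K) (oMul K)) =
      (OOperad K).comp h e 0 (oMul K) (oMul K) := by
  have hB : IsBlockPerm (rfl : 2 + 2 = 3 + 1) 1 1 (Equiv.swap 0 1) (Equiv.swap 1 2) := by
    constructor <;> decide
  have h2 := (OOperad K).act_comp h e 1
    1 (Equiv.swap 0 1) (Equiv.swap 1 2) hB (oMul K) (oMul K)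
  rw [act_one_apply, oMul_swap] at h2
  rw [oMul_assoc, ← h2]
  rfl

/-- The Jacobi identity for `pBr`: it follows from that of `Lie`, since the product of `O` is
associative and commutative. -/
theorem pBr_hJ : ∃ ε ε' : ℤˣ, (LieO K).comp (m := 2) (n := 2) (k := 3) (by omega) rfl 1
      (pBr K) (pBr K) =
      ε • (LieO K).comp (m := 2) (n := 2) (k := 3) (by omega) rfl 0 (pBr K) (pBr K) +
      ε' • (LieO K).act (Equiv.swap 1 2)
        ((LieO K).comp (m := 2) (n := 2) (k := 3) (by omega) rfl 0 (pBr K) (pBr K)) := by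
  refine ⟨1, -1, ?_⟩
  rw [one_smul, Units.neg_smul, one_smul, pBr, comp_tm, comp_tm, act_tm, ← oMul_assoc, oMul_oMul_swap,
    lieBr_jacobi, map_sub, LinearMap.sub_apply, sub_eq_add_neg]

/-- The operators are derivations of the bracket `pBr`. -/
theorem pD_pBr (n : ℕ) {c : ℤ × ℤ} (h : 1 + 2 = 2 + 1) (h' : 2 + 1 = 2 + 1)
    (e : ((1, ((n + 1 : ℕ) : ℤ)) : ℤ × ℤ) + (0, -1) = c)
    (e' : ((0, -1) : ℤ × ℤ) + (1, ((n + 1 : ℕ) : ℤ)) = c) :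
    (LieO K).comp h e 0 (pD K n) (pBr K) =
      (LieO K).comp h' e' 0 (pBr K) (pD K n) + (LieO K).comp h' e' 1 (pBr K) (pD K n) := by
  rw [pBr, pD, comp_tm, comp_tm, comp_tm, oD_mul K n h h' e e',
    (Lie K).one_comp (b := ()), (Lie K).comp_one (a := ()), (Lie K).comp_one (a := ()), map_add]

variable (K) in
/-- The composites of the operators `1 ⊗ d_n` in `Lie ⊗ O`. -/
inductive IsOpWord : ∀ {g : ℤ × ℤ}, (LieO K).obj 1 g → Prop
  | one : IsOpWord (LieO K).one
  | op {a c : ℤ × ℤ} (j : ℕ) (e : (1, ((j + 1 : ℕ) : ℤ)) + a = c)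
      {x : (LieO K).obj 1 a} : IsOpWord x → IsOpWord ((LieO K).comp rfl e 0 (pD K j) x)

variable (K) in
/-- The left-normed iterated brackets in `Lie ⊗ O` of composites of the operators `1 ⊗ d_n`. -/
inductive IsBrWord : ∀ {n : ℕ} {g : ℤ × ℤ}, (LieO K).obj n g → Prop
  | word {g : ℤ × ℤ} {x : (LieO K).obj 1 g} : IsOpWord K x → IsBrWord x
  | brk {m k : ℕ} {a b c : ℤ × ℤ} (h : m + 1 = k) (e : (0, -1) + b + a = c)
      {x : (LieO K).obj m a} {y : (LieO K).obj 1 b} : IsBrWord x → IsOpWord K y →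
      IsBrWord (brk (LieO K) (pBr K) h e x y)

theorem IsOpWord.comp_pD {a c : ℤ × ℤ} {j : ℕ} (h : 1 + 1 = 1 + 1)
    (e : a + (1, ((j + 1 : ℕ) : ℤ)) = c) {x : (LieO K).obj 1 a} (hx : IsOpWord K x) :
    IsOpWord K ((LieO K).comp h e 0 x (pD K j)) := by
  induction hx generalizing c with
  | one =>
    obtain rfl : c = (1, ((j + 1 : ℕ) : ℤ)) := by rw [← e, zero_add]
    rw [(LieO K).one_comp]
    have := IsOpWord.op (K := K) j (add_zero _) .one
    rwa [(LieO K).comp_one] at this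
  | op j' e' hx ih =>
    rw [(LieO K).assoc (p := 1) (q := 1) rfl rfl rfl rfl e' e rfl
      (by rw [← e, ← e', add_assoc]) 0 0 0 rfl]
    exact .op _ _ (ih _)

/-- An operator inserted at an input of an iterated bracket extends the word at this input. -/
theorem IsBrWord.comp_pD {m k : ℕ} {a c : ℤ × ℤ} {j : ℕ} (h : m + 1 = k + 1)
    (e : a + (1, ((j + 1 : ℕ) : ℤ)) = c) (i : Fin m) {x : (LieO K).obj m a} (hx : IsBrWord K x) :
    ∃ (ε : ℤˣ) (y : (LieO K).obj k c), IsBrWord K y ∧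
      (LieO K).comp h e i x (pD K j) = ε • y := by
  induction hx generalizing k c with
  | word hx =>
    obtain rfl : k = 1 := by omega
    obtain rfl : i = 0 := Subsingleton.elim _ _
    exact ⟨1, _, .word (hx.comp_pD h e), by rw [one_smul]⟩
  | @brk m m' a b d h' e' x y hx hy ih =>
    obtain rfl : k = m' := by omega
    by_cases hi : i.val < m
    · obtain ⟨ε, z, hz, hε⟩ := ih (rfl : m + 1 = m + 1) rfl ⟨i, hi⟩
      refine ⟨ε, _, .brk h' (by rw [← e, ← e']; abel) hz hy, ?_⟩
      rw [brk_comp_left (pBr K) h' e' h e rfl rfl h' (by rw [← e, ← e']; abel) i ⟨i, hi⟩ rfl, hε,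
        brk_units_smul_left]
    · obtain ⟨ε, hε⟩ := brk_comp_right (pBr K) h' e' h e (rfl : 1 + 1 = 1 + 1) rfl h'
        (by rw [← e, ← e']; abel) i 0 (by simp; omega) x y (pD K j)
      exact ⟨ε, _, .brk h' _ hx (hy.comp_pD rfl rfl), hε⟩

variable (K) in
/-- The span of the relabelled iterated brackets of composites of operators. -/
def brSpan (n : ℕ) (g : ℤ × ℤ) : Submodule K ((LieO K).obj n g) :=
  Submodule.span K {x | ∃ (σ : Equiv.Perm (Fin n)) (y : (LieO K).obj n g), IsBrWord K y ∧
    x = (LieO K).act σ y}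

theorem comp_pD_mem_brSpan {n k : ℕ} {a c : ℤ × ℤ} {j : ℕ} (h : n + 1 = k + 1)
    (e : a + (1, ((j + 1 : ℕ) : ℤ)) = c) (i : Fin n) {x : (LieO K).obj n a}
    (hx : x ∈ brSpan K n a) : (LieO K).comp h e i x (pD K j) ∈ brSpan K k c := by
  suffices brSpan K n a ≤ (brSpan K k c).comap (compRight (LieO K) h e i (pD K j)) from this hx
  refine Submodule.span_le.2 ?_
  rintro _ ⟨τ, y, hy, rfl⟩
  obtain ⟨ρ, -, e1⟩ := comp_act_left' (LieO K) h e i (τ⁻¹ i) τ (by simp) y (pD K j)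
  obtain ⟨ε, z, hz, hε⟩ := hy.comp_pD h e (τ⁻¹ i)
  refine (congrArg (· ∈ brSpan K k c) e1).mpr ?_
  rw [hε, act_units_smul]
  exact units_smul_mem _ _ (Submodule.subset_span ⟨ρ, z, hz, rfl⟩)

theorem isBrWord_leftNormed (k : ℕ) : IsBrWord K (tm (leftNormed K k) (iteratedMul K k)) := by
  induction k with
  | zero => exact .word .one
  | succ k ih =>
    have := IsBrWord.brk (c := (0, -((k + 1 : ℕ) : ℤ))) rfl (by ext <;> simp) ih .one
    rw [leftNormed_succ, ← iteratedMul_succ k (by ext <;> simp), ← brk_tm]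
    exact this

theorem tm_mem_brSpan {n : ℕ} {g : ℤ × ℤ} {y : (OOperad K).obj n g} (hy : IsMulD K y) :
    ∀ x : (Lie K).obj n (), tm x y ∈ brSpan K n g := by
  induction hy with
  | mul k =>
    intro x
    have hx : x ∈ lieSpan K (k + 1) := by rw [lieSpan_eq_top]; trivial
    suffices lieSpan K (k + 1) ≤ (brSpan K (k + 1) (0, -(k : ℤ))).comap
      (tmRight K (iteratedMul K k)) from this hx
    refine lieSpan_induction fun k' σ h => ?_
    obtain rfl : k = k' := by omega
    obtain ⟨ε, hε⟩ := act_iteratedMul (K := K) k σ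
    have h1 : tm ((Lie K).act σ (leftNormed K k)) (iteratedMul K k) =
        ε⁻¹ • (LieO K).act σ (tm (leftNormed K k) (iteratedMul K k)) := by
      rw [act_tm, hε, tm_units_smul, inv_smul_smul]
    have h2 : (LieO K).act σ (tm (leftNormed K k) (iteratedMul K k)) ∈
        brSpan K (k + 1) (0, -(k : ℤ)) :=
      Submodule.subset_span ⟨σ, _, isBrWord_leftNormed k, rfl⟩
    exact (congrArg (· ∈ brSpan K (k + 1) (0, -(k : ℤ))) h1).mpr (units_smul_mem _ ε⁻¹ h2)
  | zero => intro x; rw [map_zero]; exact zero_mem _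
  | add _ _ hy hy' => intro x; rw [map_add]; exact add_mem (hy x) (hy' x)
  | smul r _ hy => intro x; rw [map_smul]; exact Submodule.smul_mem _ _ (hy x)
  | @comp n k a c h j e i y _ hy =>
    intro x
    obtain rfl : k = n := by omega
    have := comp_pD_mem_brSpan h e i (hy x)
    rwa [pD, comp_tm, (Lie K).comp_one (a := ())] at this

/-- `Lie ⊗ O` is spanned by relabelled iterated brackets of composites of operators. -/
theorem brSpan_eq_top (n : ℕ) (g : ℤ × ℤ) : brSpan K n g = ⊤ :=
  LieO_induction fun x y => tm_mem_brSpan (isMulD y) x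

end Generation

/-! ### The level with respect to a suboperad -/

section Filtration

variable {K : Type u} [Field K]

/-- The family `M` is a suboperad of `Lie ⊗ O` that contains the higher derived brackets. -/
structure ContainsDerived (M : ∀ n g, Submodule K ((LieO K).obj n g)) : Prop where
  one : (LieO K).one ∈ M 1 0
  act : ∀ {n : ℕ} {g : ℤ × ℤ} (σ : Equiv.Perm (Fin n)) {x : (LieO K).obj n g}, x ∈ M n g →
    (LieO K).act σ x ∈ M n g
  comp : ∀ {m n k : ℕ} {a b c : ℤ × ℤ} (h : m + n = k + 1) (e : a + b = c) (i : Fin m)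
    {x : (LieO K).obj m a} {y : (LieO K).obj n b}, x ∈ M m a → y ∈ M n b →
    (LieO K).comp h e i x y ∈ M k c
  derived : ∀ n, derivedBracket K n ∈ M (n + 2) (1, 0)

variable (M : ∀ n g, Submodule K ((LieO K).obj n g))

/-- The elements of level `t ≥ 0`: those that give an element of `M` when `t` elements of `M` are
bracketed with them. -/
def upper : ℕ → ∀ n g, Submodule K ((LieO K).obj n g)
  | 0 => M
  | t + 1 => fun m a =>
    { carrier := {x | ∀ (n k : ℕ) (b c : ℤ × ℤ) (h : m + n = k) (e : (0, -1) + b + a = c),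
        ∀ y ∈ M n b, brk (LieO K) (pBr K) h e x y ∈ upper t k c}
      zero_mem' := by
        intro n k b c h e y hy
        rw [map_zero, LinearMap.zero_apply]
        exact zero_mem _
      add_mem' := by
        intro x x' hx hx' n k b c h e y hy
        rw [map_add, LinearMap.add_apply]
        exact add_mem (hx n k b c h e y hy) (hx' n k b c h e y hy)
      smul_mem' := by
        intro r x hx n k b c h e y hy
        rw [map_smul, LinearMap.smul_apply]
        exact Submodule.smul_mem _ _ (hx n k b c h e y hy) }

/-- The elements of level `-t ≤ 0`: combinations of relabelled brackets of `t + 1` elements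
of `M`. -/
def lower : ℕ → ∀ n g, Submodule K ((LieO K).obj n g)
  | 0 => M
  | t + 1 => fun k c => Submodule.span K {x | ∃ (m n : ℕ) (a b : ℤ × ℤ) (h : m + n = k)
      (e : (0, -1) + b + a = c) (σ : Equiv.Perm (Fin k)), ∃ y ∈ lower t m a, ∃ z ∈ M n b,
        x = (LieO K).act σ (brk (LieO K) (pBr K) h e y z)}

/-- The elements of level `l`. The elements of `M` have level `0`, and the level is going to be
compared with the weight. -/
def level : ℤ → ∀ n g, Submodule K ((LieO K).obj n g)
  | .ofNat t => upper M t
  | .negSucc t => lower M (t + 1)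

variable {M}

theorem level_congr {l l' : ℤ} (h : l = l') {n : ℕ} {g : ℤ × ℤ} {x : (LieO K).obj n g}
    (hx : x ∈ level M l n g) : x ∈ level M l' n g := h ▸ hx

theorem level_natCast (t : ℕ) : level M (t : ℤ) = upper M t := rfl

theorem act_mem_upper (hM : ContainsDerived M) (t : ℕ) {n : ℕ} {g : ℤ × ℤ}
    (σ : Equiv.Perm (Fin n)) {x : (LieO K).obj n g} (hx : x ∈ upper M t n g) :
    (LieO K).act σ x ∈ upper M t n g := by
  induction t generalizing n g with
  | zero => exact hM.act σ hx
  | succ t ih =>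
    intro n' k b c h e y hy
    obtain ⟨ρ, hρ⟩ := brk_act (pBr K) h e σ 1 x y
    rw [act_one_apply] at hρ
    rw [hρ]
    exact ih _ (hx n' k b c h e y hy)

theorem act_mem_lower (hM : ContainsDerived M) (t : ℕ) {n : ℕ} {g : ℤ × ℤ}
    (σ : Equiv.Perm (Fin n)) {x : (LieO K).obj n g} (hx : x ∈ lower M t n g) :
    (LieO K).act σ x ∈ lower M t n g := by
  cases t with
  | zero => exact hM.act σ hx
  | succ t =>
    suffices lower M (t + 1) n g ≤ (lower M (t + 1) n g).comap ((LieO K).act σ) from this hx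
    refine Submodule.span_le.2 ?_
    rintro _ ⟨m, n, a, b, h, e, τ, y, hy, z, hz, rfl⟩
    exact Submodule.subset_span ⟨m, n, a, b, h, e, σ * τ, y, hy, z, hz, act_act _ _ _ _⟩

theorem act_mem_level (hM : ContainsDerived M) (l : ℤ) {n : ℕ} {g : ℤ × ℤ}
    (σ : Equiv.Perm (Fin n)) {x : (LieO K).obj n g} (hx : x ∈ level M l n g) :
    (LieO K).act σ x ∈ level M l n g := by
  cases l with
  | ofNat t => exact act_mem_upper hM t σ hx
  | negSucc t => exact act_mem_lower hM (t + 1) σ hx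

/-- Bracketing with an element of `M` lowers the level by one. -/
theorem brk_mem_level_sub_one (l : ℤ) {m n k : ℕ} {a b c : ℤ × ℤ} (h : m + n = k)
    (e : (0, -1) + b + a = c) {x : (LieO K).obj m a} {y : (LieO K).obj n b}
    (hx : x ∈ level M l m a) (hy : y ∈ M n b) :
    brk (LieO K) (pBr K) h e x y ∈ level M (l - 1) k c := by
  rcases l with (_ | t) | t
  · refine Submodule.subset_span ⟨m, n, a, b, h, e, 1, x, hx, y, hy, ?_⟩
    rw [act_one_apply]
  · refine level_congr (by simp) (?_ : _ ∈ level M (t : ℤ) k c)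
    exact hx n k b c h e y hy
  · refine level_congr (l := Int.negSucc (t + 1)) (by omega) ?_
    refine Submodule.subset_span ⟨m, n, a, b, h, e, 1, x, hx, y, hy, ?_⟩
    rw [act_one_apply]

/-- Induction on the number of brackets in `y`, by the Jacobi identity. -/
theorem brk_mem_level_of_lower (hM : ContainsDerived M) (t : ℕ) (l : ℤ) {m n k : ℕ}
    {a b c : ℤ × ℤ} (h : m + n = k) (e : (0, -1) + b + a = c) {x : (LieO K).obj m a}
    {y : (LieO K).obj n b} (hx : x ∈ level M l m a) (hy : y ∈ lower M t n b) :
    brk (LieO K) (pBr K) h e x y ∈ level M (l - t - 1) k c := by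
  induction t generalizing l m n k a b c with
  | zero => exact level_congr (by simp) (brk_mem_level_sub_one l h e hx hy)
  | succ t ih =>
    suffices lower M (t + 1) n b ≤
      (level M (l - (t + 1 : ℕ) - 1) k c).comap (brk (LieO K) (pBr K) h e x) from this hy
    refine Submodule.span_le.2 ?_
    rintro _ ⟨n₁, n₂, b₁, b₂, h', e', σ, y, hy, z, hz, rfl⟩
    obtain ⟨ρ, hρ⟩ := brk_act (pBr K) h e 1 σ x (brk (LieO K) (pBr K) h' e' y z)
    rw [act_one_apply] at hρ
    refine (congrArg (· ∈ level M (l - (t + 1 : ℕ) - 1) k c) hρ).mpr (act_mem_level hM _ _ ?_)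
    obtain ⟨ε, ε', τ, hJ⟩ := brk_jacobi pBr_hJ h h' (by omega : m + n₁ + n₂ = k) rfl
      (by omega : m + n₂ + n₁ = k) rfl e e' (by rw [← e, ← e']; abel) rfl
      (by rw [← e, ← e']; abel) rfl x y z
    rw [hJ]
    refine add_mem (units_smul_mem _ _ ?_) (units_smul_mem _ _ (act_mem_level hM _ _ ?_))
    · exact level_congr (by push_cast; ring) (brk_mem_level_sub_one _ _ _ (ih l rfl rfl hx hy) hz)
    · exact level_congr (by push_cast; ring)
        (ih (l - 1) _ _ (brk_mem_level_sub_one l rfl rfl hx hz) hy)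

theorem brk_mem_level_symm (hM : ContainsDerived M) {l : ℤ} {m n k : ℕ}
    {a b c : ℤ × ℤ} (h : m + n = k) (e : (0, -1) + b + a = c) {x : (LieO K).obj m a}
    {y : (LieO K).obj n b}
    (H : brk (LieO K) (pBr K) (by omega) (by rw [← e]; abel : _ = c) y x ∈ level M l k c) :
    brk (LieO K) (pBr K) h e x y ∈ level M l k c := by
  obtain ⟨ε, ρ, hε⟩ := brk_antisymm (pBr K) pBr_swap h (by omega : n + m = k) e
    (by rw [← e]; abel) x y
  rw [hε]
  exact units_smul_mem _ _ (act_mem_level hM _ _ H)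

/-- The case of two positive levels: after a further bracket with an element of `M`, the Jacobi
identity lowers the level of `x` or of `y` by one. -/
theorem brk_mem_upper (hM : ContainsDerived M) (r : ℕ) {s t : ℕ} (hr : s + t < r) {m n k : ℕ}
    {a b c : ℤ × ℤ} (h : m + n = k) (e : (0, -1) + b + a = c) {x : (LieO K).obj m a}
    {y : (LieO K).obj n b} (hx : x ∈ upper M (s + 1) m a) (hy : y ∈ upper M (t + 1) n b) :
    brk (LieO K) (pBr K) h e x y ∈ upper M (s + t + 1) k c := by
  induction r generalizing s t m n k a b c with
  | zero => omega
  | succ r ih =>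
    intro n' k' b' c' h' e' z hz
    obtain ⟨ε, ε', τ, hJ⟩ := brk_jacobi pBr_hJ (by omega : m + (n + n') = k') rfl h' h
      (by omega : m + n' + n = k') rfl
      (by rw [← e', ← e]; abel : _ = c') rfl e' e (by rw [← e', ← e]; abel) rfl x y z
    have hyz := hy n' _ b' _ rfl rfl z hz
    have hxz := hx n' _ b' _ rfl rfl z hz
    have h1 : brk (LieO K) (pBr K) (by omega : m + (n + n') = k')
        (by rw [← e', ← e]; abel : _ = c') x (brk (LieO K) (pBr K) rfl rfl y z) ∈
        upper M (s + t) k' c' := by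
      cases t with
      | zero => exact hx _ _ _ _ _ _ _ hyz
      | succ t => exact ih (s := s) (t := t) (by omega) _ _ hx hyz
    have h2 : brk (LieO K) (pBr K) (by omega : m + n' + n = k')
        (by rw [← e', ← e]; abel : _ = c') (brk (LieO K) (pBr K) rfl rfl x z) y ∈
        upper M (s + t) k' c' := by
      cases s with
      | zero =>
        refine brk_mem_level_symm hM (l := ((0 + t : ℕ) : ℤ)) _ _ ?_
        rw [level_natCast, Nat.zero_add]
        exact hy _ _ _ _ _ _ _ hxz
      | succ s =>
        have := ih (s := s) (t := t) (by omega) (by omega : m + n' + n = k')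
          (by rw [← e', ← e]; abel : _ = c') hxz hy
        rwa [show s + 1 + t = s + t + 1 by omega]
    have h3 : brk (LieO K) (pBr K) h' e' (brk (LieO K) (pBr K) h e x y) z =
        ε⁻¹ • (brk (LieO K) (pBr K) (by omega : m + (n + n') = k')
        (by rw [← e', ← e]; abel : _ = c') x (brk (LieO K) (pBr K) rfl rfl y z) -
        ε' • (LieO K).act τ (brk (LieO K) (pBr K) (by omega : m + n' + n = k')
        (by rw [← e', ← e]; abel : _ = c') (brk (LieO K) (pBr K) rfl rfl x z) y)) := by
      rw [hJ, add_sub_cancel_right, inv_smul_smul]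
    rw [h3]
    exact units_smul_mem _ _ (sub_mem h1 (units_smul_mem _ _ (act_mem_upper hM _ _ h2)))

/-- The bracket is of degree `-1` with respect to the level. -/
theorem brk_mem_level (hM : ContainsDerived M) (l l' : ℤ) {m n k : ℕ}
    {a b c : ℤ × ℤ} (h : m + n = k) (e : (0, -1) + b + a = c) {x : (LieO K).obj m a}
    {y : (LieO K).obj n b} (hx : x ∈ level M l m a) (hy : y ∈ level M l' n b) :
    brk (LieO K) (pBr K) h e x y ∈ level M (l + l' - 1) k c := by
  rcases l' with (_ | t) | t
  · exact level_congr (by simp) (brk_mem_level_sub_one l h e hx hy)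
  · rcases l with (_ | s) | s
    · exact level_congr (l := Int.ofNat (t + 1) - 1) (by simp)
        (brk_mem_level_symm hM h e (brk_mem_level_sub_one _ _ _ hy hx))
    · exact level_congr (l := ((s + t + 1 : ℕ) : ℤ)) (by simp; ring)
        (brk_mem_upper hM _ (Nat.lt_succ_self _) h e hx hy)
    · refine level_congr (l := Int.ofNat (t + 1) - (s + 1 : ℕ) - 1) ?_
        (brk_mem_level_symm hM h e (brk_mem_level_of_lower hM _ _ _ _ hy hx))
      rw [Int.negSucc_eq]; push_cast; ring
  · refine level_congr (l := l - (t + 1 : ℕ) - 1) ?_ (brk_mem_level_of_lower hM _ _ _ _ hx hy)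
    rw [Int.negSucc_eq]; push_cast; ring

end Filtration

/-! ### `Lie ⊗ D_∞` is generated by the higher derived brackets -/

section Generation

variable {K : Type u} [Field K]

/-- The elements that give an element of `M` when they are bracketed `r` times with the
identity. -/
def unitUpper (M : ∀ n g, Submodule K ((LieO K).obj n g)) :
    ℕ → ∀ n g, Submodule K ((LieO K).obj n g)
  | 0 => M
  | r + 1 => fun n a => (unitUpper M r (n + 1) ((0, -1) + 0 + a)).comap
      (brkRight (LieO K) (pBr K) rfl rfl (LieO K).one)

variable {M : ∀ n g, Submodule K ((LieO K).obj n g)}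

theorem comp_mem_unitUpper (hM : ContainsDerived M) (r : ℕ) {m n k : ℕ} {a b c : ℤ × ℤ}
    (h : m + n = k + 1) (e : a + b = c) (i : Fin m) {x : (LieO K).obj m a}
    {y : (LieO K).obj n b} (hx : x ∈ unitUpper M r m a) (hy : y ∈ M n b) :
    (LieO K).comp h e i x y ∈ unitUpper M r k c := by
  induction r generalizing m k a c with
  | zero => exact hM.comp h e i hx hy
  | succ r ih =>
    have h1 := brk_comp_left (Q := LieO K) (pBr K) rfl rfl (by omega : m + 1 + n = k + 1 + 1)
      (by rw [← e]; abel) h e (rfl : k + 1 = k + 1) (rfl : (0, -1) + 0 + c = _) i.castSucc i rfl x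
      (LieO K).one y
    refine (congrArg (· ∈ unitUpper M r (k + 1) ((0, -1) + 0 + c)) h1).mp ?_
    exact ih _ _ _ hx

/-- Bracketing with `y ∈ M` is bracketing with the identity, followed by the insertion of `y`. Hence
it suffices to consider brackets with the identity. -/
theorem unitUpper_le_upper (hM : ContainsDerived M) (r : ℕ) {n : ℕ} {a : ℤ × ℤ}
    {x : (LieO K).obj n a} (hx : x ∈ unitUpper M r n a) : x ∈ upper M r n a := by
  induction r generalizing n a with
  | zero => exact hx
  | succ r ih =>
    intro n' k b c h e y hy
    obtain ⟨ε, hε⟩ := comp_brk_one (LieO K) (pBr K) (rfl : n + 1 = n + 1) rfl h e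
      (by omega : n + 1 + n' = k + 1) (by rw [← e]; abel) (Fin.last n) rfl x y
    have h1 : brk (LieO K) (pBr K) h e x y = ε⁻¹ • (LieO K).comp (by omega : n + 1 + n' = k + 1)
        (by rw [← e]; abel : (0, -1) + 0 + a + b = c) (Fin.last n)
        (brk (LieO K) (pBr K) rfl rfl x (LieO K).one) y := by
      rw [hε, inv_smul_smul]
    rw [h1]
    exact units_smul_mem _ _ (ih (comp_mem_unitUpper hM r _ _ _ hx hy))

/-- The brackets of `d_{k+1}` with identities, when completed to `k + 1` of them, give the higher
derived bracket of arity `k + 2`, which belongs to `M`. -/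
theorem leftNormed_mem_unitUpper (hM : ContainsDerived M) (k r : ℕ) : ∀ (j : ℕ) (_ : r + j = k + 1)
    (g : ℤ × ℤ) (e : (0, -(j : ℤ)) + (1, ((k + 1 : ℕ) : ℤ)) = g),
    tm (leftNormed K j) ((OOperad K).comp (m := j + 1) (n := 1) rfl e 0 (iteratedMul K j) (oD K k)) ∈
      unitUpper M r (j + 1) g := by
  induction r with
  | zero =>
    intro j hj g e
    obtain rfl : j = k + 1 := by omega
    obtain rfl : g = (1, 0) := by rw [← e]; ext <;> simp
    exact hM.derived k
  | succ r ih =>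
    intro j hj g e
    have h1 := ih (j + 1) (by omega) ((0, -1) + 0 + g) (by rw [← e]; ext <;> simp; omega)
    refine (congrArg (· ∈ unitUpper M r (j + 1 + 1) ((0, -1) + 0 + g)) ?_).mp h1
    refine Eq.trans ?_ (brk_tm rfl rfl (leftNormed K j) _ (Lie K).one (OOperad K).one).symm
    rw [leftNormed_succ, ← iteratedMul_succ j (by ext <;> simp)]
    refine congrArg _ ?_
    exact brk_comp_left (Q := OOperad K) (oMul K) rfl _ rfl _ rfl e rfl rfl 0 0 rfl _ _ _

theorem pD_mem_unitUpper (hM : ContainsDerived M) (k : ℕ) :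
    pD K k ∈ unitUpper M (k + 1) 1 (1, ((k + 1 : ℕ) : ℤ)) := by
  have h := leftNormed_mem_unitUpper hM k (k + 1) 0 rfl (1, ((k + 1 : ℕ) : ℤ)) (by ext <;> simp)
  refine (congrArg (· ∈ unitUpper M (k + 1) 1 (1, ((k + 1 : ℕ) : ℤ))) ?_).mp h
  refine congrArg _ ?_
  exact (OOperad K).one_comp rfl (zero_add _) _

/-- The operator `d_{k+1}` raises the level by `k + 1`. The induction on the level `t` of `x` uses
that `d_{k+1}` is a derivation: `[d x, y]` is a combination of `d [x, y]` and `[x, d y]`. -/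
theorem pD_comp_mem_upper (hM : ContainsDerived M) (k t : ℕ) {n : ℕ} {a c : ℤ × ℤ}
    (h : 1 + n = n + 1) (e : (1, ((k + 1 : ℕ) : ℤ)) + a = c) {x : (LieO K).obj n a}
    (hx : x ∈ upper M t n a) : (LieO K).comp h e 0 (pD K k) x ∈ upper M (t + k + 1) n c := by
  induction t generalizing n a c with
  | zero =>
    rw [Nat.zero_add]
    exact unitUpper_le_upper hM _ (comp_mem_unitUpper hM _ _ _ _ (pD_mem_unitUpper hM k) hx)
  | succ t ih =>
    have hkt : t + 1 + k + 1 = t + k + 1 + 1 := by omega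
    rw [hkt]
    intro n' k' b c' h' e' y hy
    obtain ⟨ε, hε⟩ := comp_brk_of_derivation (Q := LieO K) (pD K k) rfl (add_comm _ _)
      (pD_pBr k _ _ _ _) h' h (by omega : 1 + n' = n' + 1) (by omega : 1 + k' = k' + 1) rfl
      (by rw [← e', ← e]; abel : _ = c') e rfl e' (by rw [← e', ← e]; abel) x y
    have h1 := ih (by omega : 1 + k' = k' + 1)
      (by rw [← e', ← e]; abel : (1, ((k + 1 : ℕ) : ℤ)) + ((0, -1) + b + a) = c')
      (hx n' k' b _ h' rfl y hy)
    have h2 : brk (LieO K) (pBr K) h' (by rw [← e', ← e]; abel :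
        (0, -1) + ((1, ((k + 1 : ℕ) : ℤ)) + b) + a = c') x
        ((LieO K).comp (by omega : 1 + n' = n' + 1) rfl 0 (pD K k) y) ∈
        upper M (t + k + 1) k' c' := by
      refine brk_mem_upper hM _ (Nat.lt_succ_self _) _ _ hx ?_
      have := unitUpper_le_upper hM _ (comp_mem_unitUpper hM _ (by omega : 1 + n' = n' + 1) rfl 0
        (pD_mem_unitUpper hM k) hy)
      exact this
    have h3 : brk (LieO K) (pBr K) h' e' ((LieO K).comp h e 0 (pD K k) x) y = ε⁻¹ •
        ((LieO K).comp (by omega : 1 + k' = k' + 1)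
          (by rw [← e', ← e]; abel : (1, ((k + 1 : ℕ) : ℤ)) + ((0, -1) + b + a) = c') 0 (pD K k)
          (brk (LieO K) (pBr K) h' rfl x y) - brk (LieO K) (pBr K) h' (by rw [← e', ← e]; abel :
        (0, -1) + ((1, ((k + 1 : ℕ) : ℤ)) + b) + a = c') x
        ((LieO K).comp (by omega : 1 + n' = n' + 1) rfl 0 (pD K k) y)) := by
      rw [hε, add_sub_cancel_right, inv_smul_smul]
    rw [h3]
    exact units_smul_mem _ _ (sub_mem h1 h2)

/-- The level of a composite of operators is its weight. -/
theorem IsOpWord.mem_upper (hM : ContainsDerived M) {g : ℤ × ℤ} {x : (LieO K).obj 1 g}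
    (hx : IsOpWord K x) : ∃ t : ℕ, g.2 = t ∧ x ∈ upper M t 1 g := by
  induction hx with
  | one => exact ⟨0, rfl, hM.one⟩
  | op j e hx ih =>
    obtain ⟨t, ht, hx⟩ := ih
    refine ⟨t + j + 1, ?_, pD_comp_mem_upper hM _ _ _ _ hx⟩
    rw [← e, Prod.snd_add, ht]
    push_cast
    ring

/-- The level of an iterated bracket of composites of operators is its weight. -/
theorem IsBrWord.mem_level (hM : ContainsDerived M) {n : ℕ} {g : ℤ × ℤ} {x : (LieO K).obj n g}
    (hx : IsBrWord K x) : x ∈ level M g.2 n g := by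
  induction hx with
  | word hx =>
    obtain ⟨t, ht, hx⟩ := hx.mem_upper hM
    exact level_congr (l := (t : ℤ)) ht.symm hx
  | brk h e hx hy ih =>
    obtain ⟨t, ht, hy⟩ := hy.mem_upper hM
    refine level_congr ?_ (brk_mem_level hM _ (t : ℤ) _ _ ih hy)
    rw [← e, Prod.snd_add, Prod.snd_add, ht]
    ring

/-- The higher derived brackets generate the part of weight `0` of `Lie ⊗ O`. -/
theorem mem_of_containsDerived (hM : ContainsDerived M) {n : ℕ} {g : ℤ}
    (x : (LieO K).obj n (g, 0)) : x ∈ M n (g, 0) := by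
  have hx : x ∈ brSpan K n (g, 0) := by rw [brSpan_eq_top]; trivial
  suffices brSpan K n (g, 0) ≤ M n (g, 0) from this hx
  refine Submodule.span_le.2 ?_
  rintro _ ⟨σ, y, hy, rfl⟩
  exact hM.act σ (hy.mem_level hM)

end Generation

/-! ### The free operad and planar trees -/

/-- The planar rooted trees all of whose internal vertices have at least two children: `Plan false`
is the type of the trees, and `Plan true` that of the nonempty ordered forests. The vertex
`node T f` has the tree `T` as its first child, and the trees of `f` as the others. -/
inductive Plan : Bool → Type
  | leaf : Plan false
  | node : Plan false → Plan true → Plan false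
  | one : Plan false → Plan true
  | cons : Plan false → Plan true → Plan true

namespace Plan

/-- The number of leaves. -/
def leaves : ∀ {b : Bool}, Plan b → ℕ
  | _, leaf => 1
  | _, node T f => T.leaves + f.leaves
  | _, one T => T.leaves
  | _, cons T f => T.leaves + f.leaves

/-- The number of internal vertices; for a forest, the root to which its trees are going to be
attached is counted, too. -/
def deg : ∀ {b : Bool}, Plan b → ℕ
  | _, leaf => 0
  | _, node T f => f.deg + T.deg
  | _, one T => 1 + T.deg
  | _, cons T f => f.deg + T.deg

theorem leaves_pos {b : Bool} (T : Plan b) : 0 < T.leaves := by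
  induction T with
  | leaf => exact Nat.one_pos
  | node T f hT _ => exact Nat.add_pos_left hT _
  | one T hT => exact hT
  | cons T f hT _ => exact Nat.add_pos_left hT _

end Plan

/-- The generators of the free operad: one operation of degree `1` and weight `0` in each arity
at least `2`. -/
inductive FGen : ℕ → ℤ × ℤ → Type
  | l (n : ℕ) : FGen (n + 2) (1, 0)

/-- The free operad with one generator of degree `1` in each arity at least `2`. -/
def FreeOp (K : Type u) [Field K] : GradedOperad.{u, u, 0} K (ℤ × ℤ) degreeHom :=
  presented K FGen degreeHom fun _ => False

section Trees

variable (K : Type u) [Field K]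

/-- The generators of the free operad. -/
def fL (n : ℕ) : (FreeOp K).obj (n + 2) (1, 0) :=
  presentedGen K degreeHom (fun _ => False) (.l n)

/-- The arity of the operation given by a tree, or by a forest together with `k + 1` leaves, if
there are `l` leaves in the tree or forest. -/
def inputs : Bool → ℕ → ℕ → ℕ
  | false, _, l => l
  | true, k, l => k + 1 + l

/-- The operation in the free operad given by a tree; for a forest, the operation given by the
tree with one internal vertex to the root of which `k + 1` leaves and then the forest are
attached. -/
def Plan.ev : ∀ {b : Bool} (T : Plan b) (k : ℕ), (FreeOp K).obj (inputs b k T.leaves) (T.deg, 0)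
  | _, leaf, _ => (FreeOp K).one
  | _, node T f, _ => (FreeOp K).comp (m := 0 + 1 + f.leaves) (n := T.leaves)
      (k := T.leaves + f.leaves) (a := (f.deg, 0)) (b := (T.deg, 0)) (by omega)
      (by ext <;> simp [deg]) ⟨0, by omega⟩ (f.ev 0) (T.ev 0)
  | _, one T, k => (FreeOp K).comp (m := k + 2) (n := T.leaves) (k := k + 1 + T.leaves)
      (b := (T.deg, 0)) (by omega) (by ext <;> simp [deg]) ⟨k + 1, by omega⟩ (fL K k) (T.ev 0)
  | _, cons T f, k => (FreeOp K).comp (m := k + 1 + 1 + f.leaves) (n := T.leaves)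
      (k := k + 1 + (T.leaves + f.leaves)) (a := (f.deg, 0)) (b := (T.deg, 0)) (by omega)
      (by ext <;> simp [deg]) ⟨k + 1, by omega⟩ (f.ev (k + 1)) (T.ev 0)

variable {K}

/-- The operation `x` is the one given by the tree or forest `T`. -/
def IsEv {b : Bool} (T : Plan b) (k : ℕ) {n : ℕ} {g : ℤ × ℤ} (x : (FreeOp K).obj n g) : Prop :=
  (⟨n, g, x⟩ : Σ n g, (FreeOp K).obj n g) = ⟨_, _, T.ev K k⟩

theorem isEv_ev {b : Bool} (T : Plan b) (k : ℕ) : IsEv T k (T.ev K k) := rfl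

theorem IsEv.tree {T : Plan false} {n k : ℕ} {g : ℤ × ℤ} {x : (FreeOp K).obj n g}
    (h : IsEv T k x) (k' : ℕ) : IsEv T k' x := by
  cases T with
  | leaf => exact h
  | node T f => exact h

theorem IsEv.node {T : Plan false} {f : Plan true} {m n q : ℕ} {a b c : ℤ × ℤ}
    {x : (FreeOp K).obj m a} {y : (FreeOp K).obj n b} (hf : IsEv f 0 x) (hT : IsEv T 0 y)
    (h : m + n = q + 1) (e : a + b = c) (i : Fin m) (hi : i.val = 0) :
    IsEv (.node T f) 0 ((FreeOp K).comp h e i x y) := by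
  cases hf
  cases hT
  obtain rfl : q = (Plan.node T f).leaves := by simp only [inputs, Plan.leaves] at *; omega
  obtain rfl : c = (((Plan.node T f).deg : ℤ), 0) := by rw [← e]; ext <;> simp [Plan.deg]
  have h0 : 0 < inputs true 0 f.leaves := by simp only [inputs]; omega
  rw [show i = ⟨0, h0⟩ from Fin.ext hi]
  rfl

theorem IsEv.one {T : Plan false} {n k q : ℕ} {b c : ℤ × ℤ}
    {y : (FreeOp K).obj n b} (hT : IsEv T 0 y)
    (h : k + 2 + n = q + 1) (e : (1, 0) + b = c) (i : Fin (k + 2)) (hi : i.val = k + 1) :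
    IsEv (.one T) k ((FreeOp K).comp h e i (fL K k) y) := by
  cases hT
  obtain rfl : q = k + 1 + (Plan.one T).leaves := by simp only [inputs, Plan.leaves] at *; omega
  obtain rfl : c = (((Plan.one T).deg : ℤ), 0) := by rw [← e]; ext <;> simp [Plan.deg]
  rw [show i = ⟨k + 1, Nat.lt_succ_self _⟩ from Fin.ext hi]
  rfl

theorem IsEv.cons {T : Plan false} {f : Plan true} {m n k q : ℕ} {a b c : ℤ × ℤ}
    {x : (FreeOp K).obj m a} {y : (FreeOp K).obj n b} (hf : IsEv f (k + 1) x) (hT : IsEv T 0 y)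
    (h : m + n = q + 1) (e : a + b = c) (i : Fin m) (hi : i.val = k + 1) :
    IsEv (.cons T f) k ((FreeOp K).comp h e i x y) := by
  cases hf
  cases hT
  obtain rfl : q = k + 1 + (Plan.cons T f).leaves := by simp only [inputs, Plan.leaves] at *; omega
  obtain rfl : c = (((Plan.cons T f).deg : ℤ), 0) := by rw [← e]; ext <;> simp [Plan.deg]
  have h0 : k + 1 < inputs true (k + 1) f.leaves := by simp only [inputs]; omega
  rw [show i = ⟨k + 1, h0⟩ from Fin.ext hi]
  rfl

/-- The grafting of trees: up to sign, the operations given by trees are closed under partial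
compositions. -/
theorem exists_graft (T' : Plan false) {b : Bool} (T : Plan b) : ∀ (k : ℕ) {q : ℕ} {c : ℤ × ℤ}
    (h : inputs b k T.leaves + T'.leaves = q + 1) (e : ((T.deg : ℤ), (0 : ℤ)) + ((T'.deg : ℤ), 0) = c)
    (i : Fin (inputs b k T.leaves)), (b = true → k + 1 ≤ i.val) →
    ∃ (ε : ℤˣ) (S : Plan b) (z : (FreeOp K).obj q c), IsEv S k z ∧
      (FreeOp K).comp h e i (T.ev K k) (T'.ev K 0) = ε • z := by
  have hT' := T'.leaves_pos
  induction T with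
  | leaf =>
    intro k q c h e i hi
    obtain rfl : q = T'.leaves := by simp only [inputs, Plan.leaves] at h; omega
    obtain rfl : c = ((T'.deg : ℤ), 0) := by rw [← e]; ext <;> simp [Plan.deg]
    obtain rfl : i = (0 : Fin 1) := Subsingleton.elim (α := Fin 1) _ _
    refine ⟨1, T', T'.ev K 0, (isEv_ev T' 0).tree k, Eq.trans ?_ (one_smul _ _).symm⟩
    exact (FreeOp K).one_comp h e _
  | node T f hT hf =>
    intro k q c h e i _
    have hT0 := T.leaves_pos
    have hi' := i.isLt
    simp only [inputs, Plan.leaves] at h hi'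
    -- The tree `T'` is grafted either to a leaf of the first subtree `T`, or to one of `f`.
    by_cases hi : i.val < T.leaves
    · obtain ⟨ε, S, z, hz, hε⟩ := hT 0 (q := T.leaves + T'.leaves - 1) (c := (T.deg + T'.deg, 0))
        (by simp only [inputs]; omega) (by ext <;> simp) ⟨i, hi⟩ (by simp)
      refine ⟨ε, .node S f, _, ((isEv_ev f 0).node hz
        (by simp only [inputs]; omega : inputs true 0 f.leaves + (T.leaves + T'.leaves - 1) = q + 1)
        (by rw [← e]; ext <;> simp [Plan.deg]; omega) ⟨0, by simp only [inputs]; omega⟩ rfl).tree k, ?_⟩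
      rw [← comp_units_smul_right, ← hε]
      exact (FreeOp K).assoc _ _ _ _ _ _ _ _ _ _ _ (by simp) _ _ _
    · obtain ⟨ε, S, z, hz, hε⟩ := hf 0 (q := f.leaves + T'.leaves) (c := (f.deg + T'.deg, 0))
        (by simp only [inputs]; omega) (by ext <;> simp)
        ⟨i.val - T.leaves + 1, by simp only [inputs]; omega⟩ (by simp)
      obtain ⟨ε', hε'⟩ := exists_parallel (FreeOp K) (l := inputs true 0 f.leaves)
        (m := T.leaves) (n := T'.leaves) (p := T.leaves + f.leaves) (q := f.leaves + T'.leaves)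
        (r := q) (by simp only [inputs]; omega) (by omega) (by simp only [inputs]; omega) (by omega)
        (by ext <;> simp [Plan.deg]) e (by ext <;> simp)
        (by rw [← e]; ext <;> simp [Plan.deg]; omega :
          ((f.deg : ℤ) + T'.deg, (0 : ℤ)) + ((T.deg : ℤ), 0) = c) ⟨0, by simp only [inputs]; omega⟩
        ⟨i.val - T.leaves + 1, by simp only [inputs]; omega⟩ i ⟨0, by omega⟩
        (by simp [Fin.lt_def]) (by simp [inputs]; omega) rfl (f.ev K 0) (T.ev K 0) (T'.ev K 0)
      refine ⟨ε' * ε, .node T S, _, (hz.node (isEv_ev T 0)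
        (by simp only [inputs]; omega : f.leaves + T'.leaves + inputs false 0 T.leaves = q + 1)
        (by rw [← e]; ext <;> simp [Plan.deg]; omega) ⟨0, by omega⟩ rfl).tree k, hε'.trans ?_⟩
      rw [hε]
      exact (congrArg (ε' • ·) (comp_units_smul_left (FreeOp K) _ _ _ ε z (T.ev K 0))).trans
        (smul_smul _ _ _)
  | one T hT =>
    intro k q c h e i hi
    have hT0 := T.leaves_pos
    have hi := hi rfl
    have hi' := i.isLt
    simp only [inputs, Plan.leaves] at h hi hi'
    obtain ⟨ε, S, z, hz, hε⟩ := hT 0 (q := T.leaves + T'.leaves - 1) (c := (T.deg + T'.deg, 0))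
      (by simp only [inputs]; omega) (by ext <;> simp)
      ⟨i - (k + 1), by simp only [inputs]; omega⟩ (by simp)
    refine ⟨ε, .one S, _, hz.one (q := q) (by omega) (by rw [← e]; ext <;> simp [Plan.deg]; omega)
      ⟨k + 1, by omega⟩ rfl, ?_⟩
    rw [← comp_units_smul_right, ← hε]
    exact (FreeOp K).assoc _ _ _ _ _ _ _ _ _ _ _ (by simp; omega) _ _ _
  | cons T f hT hf =>
    intro k q c h e i hi
    have hT0 := T.leaves_pos
    have hi := hi rfl
    have hi' := i.isLt
    simp only [inputs, Plan.leaves] at h hi hi'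
    by_cases hi : i.val < k + 1 + T.leaves
    · obtain ⟨ε, S, z, hz, hε⟩ := hT 0 (q := T.leaves + T'.leaves - 1) (c := (T.deg + T'.deg, 0))
        (by simp only [inputs]; omega) (by ext <;> simp)
        ⟨i - (k + 1), by simp only [inputs]; omega⟩ (by simp)
      refine ⟨ε, .cons S f, _, (isEv_ev f (k + 1)).cons hz
        (by simp only [inputs]; omega :
          inputs true (k + 1) f.leaves + (T.leaves + T'.leaves - 1) = q + 1)
        (by rw [← e]; ext <;> simp [Plan.deg]; omega)
        ⟨k + 1, by simp only [inputs]; omega⟩ rfl, ?_⟩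
      rw [← comp_units_smul_right, ← hε]
      exact (FreeOp K).assoc _ _ _ _ _ _ _ _ _ _ _ (by simp; omega) _ _ _
    · obtain ⟨ε, S, z, hz, hε⟩ := hf (k + 1) (q := k + 1 + f.leaves + T'.leaves)
        (c := (f.deg + T'.deg, 0))
        (by simp only [inputs]; omega) (by ext <;> simp)
        ⟨i.val - T.leaves + 1, by simp only [inputs]; omega⟩ (by simp; omega)
      obtain ⟨ε', hε'⟩ := exists_parallel (FreeOp K) (l := inputs true (k + 1) f.leaves)
        (m := T.leaves) (n := T'.leaves) (p := k + 1 + (T.leaves + f.leaves))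
        (q := k + 1 + f.leaves + T'.leaves) (r := q)
        (by simp only [inputs]; omega) (by omega) (by simp only [inputs]; omega) (by omega)
        (by ext <;> simp [Plan.deg]) e (by ext <;> simp)
        (by rw [← e]; ext <;> simp [Plan.deg]; omega :
          ((f.deg : ℤ) + T'.deg, (0 : ℤ)) + ((T.deg : ℤ), 0) = c) ⟨k + 1, by simp only [inputs]; omega⟩
        ⟨i.val - T.leaves + 1, by simp only [inputs]; omega⟩ i ⟨k + 1, by omega⟩
        (by simp [Fin.lt_def]; omega) (by simp [inputs]; omega) rfl (f.ev K (k + 1)) (T.ev K 0)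
        (T'.ev K 0)
      refine ⟨ε' * ε, .cons T S, _, hz.cons (isEv_ev T 0)
        (by simp only [inputs]; omega :
          k + 1 + f.leaves + T'.leaves + inputs false 0 T.leaves = q + 1)
        (by rw [← e]; ext <;> simp [Plan.deg]; omega) ⟨k + 1, by omega⟩ rfl, hε'.trans ?_⟩
      rw [hε]
      exact (congrArg (ε' • ·) (comp_units_smul_left (FreeOp K) _ _ _ ε z (T.ev K 0))).trans
        (smul_smul _ _ _)

theorem IsEv.unique {n : ℕ} {g : ℤ × ℤ} {T : Plan false} {x y : (FreeOp K).obj n g}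
    (hx : IsEv T 0 x) (hy : IsEv T 0 y) : x = y := by
  have h := hx.trans hy.symm
  cases h
  rfl

theorem IsEv.arity {n : ℕ} {g : ℤ × ℤ} {T : Plan false} {x : (FreeOp K).obj n g}
    (hx : IsEv T 0 x) : T.leaves = n := by
  cases hx
  rfl

theorem IsEv.degree {n : ℕ} {g : ℤ × ℤ} {T : Plan false} {x : (FreeOp K).obj n g}
    (hx : IsEv T 0 x) : ((T.deg : ℤ), (0 : ℤ)) = g := by
  cases hx
  rfl

namespace Plan

/-- The forest of `n + 1` leaves. -/
def leafForest : ℕ → Plan true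
  | 0 => one leaf
  | n + 1 => cons leaf (leafForest n)

/-- The tree with `n + 2` leaves and one internal vertex. -/
def corolla (n : ℕ) : Plan false := node leaf (leafForest n)

end Plan

theorem isEv_leafForest (n : ℕ) : ∀ (k m : ℕ) (_ : m = k + n), IsEv (.leafForest n) k (fL K m) := by
  induction n with
  | zero =>
    intro k m h
    obtain rfl : k = m := by omega
    have := (isEv_ev (K := K) .leaf 0).one (k := k) rfl (add_zero _) (Fin.last (k + 1)) rfl
    exact (congrArg (IsEv (.leafForest 0) k) ((FreeOp K).comp_one rfl _ _ (fL K k))).mp this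
  | succ n ih =>
    intro k m h
    have := (ih (k + 1) m (by omega)).cons (isEv_ev .leaf 0) rfl (add_zero _) ⟨k + 1, by omega⟩ rfl
    exact (congrArg (IsEv (.leafForest (n + 1)) k) ((FreeOp K).comp_one rfl _ _ (fL K m))).mp this

theorem isEv_corolla (n : ℕ) : IsEv (.corolla n) 0 (fL K n) := by
  have := (isEv_leafForest (K := K) n 0 n (by omega)).node (isEv_ev .leaf 0) rfl (add_zero _) 0 rfl
  exact (congrArg (IsEv (.corolla n) 0) ((FreeOp K).comp_one rfl _ _ (fL K n))).mp this

variable (K) in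
/-- The span of the relabelled operations given by trees. -/
def treeSpan (n : ℕ) (g : ℤ × ℤ) : Submodule K ((FreeOp K).obj n g) :=
  Submodule.span K {x | ∃ (σ : Equiv.Perm (Fin n)) (T : Plan false) (z : (FreeOp K).obj n g),
    IsEv T 0 z ∧ x = (FreeOp K).act σ z}

theorem IsEv.mem_treeSpan {n : ℕ} {g : ℤ × ℤ} {T : Plan false} {x : (FreeOp K).obj n g}
    (hx : IsEv T 0 x) : x ∈ treeSpan K n g :=
  Submodule.subset_span ⟨1, T, x, hx, (act_one_apply _ _).symm⟩

theorem act_mem_treeSpan {n : ℕ} {g : ℤ × ℤ} (σ : Equiv.Perm (Fin n)) {x : (FreeOp K).obj n g}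
    (hx : x ∈ treeSpan K n g) : (FreeOp K).act σ x ∈ treeSpan K n g := by
  suffices treeSpan K n g ≤ (treeSpan K n g).comap ((FreeOp K).act σ) from this hx
  refine Submodule.span_le.2 ?_
  rintro _ ⟨τ, T, z, hz, rfl⟩
  exact Submodule.subset_span ⟨σ * τ, T, z, hz, act_act _ _ _ _⟩

theorem comp_mem_treeSpan {m n k : ℕ} {a b c : ℤ × ℤ} (h : m + n = k + 1) (e : a + b = c)
    (i : Fin m) {x : (FreeOp K).obj m a} {y : (FreeOp K).obj n b} (hx : x ∈ treeSpan K m a)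
    (hy : y ∈ treeSpan K n b) : (FreeOp K).comp h e i x y ∈ treeSpan K k c := by
  refine bilin_mem_of_span _ ?_ hx hy
  rintro _ ⟨σ, T, x, hx, rfl⟩ _ ⟨τ, T', y, hy, rfl⟩
  obtain ⟨ρ, hρ⟩ := exists_isBlockPerm h (σ⁻¹ i) σ τ
  have h1 := (FreeOp K).act_comp h e (σ⁻¹ i) σ τ ρ hρ x y
  rw [show σ (σ⁻¹ i) = i by simp] at h1
  refine (congrArg (· ∈ treeSpan K k c) h1).mpr (act_mem_treeSpan _ ?_)
  cases hx
  cases hy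
  obtain ⟨ε, S, z, hz, hε⟩ := exists_graft (K := K) T' T 0 h e (σ⁻¹ i) (by simp)
  refine (congrArg (· ∈ treeSpan K k c) hε).mpr (units_smul_mem _ _ hz.mem_treeSpan)

variable (K) in
/-- The free operad is spanned by the relabelled operations given by planar trees. -/
theorem treeSpan_eq_top (n : ℕ) (g : ℤ × ℤ) : treeSpan K n g = ⊤ := by
  refine eq_top_iff.2 fun x _ => presented_induction (treeSpan K) ?_ ?_ ?_ ?_ x
  · rintro _ _ ⟨n⟩
    exact (isEv_corolla n).mem_treeSpan
  · exact (isEv_ev .leaf 0).mem_treeSpan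
  · exact fun σ x hx => act_mem_treeSpan σ hx
  · exact fun h e i x y hx hy => comp_mem_treeSpan h e i hx hy

end Trees

/-! ### The number of planar trees -/

namespace Plan

/-- The trees and forests with `n` leaves. -/
abbrev WithLeaves (b : Bool) (n : ℕ) : Type := {T : Plan b // T.leaves = n}

/-- The pairs of a tree and a forest with `n` leaves together. -/
abbrev Pairs (n : ℕ) : Type :=
  Σ p : Finset.HasAntidiagonal.antidiagonal n, WithLeaves false p.1.1 × WithLeaves true p.1.2

instance (b : Bool) : IsEmpty (WithLeaves b 0) :=
  ⟨fun T => (T.1.leaves_pos.ne' T.2).elim⟩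

/-- A pair of a tree and a forest with `n` leaves together. -/
def toPairs {n : ℕ} (T : Plan false) (f : Plan true) (h : T.leaves + f.leaves = n) : Pairs n :=
  ⟨⟨(T.leaves, f.leaves), Finset.HasAntidiagonal.mem_antidiagonal.2 h⟩, ⟨T, rfl⟩, ⟨f, rfl⟩⟩

/-- A tree with more than one leaf is given by the first subtree of its root, and the forest of
the others. -/
def treeEquiv {n : ℕ} (hn : n ≠ 1) : WithLeaves false n ≃ Pairs n where
  toFun
    | ⟨leaf, h⟩ => (hn h.symm).elim
    | ⟨node T f, h⟩ => toPairs T f h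
  invFun p := ⟨node p.2.1.1 p.2.2.1, by
    rw [leaves, p.2.1.2, p.2.2.2, Finset.HasAntidiagonal.mem_antidiagonal.1 p.1.2]⟩
  left_inv
    | ⟨leaf, h⟩ => (hn h.symm).elim
    | ⟨node T f, h⟩ => rfl
  right_inv := by
    rintro ⟨⟨⟨i, j⟩, hij⟩, ⟨T, hT⟩, ⟨f, hf⟩⟩
    dsimp only at hT hf
    subst hT hf
    rfl

/-- A forest is either one tree, or given by its first tree and the forest of the others. -/
def forestEquiv (n : ℕ) : WithLeaves true n ≃ WithLeaves false n ⊕ Pairs n where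
  toFun
    | ⟨one T, h⟩ => .inl ⟨T, h⟩
    | ⟨cons T f, h⟩ => .inr (toPairs T f h)
  invFun
    | .inl T => ⟨one T.1, T.2⟩
    | .inr p => ⟨cons p.2.1.1 p.2.2.1, by
        rw [leaves, p.2.1.2, p.2.2.2, Finset.HasAntidiagonal.mem_antidiagonal.1 p.1.2]⟩
  left_inv
    | ⟨one T, h⟩ => rfl
    | ⟨cons T f, h⟩ => rfl
  right_inv := by
    rintro (⟨T, rfl⟩ | ⟨⟨⟨i, j⟩, hij⟩, ⟨T, hT⟩, ⟨f, hf⟩⟩)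
    · rfl
    · dsimp only at hT hf
      subst hT hf
      rfl

theorem eq_leaf_of_leaves {T : Plan false} (h : T.leaves = 1) : T = leaf := by
  cases T with
  | leaf => rfl
  | node T f =>
    have h1 := T.leaves_pos
    have h2 := f.leaves_pos
    rw [leaves] at h
    omega

instance finite_withLeaves (b : Bool) (n : ℕ) : Finite (WithLeaves b n) := by
  induction n using Nat.strong_induction_on generalizing b with
  | _ n ih =>
  have hp : Finite (Pairs n) := by
    suffices h : ∀ p : Finset.HasAntidiagonal.antidiagonal n,
      Finite (WithLeaves false p.1.1 × WithLeaves true p.1.2) from inferInstance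
    rintro ⟨⟨i, j⟩, hij⟩
    rw [Finset.HasAntidiagonal.mem_antidiagonal] at hij
    rcases i.eq_zero_or_pos with rfl | hi
    · infer_instance
    rcases j.eq_zero_or_pos with rfl | hj
    · infer_instance
    have := ih i (by simp at hij; omega) false
    have := ih j (by simp at hij; omega) true
    infer_instance
  have ht : Finite (WithLeaves false n) := by
    by_cases hn : n = 1
    · refine @Finite.of_subsingleton _ ⟨fun T T' => Subtype.ext ?_⟩
      rw [eq_leaf_of_leaves (T.2.trans hn), eq_leaf_of_leaves (T'.2.trans hn)]
    · exact Finite.of_equiv _ (treeEquiv hn).symm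
  cases b with
  | false => exact ht
  | true => exact Finite.of_equiv _ (forestEquiv n).symm

instance (n : ℕ) : Finite (Pairs n) := inferInstance

theorem card_pairs (n : ℕ) : Nat.card (Pairs n) = ∑ p ∈ Finset.HasAntidiagonal.antidiagonal n,
    Nat.card (WithLeaves false p.1) * Nat.card (WithLeaves true p.2) := by
  rw [Nat.card_sigma]
  exact (Finset.sum_congr rfl fun p _ => Nat.card_prod _ _).trans (Finset.sum_coe_sort _
    fun p : ℕ × ℕ => Nat.card (WithLeaves false p.1) * Nat.card (WithLeaves true p.2))

theorem card_tree_one : Nat.card (WithLeaves false 1) = 1 := by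
  refine Nat.card_eq_one_iff_unique.2 ⟨⟨fun T T' => Subtype.ext ?_⟩, ⟨leaf, rfl⟩⟩
  rw [eq_leaf_of_leaves T.2, eq_leaf_of_leaves T'.2]

theorem card_pairs_add_two (n : ℕ) : Nat.card (Pairs (n + 2)) = ∑ k ∈ Finset.range (n + 1),
    Nat.card (WithLeaves false (k + 1)) * Nat.card (WithLeaves true (n - k + 1)) := by
  rw [card_pairs, Finset.Nat.sum_antidiagonal_eq_sum_range_succ
    (fun i j => Nat.card (WithLeaves false i) * Nat.card (WithLeaves true j)),
    Finset.sum_range_succ, Finset.sum_range_succ']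
  simp only [Nat.card_of_isEmpty, zero_mul, Nat.sub_self, mul_zero, add_zero]
  refine Finset.sum_congr rfl fun k hk => ?_
  rw [show n + 2 - (k + 1) = n - k + 1 by have := Finset.mem_range.1 hk; omega]

/-- The forests are counted by the large Schröder numbers, since both satisfy the same recursion. -/
theorem card_forest (n : ℕ) :
    Nat.card (WithLeaves true (n + 1)) = n.largeSchroder ∧
      (n ≠ 0 → 2 * Nat.card (WithLeaves false (n + 1)) = n.largeSchroder) := by
  induction n using Nat.strong_induction_on with
  | _ n ih =>
  cases n with
  | zero =>
    refine ⟨?_, fun h => (h rfl).elim⟩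
    rw [Nat.card_congr (forestEquiv 1), Nat.card_sum, card_tree_one, card_pairs]
    simp [Finset.Nat.antidiagonal_succ]
  | succ n =>
    have h1 : 2 * Nat.card (WithLeaves false (n + 2)) = (n + 1).largeSchroder := by
      rw [Nat.card_congr (treeEquiv (by omega)), card_pairs_add_two, Nat.largeSchroder_succ,
        ← Finset.Icc_bot, show Finset.Icc ⊥ n = Finset.range (n + 1) from
          (Nat.range_succ_eq_Icc_zero n).symm, Finset.sum_range_succ',
        Finset.sum_range_succ', card_tree_one, (ih (n - 0) (by omega)).1, mul_add,
        Finset.mul_sum, Nat.largeSchroder_zero]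
      have h2 : ∀ k ∈ Finset.range n, 2 * (Nat.card (WithLeaves false (k + 1 + 1)) *
          Nat.card (WithLeaves true (n - (k + 1) + 1))) =
          (k + 1).largeSchroder * (n - (k + 1)).largeSchroder := by
        intro k hk
        have hk := Finset.mem_range.1 hk
        rw [(ih (n - (k + 1)) (by omega)).1, ← (ih (k + 1) (by omega)).2 (by omega), mul_assoc]
      rw [Finset.sum_congr rfl h2, Nat.sub_zero]
      omega
    refine ⟨?_, fun _ => h1⟩
    rw [Nat.card_congr (forestEquiv _), Nat.card_sum, ← Nat.card_congr (treeEquiv (by omega)),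
      ← h1, two_mul]

theorem card_tree {n : ℕ} (hn : 1 ≤ n) :
    Nat.card (WithLeaves false n) = n.smallSchroder := by
  obtain ⟨n, rfl⟩ := Nat.exists_eq_add_of_le' hn
  cases n with
  | zero => rw [card_tree_one, Nat.smallSchroder_one]
  | succ n =>
    refine Nat.mul_left_cancel zero_lt_two ?_
    rw [(card_forest (n + 1)).2 (by omega), Nat.two_mul_smallSchroder_succ (by omega)]

/-! ### Planar trees as tuples of words -/

/-- One less than the number of trees of a forest. -/
def num : Plan true → ℕ
  | one _ => 0
  | cons _ f => f.num + 1

/-- The list of words with the letter `j` put in front of its first word. -/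
def consHead (j : ℕ) : List (List ℕ) → List (List ℕ)
  | [] => []
  | w :: l => (j :: w) :: l

/-- The word of a leaf of a tree lists the vertices of which this leaf is the first one that is
seen when the tree is traversed, a vertex with `j + 2` children being written as the letter `j`. -/
def enc : ∀ {b : Bool}, Plan b → List (List ℕ)
  | _, leaf => [[]]
  | _, node T f => consHead f.num (T.enc ++ f.enc)
  | _, one T => T.enc
  | _, cons T f => T.enc ++ f.enc

theorem length_consHead (j : ℕ) (l : List (List ℕ)) : (consHead j l).length = l.length := by
  cases l <;> rfl

theorem length_enc {b : Bool} (T : Plan b) : T.enc.length = T.leaves := by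
  induction T with
  | leaf => rfl
  | node T f hT hf => rw [enc, length_consHead, List.length_append, hT, hf, leaves]
  | one T hT => exact hT
  | cons T f hT hf => rw [enc, List.length_append, hT, hf, leaves]

theorem enc_ne_nil {b : Bool} (T : Plan b) : T.enc ≠ [] := by
  intro h
  have := T.length_enc
  rw [h] at this
  exact T.leaves_pos.ne this

theorem consHead_append (j : ℕ) {l : List (List ℕ)} (hl : l ≠ []) (l' : List (List ℕ)) :
    consHead j l ++ l' = consHead j (l ++ l') := by
  cases l with
  | nil => exact (hl rfl).elim
  | cons w l => rfl

theorem consHead_inj {j j' : ℕ} {l l' : List (List ℕ)} (hl : l ≠ []) (hl' : l' ≠ [])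
    (h : consHead j l = consHead j' l') : j = j' ∧ l = l' := by
  cases l with
  | nil => exact (hl rfl).elim
  | cons w l =>
    cases l' with
    | nil => exact (hl' rfl).elim
    | cons w' l' =>
      simp only [consHead, List.cons.injEq] at h
      exact ⟨h.1.1, by rw [h.1.2, h.2]⟩

theorem consHead_ne_leaf (j : ℕ) {l l' : List (List ℕ)} (hl : l ≠ []) :
    consHead j l ≠ leaf.enc ++ l' := by
  cases l with
  | nil => exact (hl rfl).elim
  | cons w l => simp [consHead, enc]

/-- The two forests, if there are two, have the same number of trees. -/
def SameNum : ∀ {b : Bool}, Plan b → Plan b → Prop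
  | false, _, _ => True
  | true, f, f' => f.num = f'.num

/-- The code of a tree is not a proper initial segment of that of another one. -/
theorem enc_append_inj {b : Bool} (T : Plan b) : ∀ (T' : Plan b) (l l' : List (List ℕ)),
    SameNum T T' → T.enc ++ l = T'.enc ++ l' → T = T' ∧ l = l' := by
  induction T with
  | leaf =>
    intro T' l l' _ h
    cases T' with
    | leaf => exact ⟨rfl, by simpa [enc] using h⟩
    | node T f =>
      rw [enc.eq_2, consHead_append _ (by simp [enc_ne_nil])] at h
      exact (consHead_ne_leaf _ (by simp [enc_ne_nil]) h.symm).elim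
  | node T f hT hf =>
    intro T' l l' _ h
    cases T' with
    | leaf =>
      rw [enc.eq_2, consHead_append _ (by simp [enc_ne_nil])] at h
      exact (consHead_ne_leaf _ (by simp [enc_ne_nil]) h).elim
    | node T' f' =>
      rw [enc, enc, consHead_append _ (by simp [enc_ne_nil]),
        consHead_append _ (by simp [enc_ne_nil])] at h
      obtain ⟨h1, h2⟩ := consHead_inj (by simp [enc_ne_nil]) (by simp [enc_ne_nil]) h
      rw [List.append_assoc, List.append_assoc] at h2
      obtain ⟨rfl, h3⟩ := hT _ _ _ trivial h2
      obtain ⟨rfl, rfl⟩ := hf _ _ _ h1 h3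
      exact ⟨rfl, rfl⟩
  | one T hT =>
    intro T' l l' hs h
    cases T' with
    | one T' =>
      obtain ⟨rfl, rfl⟩ := hT _ _ _ trivial h
      exact ⟨rfl, rfl⟩
    | cons T' f' => exact absurd hs (by simp [SameNum, num])
  | cons T f hT hf =>
    intro T' l l' hs h
    cases T' with
    | one T' => exact absurd hs (by simp [SameNum, num])
    | cons T' f' =>
      rw [enc, enc, List.append_assoc, List.append_assoc] at h
      obtain ⟨rfl, h3⟩ := hT _ _ _ trivial h
      obtain ⟨rfl, rfl⟩ := hf _ _ _ (by simpa [SameNum, num] using hs) h3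
      exact ⟨rfl, rfl⟩

/-- The weight of a word, the letter `j` having the weight `j + 1`. -/
def wordWeight (w : List ℕ) : ℕ := (w.map (· + 1)).sum

/-- The height of the lattice path given by a list of words, in which the word `w` is a step
by its weight minus one. -/
def height (l : List (List ℕ)) : ℤ := (l.map fun w => (wordWeight w : ℤ) - 1).sum

theorem height_append (l l' : List (List ℕ)) : height (l ++ l') = height l + height l' := by
  simp [height]

theorem height_consHead (j : ℕ) {l : List (List ℕ)} (hl : l ≠ []) :
    height (consHead j l) = j + 1 + height l := by
  cases l with
  | nil => exact (hl rfl).elim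
  | cons w l =>
    simp only [consHead, height, wordWeight, List.map_cons, List.sum_cons]
    push_cast
    ring

/-- The bound for the heights of the initial segments of the codes of trees and forests. -/
def drop : ∀ {b : Bool}, Plan b → ℕ
  | false, _ => 0
  | true, f => f.num

theorem height_enc {b : Bool} (T : Plan b) : height T.enc = -(T.drop : ℤ) - 1 := by
  induction T with
  | leaf => simp [enc, height, wordWeight, drop]
  | node T f hT hf =>
    rw [enc, height_consHead _ (by simp [enc_ne_nil]), height_append, hT, hf]
    simp only [drop]
    push_cast
    ring
  | one T hT =>
    rw [enc, hT]
    simp [drop, num]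
  | cons T f hT hf =>
    rw [enc, height_append, hT, hf]
    simp only [drop, num]
    push_cast
    ring

/-- The bound for initial segments of a concatenation, from the bounds for its two parts. -/
theorem height_append_of_prefix {T : Plan false} {f : Plan true}
    (hT : ∀ u v, T.enc = u ++ v → v ≠ [] → -(T.drop : ℤ) ≤ height u)
    (hf : ∀ u v, f.enc = u ++ v → v ≠ [] → -(f.drop : ℤ) ≤ height u) (u v : List (List ℕ))
    (h : T.enc ++ f.enc = u ++ v) (hv : v ≠ []) : -(f.num : ℤ) - 1 ≤ height u := by
  rcases List.append_eq_append_iff.1 h with ⟨a, rfl, ha⟩ | ⟨a, ha, rfl⟩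
  · have h1 := hf a v ha hv
    rw [height_append, height_enc]
    simp only [drop] at *
    push_cast
    linarith
  · by_cases ha' : a = []
    · rw [ha', List.append_nil] at ha
      rw [← ha, height_enc]
      simp only [drop]
      push_cast
      have : (0 : ℤ) ≤ f.num := by positivity
      linarith
    · have h1 := hT u a ha ha'
      simp only [drop] at h1
      have : (0 : ℤ) ≤ f.num := by positivity
      push_cast at h1
      linarith

/-- The path of a tree or forest stays above its bound before its last step. For trees this means
that the height becomes negative only at the end. -/
theorem height_prefix {b : Bool} (T : Plan b) : ∀ u v, T.enc = u ++ v → v ≠ [] →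
    -(T.drop : ℤ) ≤ height u := by
  induction T with
  | leaf =>
    intro u v h hv
    cases u with
    | nil => simp [drop, height]
    | cons w u =>
      simp only [enc, List.cons_append, List.cons.injEq] at h
      exact (hv (List.append_eq_nil_iff.1 h.2.symm).2).elim
  | node T f hT hf =>
    intro u v h hv
    cases u with
    | nil => simp [drop, height]
    | cons w u =>
      obtain ⟨w', l, hl⟩ := List.exists_cons_of_ne_nil (l := T.enc ++ f.enc) (by simp [enc_ne_nil])
      rw [enc, hl] at h
      simp only [consHead, List.cons_append, List.cons.injEq] at h
      have h1 := height_append_of_prefix hT hf (w' :: u) v (by rw [hl, h.2, List.cons_append]) hv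
      have h2 := height_consHead f.num (l := w' :: u) (by simp)
      rw [consHead, h.1] at h2
      rw [h2]
      simp only [drop]
      push_cast
      linarith
  | one T hT => simpa [enc, drop, num] using hT
  | cons T f hT hf =>
    intro u v h hv
    have := height_append_of_prefix hT hf u v h hv
    simp only [drop, num]
    push_cast
    linarith

/-- The cycle lemma: the nontrivial rotations of the code of a tree are not codes of trees. -/
theorem enc_rotate_inj {T T' : Plan false} {r : ℕ} (hr : r < T.leaves)
    (h : T'.enc = T.enc.rotate r) : r = 0 := by
  by_contra hr0
  -- Both parts of the rotated code are initial segments of codes, so their heights are nonnegative,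
  -- while the heights add up to `-1`.
  rw [List.rotate_eq_drop_append_take (by rw [length_enc]; omega)] at h
  have h1 := height_prefix T (T.enc.take r) (T.enc.drop r) (List.take_append_drop _ _).symm
    (by simpa [length_enc] using hr)
  have h2 := height_prefix T' _ _ h (by
    rw [← List.length_pos_iff, List.length_take, length_enc]; omega)
  have h3 := height_enc T
  rw [← List.take_append_drop r T.enc, height_append] at h3
  simp only [drop] at h1 h2 h3
  push_cast at h1 h2 h3
  linarith

/-- Trees with a chosen rotation give different tuples of words. -/
theorem enc_rotate_rotate_inj {T T' : Plan false} {n r r' : ℕ} (hT : T.leaves = n)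
    (hT' : T'.leaves = n) (hr : r < n) (hr' : r' < n) (h : T.enc.rotate r = T'.enc.rotate r') :
    T = T' ∧ r = r' := by
  wlog hrr : r' ≤ r generalizing T T' r r'
  · obtain ⟨h1, h2⟩ := this hT' hT hr' hr h.symm (by omega)
    exact ⟨h1.symm, h2.symm⟩
  have h1 : T'.enc = T.enc.rotate (r - r') := by
    have h2 : (T.enc.rotate (r - r')).rotate r' = T'.enc.rotate r' := by
      rw [List.rotate_rotate, Nat.sub_add_cancel hrr, h]
    exact (List.rotate_injective r' h2).symm
  have h2 : r = r' := by
    have := enc_rotate_inj (by omega) h1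
    omega
  subst h2
  rw [Nat.sub_self, List.rotate_zero] at h1
  exact ⟨(enc_append_inj T T' [] [] trivial (by rw [h1])).1, rfl⟩

/-- The total length of the words is the number of internal vertices. -/
theorem length_flatten_enc {b : Bool} (T : Plan b) :
    T.enc.flatten.length + (if b then 1 else 0) = T.deg := by
  have hc : ∀ (j : ℕ) (l : List (List ℕ)), l ≠ [] →
      (consHead j l).flatten.length = l.flatten.length + 1 := by
    intro j l hl
    cases l with
    | nil => exact (hl rfl).elim
    | cons w l => simp [consHead]
  induction T with
  | leaf => rfl
  | node T f hT hf =>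
    rw [enc, hc _ _ (by simp [enc_ne_nil]), List.flatten_append, List.length_append, deg]
    simp at hT hf ⊢
    omega
  | one T hT =>
    simp [enc, deg] at hT ⊢
    omega
  | cons T f hT hf =>
    rw [enc, List.flatten_append, List.length_append, deg]
    simp at hT hf ⊢
    omega

/-- Among the trees, only the leaf has no internal vertex, and the forests of degree `1` consist
of leaves; every forest has positive degree. -/
theorem eq_leafForest {b : Bool} (T : Plan b) : (match b, T with
    | false, T => T.deg = 0 → T = leaf
    | true, f => f.deg = 1 → ∃ n, f = leafForest n) ∧ (if b then 1 else 0) ≤ T.deg := by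
  induction T with
  | leaf => simp
  | node T f hT hf =>
    refine ⟨fun h => ?_, by simp⟩
    have := hf.2
    simp [deg] at h this
    omega
  | one T hT =>
    refine ⟨fun h => ⟨0, ?_⟩, by simp [deg]⟩
    rw [hT.1 (by simp [deg] at h; omega)]
    rfl
  | cons T f hT hf =>
    have := hf.2
    simp at this
    refine ⟨fun h => ?_, by simp [deg]; omega⟩
    obtain ⟨n, hn⟩ := hf.1 (by rw [deg] at h; omega)
    exact ⟨n + 1, by rw [hn, hT.1 (by rw [deg] at h; omega)]; rfl⟩

theorem eq_corolla {T : Plan false} (h : T.deg = 1) : ∃ n, T = corolla n := by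
  cases T with
  | leaf => cases h
  | node T f =>
    have h1 := (eq_leafForest f).2
    simp at h1
    rw [deg] at h
    obtain ⟨n, hn⟩ := (eq_leafForest f).1 (by omega)
    exact ⟨n, by rw [hn, (eq_leafForest T).1 (by omega)]; rfl⟩

theorem leaves_corolla (n : ℕ) : (corolla n).leaves = n + 2 := by
  have : ∀ n, (leafForest n).leaves = n + 1 := by
    intro n
    induction n with
    | zero => rfl
    | succ n ih => rw [leafForest, leaves, ih, leaves]; omega
  rw [corolla, leaves, this, leaves]; omega

end Plan

/-! ### The endomorphism operad of a vector space -/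

section EndOperad

variable {A : Type*}

/-- The arguments of `x` in `(x ∘ᵢ y)(v)`, if `a` is the value of `y`. -/
def plug {m n k : ℕ} (h : m + n = k + 1) (i : Fin m) (a : A) (v : Fin k → A) : Fin m → A :=
  fun j => if hj : j = i then a else v (outerPos h i j hj)

theorem plug_self {m n k : ℕ} (h : m + n = k + 1) (i : Fin m) (a : A) (v : Fin k → A) :
    plug h i a v i = a := dif_pos rfl

theorem plug_of_ne {m n k : ℕ} (h : m + n = k + 1) (i : Fin m) (a : A) (v : Fin k → A) {j : Fin m}
    (hj : j ≠ i) : plug h i a v j = v (outerPos h i j hj) := dif_neg hj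

theorem plug_eq_update {m n k : ℕ} (h : m + n = k + 1) (i : Fin m) (a b : A) (v : Fin k → A) :
    plug h i a v = Function.update (plug h i b v) i a := by
  funext j
  by_cases hj : j = i
  · subst hj
    rw [plug_self, Function.update_self]
  · rw [Function.update_of_ne hj, plug_of_ne h i _ v hj, plug_of_ne h i _ v hj]

theorem plug_update_outer {m n k : ℕ} (h : m + n = k + 1) (i : Fin m) (a b : A) (v : Fin k → A)
    {j : Fin m} (hj : j ≠ i) :
    plug h i a (Function.update v (outerPos h i j hj) b) = Function.update (plug h i a v) j b := by
  funext j'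
  by_cases hj' : j' = i
  · subst hj'
    rw [plug_self, Function.update_of_ne hj.symm, plug_self]
  · rw [plug_of_ne h i _ _ hj']
    by_cases hjj : j' = j
    · subst hjj
      rw [Function.update_self, Function.update_self]
    · rw [Function.update_of_ne hjj, Function.update_of_ne, plug_of_ne h i _ _ hj']
      exact fun e => hjj (outerPos_injective h i hj' hj e)

theorem plug_update_inner {m n k : ℕ} (h : m + n = k + 1) (i : Fin m) (a b : A) (v : Fin k → A)
    (l : Fin n) : plug h i a (Function.update v (innerPos h i l) b) = plug h i a v := by
  funext j
  by_cases hj : j = i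
  · subst hj
    rw [plug_self, plug_self]
  · rw [plug_of_ne h i _ _ hj, plug_of_ne h i _ _ hj, Function.update_of_ne]
    exact outerPos_ne_innerPos h i hj _

theorem update_innerPos {m n k : ℕ} (h : m + n = k + 1) (i : Fin m) (b : A) (v : Fin k → A)
    (l : Fin n) : (fun l' => Function.update v (innerPos h i l) b (innerPos h i l')) =
      Function.update (fun l' => v (innerPos h i l')) l b := by
  funext l'
  by_cases hl : l' = l
  · subst hl
    rw [Function.update_self, Function.update_self]
  · rw [Function.update_of_ne hl, Function.update_of_ne fun e => hl (innerPos_injective h i e)]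

theorem update_outerPos {m n k : ℕ} (h : m + n = k + 1) (i : Fin m) (b : A) (v : Fin k → A)
    {j : Fin m} (hj : j ≠ i) :
    (fun l' => Function.update v (outerPos h i j hj) b (innerPos h i l')) =
      fun l' => v (innerPos h i l') := by
  funext l'
  rw [Function.update_of_ne (outerPos_ne_innerPos h i hj _).symm]

end EndOperad

section EndOperad

variable (K : Type u) [Field K] (A : Type*) [AddCommGroup A] [Module K A]

/-- The partial composite of multilinear maps. -/
def multilinearComp {m n k : ℕ} (h : m + n = k + 1) (i : Fin m)
    (x : MultilinearMap K (fun _ : Fin m => A) A) (y : MultilinearMap K (fun _ : Fin n => A) A) :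
    MultilinearMap K (fun _ : Fin k => A) A :=
  MultilinearMap.mk' (fun v => x (plug h i (y fun l => v (innerPos h i l)) v))
    (by
      intro v p a b
      rcases exists_pos h i p with ⟨j, hj, rfl⟩ | ⟨l, rfl⟩
      · simp only [update_outerPos, plug_update_outer, MultilinearMap.map_update_add]
      · simp only [update_innerPos, plug_update_inner, MultilinearMap.map_update_add]
        rw [plug_eq_update h i _ 0, plug_eq_update h i (y _) 0, plug_eq_update h i (y _) 0,
          MultilinearMap.map_update_add])
    (by
      intro v p r a
      rcases exists_pos h i p with ⟨j, hj, rfl⟩ | ⟨l, rfl⟩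
      · simp only [update_outerPos, plug_update_outer, MultilinearMap.map_update_smul]
      · simp only [update_innerPos, plug_update_inner, MultilinearMap.map_update_smul]
        rw [plug_eq_update h i _ 0, plug_eq_update h i (y _) 0, MultilinearMap.map_update_smul])

/-- The operad of the multilinear operations on a vector space. -/
def endOperad : Operad K where
  obj n _ := MultilinearMap K (fun _ : Fin n => A) A
  act {n g} :=
    { toFun := fun σ => (MultilinearMap.domDomCongrLinearEquiv K K A A σ).toLinearMap
      map_one' := rfl
      map_mul' := fun _ _ => rfl }
  one := MultilinearMap.ofSubsingleton K A A 0 LinearMap.id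
  comp h _ i := LinearMap.mk₂ K (multilinearComp K A h i) (fun _ _ _ => rfl) (fun _ _ _ => rfl)
    (fun x y y' => MultilinearMap.ext fun v => by
      change x _ = x _ + x _
      rw [plug_eq_update h i _ 0, plug_eq_update h i (y _) 0, plug_eq_update h i (y' _) 0,
        ← MultilinearMap.map_update_add]
      rfl)
    (fun r x y => MultilinearMap.ext fun v => by
      change x _ = r • x _
      rw [plug_eq_update h i _ 0, plug_eq_update h i (y _) 0, ← MultilinearMap.map_update_smul]
      rfl)
  one_comp {n b} h e y := MultilinearMap.ext fun v => by
    change plug h 0 _ v 0 = _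
    rw [plug_self]
    exact congrArg y (funext fun l => congrArg v (Fin.ext (by simp [innerPos])))
  comp_one {m a} h e i x := MultilinearMap.ext fun v => by
    refine congrArg x (funext fun j => ?_)
    by_cases hj : j = i
    · subst hj
      rw [plug_self]
      exact congrArg v (Fin.ext (by simp [innerPos]))
    · rw [plug_of_ne _ _ _ _ hj]
      refine congrArg v (Fin.ext ?_)
      simp only [outerPos]
      split <;> omega
  act_comp {m n k a b c} h e i σ τ ρ hρ x y := MultilinearMap.ext fun v => by
    refine congrArg x (funext fun j => ?_)
    by_cases hj : j = i
    · subst hj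
      rw [plug_self, plug_self]
      exact congrArg y (funext fun l => congrArg v (hρ.2 l).symm)
    · rw [plug_of_ne _ _ _ _ hj, plug_of_ne _ _ _ _ fun e => hj (σ.injective e)]
      exact congrArg v (hρ.1 j hj).symm
  assoc {l m n p q r a b c d d' f} h₁ h₂ h₃ h₄ e₁ e₂ e₃ e₄ i j s hs x y z :=
    MultilinearMap.ext fun v => by
    have hi := i.isLt
    have hj := j.isLt
    refine congrArg x (funext fun j' => ?_)
    by_cases hj' : j' = i
    · subst hj'
      rw [plug_self, plug_self]
      refine congrArg y (funext fun t => ?_)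
      by_cases ht : t = j
      · subst ht
        rw [plug_self, show innerPos h₁ j' t = s from Fin.ext (by simp [innerPos, hs]), plug_self]
        exact congrArg z (funext fun t' => congrArg v (Fin.ext (by simp [innerPos, hs]; omega)))
      · have ht' : innerPos h₁ j' t ≠ s := fun e =>
          ht (Fin.ext (by simpa [innerPos, hs] using congrArg Fin.val e))
        rw [plug_of_ne _ _ _ _ ht, plug_of_ne _ _ _ _ ht']
        refine congrArg v (Fin.ext ?_)
        simp only [innerPos, outerPos, hs]
        split_ifs <;> omega
    · have hne : j'.val ≠ i.val := fun e => hj' (Fin.ext e)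
      have hs' : outerPos h₁ i j' hj' ≠ s := by
        intro e
        have := congrArg Fin.val e
        simp only [outerPos, hs] at this
        split_ifs at this <;> omega
      rw [plug_of_ne _ _ _ _ hj', plug_of_ne _ _ _ _ hj', plug_of_ne _ _ _ _ hs']
      refine congrArg v (Fin.ext ?_)
      simp only [outerPos, hs]
      split_ifs <;> omega
  parallel {l m n p q r a b c d d' f} h₁ h₂ h₃ h₄ e₁ e₂ e₃ e₄ i j s t hij hs ht x y z := by
    rw [AddMonoidHom.zero_apply, zero_mul, Int.negOnePow_zero, one_smul]
    refine MultilinearMap.ext fun v => ?_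
    have hi := i.isLt
    have hj := j.isLt
    have hij' : i.val < j.val := hij
    refine congrArg x (funext fun j' => ?_)
    by_cases hi' : j' = i
    · have hne : j' ≠ j := hi'.trans_ne hij.ne
      subst hi'
      have ht' : outerPos h₃ j j' hne = t := by
        refine Fin.ext ?_
        simp only [outerPos, ht]
        split_ifs
        omega
      rw [plug_self, plug_of_ne _ _ _ _ hne, ht', plug_self]
      refine congrArg y (funext fun t' => ?_)
      have h' : innerPos h₁ j' t' ≠ s := by
        intro e
        have := congrArg Fin.val e
        simp only [innerPos] at this
        omega
      rw [plug_of_ne _ _ _ _ h']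
      exact congrArg v (Fin.ext ((if_pos (show j'.val + t'.val < s.val by omega)).trans
        (congrArg (· + t'.val) ht.symm)))
    · have hne : j'.val ≠ i.val := fun e => hi' (Fin.ext e)
      rw [plug_of_ne _ _ _ _ hi']
      by_cases hj' : j' = j
      · subst hj'
        have hs' : outerPos h₁ i j' hi' = s := by
          refine Fin.ext ?_
          simp only [outerPos]
          split_ifs <;> omega
        rw [plug_self, hs', plug_self]
        refine congrArg z (funext fun t' => ?_)
        have h' : innerPos h₃ j' t' ≠ t := by
          intro e
          have := congrArg Fin.val e
          simp only [innerPos] at this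
          omega
        rw [plug_of_ne _ _ _ _ h']
        have h0 : s.val + t'.val = j'.val + t'.val + m - 1 := by omega
        exact congrArg v (Fin.ext (h0.trans
          (if_neg (show ¬ j'.val + t'.val < t.val by omega)).symm))
      · have hne' : j'.val ≠ j.val := fun e => hj' (Fin.ext e)
        have h1 : outerPos h₁ i j' hi' ≠ s := by
          intro e
          have := congrArg Fin.val e
          simp only [outerPos] at this
          split_ifs at this <;> omega
        have h2 : outerPos h₃ j j' hj' ≠ t := by
          intro e
          have := congrArg Fin.val e
          simp only [outerPos] at this
          split_ifs at this <;> omega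
        rw [plug_of_ne _ _ _ _ hj', plug_of_ne _ _ _ _ h1, plug_of_ne _ _ _ _ h2]
        refine congrArg v (Fin.ext ?_)
        simp only [outerPos]
        split_ifs <;> omega

end EndOperad

/-! ### A lower bound for the dimension of `Lie n` -/

/-- A family on which some linear maps are given by a diagonal matrix is linearly independent. -/
theorem linearIndependent_of_diagonal {K M N ι : Type*} [Field K] [AddCommGroup M] [Module K M]
    [AddCommGroup N] [Module K N] [DecidableEq ι] {x : ι → M} {t : N} (ht : t ≠ 0)
    (f : ι → M →ₗ[K] N) (h : ∀ i j, f i (x j) = if j = i then t else 0) :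
    LinearIndependent K x := by
  refine linearIndependent_iff'.2 fun s c hc i hi => ?_
  have h1 := congrArg (f i) hc
  rw [map_sum, map_zero] at h1
  simp only [map_smul, h] at h1
  rw [Finset.sum_eq_single i (fun j _ hj => by rw [if_neg hj, smul_zero])
    (fun hi' => (hi' hi).elim), if_pos rfl] at h1
  exact (smul_eq_zero.1 h1).resolve_right ht

section Commutator

variable (K : Type u) [Field K] (A : Type*) [Ring A] [Algebra K A]

/-- The product of an algebra as an operation of arity `2`. -/
def mulMap : MultilinearMap K (fun _ : Fin 2 => A) A := MultilinearMap.mkPiAlgebraFin K 2 A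

theorem mulMap_apply (v : Fin 2 → A) : mulMap K A v = v 0 * v 1 := by
  simp [mulMap, MultilinearMap.mkPiAlgebraFin_apply]

/-- The commutator of an algebra. -/
def commutatorMap : (endOperad K A).obj 2 () :=
  (mulMap K A - (mulMap K A).domDomCongr (Equiv.swap 0 1) :
    MultilinearMap K (fun _ : Fin 2 => A) A)

variable {K A}

theorem commutatorMap_apply (v : Fin 2 → A) :
    DFunLike.coe (F := MultilinearMap K (fun _ : Fin 2 => A) A) (commutatorMap K A) v =
      v 0 * v 1 - v 1 * v 0 := by
  have h : mulMap K A (fun j => v (Equiv.swap 0 1 j)) = v 1 * v 0 := by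
    rw [mulMap_apply, Equiv.swap_apply_left, Equiv.swap_apply_right]
  rw [← mulMap_apply (K := K), ← h]
  rfl

/-- The value of a multilinear operation. -/
def evalAt {n : ℕ} {g : Unit} (x : (endOperad K A).obj n g) (v : Fin n → A) : A :=
  DFunLike.coe (F := MultilinearMap K (fun _ : Fin n => A) A) x v

theorem evalAt_comp {m n k : ℕ} (h : m + n = k + 1) {a b c : Unit} (e : a + b = c) (i : Fin m)
    (x : (endOperad K A).obj m a) (y : (endOperad K A).obj n b) (v : Fin k → A) :
    evalAt ((endOperad K A).comp h e i x y) v =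
      evalAt x (plug h i (evalAt y fun l => v (innerPos h i l)) v) := rfl

theorem evalAt_act {n : ℕ} {g : Unit} (σ : Equiv.Perm (Fin n)) (x : (endOperad K A).obj n g)
    (v : Fin n → A) : evalAt ((endOperad K A).act σ x) v = evalAt x fun j => v (σ j) := rfl

theorem evalAt_add {n : ℕ} {g : Unit} (x y : (endOperad K A).obj n g) (v : Fin n → A) :
    evalAt (x + y) v = evalAt x v + evalAt y v := rfl

theorem evalAt_zero {n : ℕ} {g : Unit} (v : Fin n → A) :
    evalAt (0 : (endOperad K A).obj n g) v = 0 := rfl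

theorem evalAt_ext {n : ℕ} {g : Unit} {x y : (endOperad K A).obj n g}
    (h : ∀ v, evalAt x v = evalAt y v) : x = y := MultilinearMap.ext h

theorem evalAt_commutator (v : Fin 2 → A) :
    evalAt (commutatorMap K A) v = v 0 * v 1 - v 1 * v 0 := commutatorMap_apply v

variable (K A) in
/-- The operations by which `Lie` is going to act. -/
def lieGenMap : ∀ {n : ℕ} {g : Unit}, LieGen n g → (endOperad K A).obj n g
  | _, _, .bracket => commutatorMap K A

theorem evalAt_commutator_comp (h : 2 + 2 = 3 + 1) (e : () + () = ()) (v : Fin 3 → A) :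
    evalAt ((endOperad K A).comp h e 0 (commutatorMap K A) (commutatorMap K A)) v =
      (v 0 * v 1 - v 1 * v 0) * v 2 - v 2 * (v 0 * v 1 - v 1 * v 0) := by
  rw [evalAt_comp, evalAt_commutator, evalAt_commutator, plug_self, plug_of_ne _ _ _ _ (by decide)]
  rfl

theorem lieGenMap_rel {n : ℕ} {g : Unit} (x : Lin K LieGen n g) (hx : LieRel K x) :
    evalLin (endOperad K A) (lieGenMap K A) x = 0 := by
  cases hx with
  | skew =>
    rw [map_add, evalLin_act, evalLin_mon]
    refine evalAt_ext fun v => ?_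
    rw [evalAt_add, evalAt_act]
    change evalAt (commutatorMap K A) _ + evalAt (commutatorMap K A) _ = _
    rw [evalAt_commutator, evalAt_commutator, evalAt_zero, Equiv.swap_apply_left,
      Equiv.swap_apply_right]
    abel
  | jacobi h e x hx =>
    rw [map_add, map_add, evalLin_act, evalLin_act, evalLin_act, hx, evalLin_comp, evalLin_mon]
    refine evalAt_ext fun v => ?_
    rw [evalAt_add, evalAt_add, evalAt_act, evalAt_act, evalAt_act]
    refine (congrArg₂ (· + ·) (congrArg₂ (· + ·) (evalAt_commutator_comp h e _)
      (evalAt_commutator_comp h e _)) (evalAt_commutator_comp h e _)).trans ?_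
    simp only [evalAt_zero, show finRotate 3 0 = 1 by decide, show finRotate 3 1 = 2 by decide,
      show finRotate 3 2 = 0 by decide]
    noncomm_ring

variable (K A) in
/-- The action of `Lie` on an associative algebra by commutators. -/
def lieHom : OperadHom (Lie K) (endOperad K A) :=
  presentedLift (endOperad K A) (lieGenMap K A) lieGenMap_rel

theorem evalAt_leftNormed_succ (n : ℕ) (v : Fin (n + 2) → A) :
    evalAt ((lieHom K A).map (leftNormed K (n + 1))) v =
      evalAt ((lieHom K A).map (leftNormed K n)) (fun i => v i.castSucc) * v (Fin.last _) -
        v (Fin.last _) * evalAt ((lieHom K A).map (leftNormed K n)) (fun i => v i.castSucc) := by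
  have h1 : (lieHom K A).map (lieBr K) = commutatorMap K A :=
    presentedLift_gen (endOperad K A) (lieGenMap K A) lieGenMap_rel .bracket
  have h2 := (lieHom K A).map_comp (m := 2) (n := n + 1) (k := n + 2) (a := ()) (b := ()) (c := ())
    (by omega) rfl 0 (lieBr K) (leftNormed K n)
  have h3 : leftNormed K (n + 1) = (Lie K).comp (m := 2) (n := n + 1) (k := n + 2) (a := ())
    (b := ()) (c := ()) (by omega) rfl 0 (lieBr K) (leftNormed K n) := rfl
  rw [h3, h2, h1, evalAt_comp, evalAt_commutator, plug_self, plug_of_ne _ _ _ _ (by decide),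
    show outerPos (by omega : 2 + (n + 1) = n + 2 + 1) 0 1 (by decide) = Fin.last (n + 1) from
      Fin.ext (by simp [outerPos]),
    show (fun l : Fin (n + 1) => v (innerPos (by omega : 2 + (n + 1) = n + 2 + 1) 0 l)) =
      fun l => v l.castSucc from funext fun l => congrArg v (Fin.ext (by simp [innerPos]))]

theorem evalAt_leftNormed_zero (v : Fin 1 → A) :
    evalAt ((lieHom K A).map (leftNormed K 0)) v = v 0 := by
  have h : (lieHom K A).map (leftNormed K 0) = (endOperad K A).one := (lieHom K A).map_one
  rw [h]
  rfl

end Commutator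

section LieLowerBound

variable (K : Type u) [Field K]

/-- The free associative algebra. -/
abbrev FreeAssoc := MonoidAlgebra K (FreeMonoid ℕ)

/-- The generators of the free associative algebra. -/
def letterX (j : ℕ) : FreeAssoc K := MonoidAlgebra.single (FreeMonoid.of j) 1

/-- The coefficient of a word. -/
def coeffAt (l : List ℕ) : FreeAssoc K →ₗ[K] K where
  toFun y := y.coeff (FreeMonoid.ofList l)
  map_add' _ _ := rfl
  map_smul' _ _ := rfl

variable {K}

theorem coeffAt_letterX (j : ℕ) (l : List ℕ) :
    coeffAt K l (letterX K j) = if l = [j] then 1 else 0 := by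
  classical
  refine (Finsupp.single_apply (a := FreeMonoid.of j) (a' := FreeMonoid.ofList l)).trans ?_
  refine if_congr ⟨fun h => ?_, fun h => ?_⟩ rfl rfl
  · exact (congrArg FreeMonoid.toList h).symm
  · rw [h]; rfl

theorem coeffAt_letterX_mul {j i : ℕ} (hij : i ≠ j) (l : List ℕ) (y : FreeAssoc K) :
    coeffAt K (i :: l) (letterX K j * y) = 0 := by
  refine MonoidAlgebra.coeff_single_mul_of_forall_mul_ne (M := FreeMonoid ℕ) _ _ fun d hd => ?_
  exact hij (List.cons.inj (congrArg FreeMonoid.toList hd)).1.symm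

theorem coeffAt_mul_letterX_of_ne {j i : ℕ} (hij : i ≠ j) (l : List ℕ) (y : FreeAssoc K) :
    coeffAt K (l ++ [i]) (y * letterX K j) = 0 := by
  refine MonoidAlgebra.coeff_mul_single_of_forall_mul_ne (M := FreeMonoid ℕ) _ _ fun d hd => ?_
  have := congrArg FreeMonoid.toList hd
  rw [FreeMonoid.toList_ofList, FreeMonoid.toList_mul, FreeMonoid.toList_of] at this
  exact hij (List.cons.inj (List.append_inj_right' this rfl)).1.symm

theorem coeffAt_mul_letterX (j : ℕ) (l : List ℕ) (y : FreeAssoc K) :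
    coeffAt K (l ++ [j]) (y * letterX K j) = coeffAt K l y := by
  refine (MonoidAlgebra.coeff_mul_single_eq_coeff_mul (FreeMonoid.ofList l) ?_).trans (mul_one _)
  intro a _
  rw [FreeMonoid.ofList_append]
  exact ⟨fun h => mul_right_cancel h, fun h => by rw [h]; rfl⟩

/-- In the expansion of a left-normed bracket, exactly one word begins with the first letter. -/
theorem coeffAt_leftNormed (n : ℕ) (c : Fin (n + 1) → ℕ) (hc : ∀ i, i ≠ 0 → c i ≠ c 0)
    (l : List ℕ) : coeffAt K (c 0 :: l) (evalAt ((lieHom K (FreeAssoc K)).map (leftNormed K n))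
      fun i => letterX K (c i)) = if c 0 :: l = List.ofFn c then 1 else 0 := by
  induction n generalizing l with
  | zero =>
    rw [evalAt_leftNormed_zero, coeffAt_letterX]
    rfl
  | succ n ih =>
    rw [evalAt_leftNormed_succ, map_sub, coeffAt_letterX_mul (hc _ (by simp)).symm, sub_zero,
      List.ofFn_succ']
    rcases List.eq_nil_or_concat l with rfl | ⟨l, j, rfl⟩
    · have := coeffAt_mul_letterX_of_ne (K := K) (hc (Fin.last (n + 1)) (by simp)).symm []
      rw [if_neg]
      · exact this _
      · intro h
        have := congrArg List.length h
        simp at this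
    · rw [List.concat_eq_append, ← List.cons_append]
      by_cases hj : j = c (Fin.last (n + 1))
      · subst hj
        rw [coeffAt_mul_letterX]
        refine (ih (fun i => c i.castSucc) (fun i hi => hc _ fun e => hi ?_) l).trans ?_
        · exact Fin.castSucc_injective _ e
        · rw [List.concat_eq_append]
          refine if_congr (List.append_left_inj _).symm rfl rfl
      · rw [coeffAt_mul_letterX_of_ne hj, if_neg]
        intro h
        rw [List.concat_eq_append] at h
        exact hj (List.cons.inj (List.append_inj_right' h rfl)).1

/-- The relabellings that fix the first input. -/
def extendPerm {n : ℕ} (σ : Equiv.Perm (Fin n)) : Equiv.Perm (Fin (n + 1)) :=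
  Equiv.Perm.decomposeFin.symm (0, σ)

variable (K) in
/-- The left-normed brackets that begin with the first input are linearly independent: they are
separated by the words that begin with the first letter. -/
theorem linearIndependent_leftNormed (n : ℕ) :
    LinearIndependent K fun σ : Equiv.Perm (Fin n) =>
      (Lie K).act (extendPerm σ) (leftNormed K n) := by
  let f : (Equiv.Perm (Fin n)) → (Lie K).obj (n + 1) () →ₗ[K] K := fun τ =>
    { toFun := fun x => coeffAt K (List.ofFn fun i => (extendPerm τ i : ℕ))
        (evalAt ((lieHom K (FreeAssoc K)).map x) fun i => letterX K i)
      map_add' := fun x y => by rw [map_add, evalAt_add, map_add]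
      map_smul' := fun r x => by
        rw [map_smul]
        exact map_smul (coeffAt K _) r _ }
  have h0 : ∀ σ : Equiv.Perm (Fin n), extendPerm σ 0 = 0 := fun σ => by
    simp [extendPerm]
  refine linearIndependent_of_diagonal one_ne_zero f fun τ σ => ?_
  change coeffAt K _ (evalAt ((lieHom K (FreeAssoc K)).map ((Lie K).act _ _)) _) = _
  rw [(lieHom K (FreeAssoc K)).map_act, evalAt_act, List.ofFn_succ, h0, ← h0 σ]
  rw [coeffAt_leftNormed n (fun i => (extendPerm σ i : ℕ))
    (fun i hi e => hi ((extendPerm σ).injective (Fin.ext e)))]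
  refine if_congr ⟨fun h => ?_, fun h => ?_⟩ rfl rfl
  · have h1 : List.ofFn (fun i => (extendPerm τ i : ℕ)) =
        List.ofFn fun i => (extendPerm σ i : ℕ) := by
      rw [← h, List.ofFn_succ, h0, h0]
    have h2 : extendPerm σ = extendPerm τ := Equiv.ext fun i =>
      Fin.ext (congrFun (List.ofFn_injective h1) i).symm
    exact congrArg Prod.snd (Equiv.Perm.decomposeFin.symm.injective h2)
  · rw [h, List.ofFn_succ]

theorem finite_lie (n : ℕ) : Module.Finite K ((Lie K).obj n ()) := by
  refine Module.finite_def.2 (lieSpan_eq_top (K := K) n ▸ Submodule.fg_span ?_)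
  cases n with
  | zero =>
    convert Set.finite_empty
    refine Set.eq_empty_iff_forall_notMem.2 ?_
    rintro x ⟨k, σ, h⟩
    exact absurd (congrArg Sigma.fst h) (Nat.succ_ne_zero k).symm
  | succ n =>
    refine (Set.finite_range fun σ => (Lie K).act σ (leftNormed K n)).subset ?_
    rintro x ⟨k, σ, h⟩
    cases h
    exact ⟨σ, rfl⟩

theorem factorial_le_finrank_lie (n : ℕ) :
    n.factorial ≤ Module.finrank K ((Lie K).obj (n + 1) ()) := by
  have := finite_lie (K := K) (n + 1)
  have := (linearIndependent_leftNormed K n).fintype_card_le_finrank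
  rwa [Fintype.card_perm, Fintype.card_fin] at this

end LieLowerBound

/-! ### The exterior algebra as an operad -/

section Exterior

variable (K : Type u) [Field K]

/-- The exterior algebra on generators that are indexed by the natural numbers. -/
abbrev Ext := ExteriorAlgebra K (ℕ → K)

/-- The even or odd part of the exterior algebra, according to the parity of `d`. -/
abbrev extPart (d : ℤ) : Submodule K (Ext K) :=
  CliffordAlgebra.evenOdd (0 : QuadraticForm K (ℕ → K)) (d : ZMod 2)

/-- A generator of the exterior algebra. -/
def theta (j : ℕ) : Ext K := ExteriorAlgebra.ι K (Pi.single j 1)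

variable {K}

theorem theta_mem (j : ℕ) : theta K j ∈ extPart K 1 := by
  rw [extPart, Int.cast_one]
  exact CliffordAlgebra.ι_mem_evenOdd_one _ _

theorem one_mem_extPart : (1 : Ext K) ∈ extPart K 0 := by
  rw [extPart, Int.cast_zero]
  exact SetLike.GradedOne.one_mem

theorem mul_mem_extPart {a b c : ℤ} (e : a + b = c) {x y : Ext K} (hx : x ∈ extPart K a)
    (hy : y ∈ extPart K b) : x * y ∈ extPart K c := by
  rw [extPart, ← e, Int.cast_add]
  exact SetLike.mul_mem_graded hx hy

theorem mul_comm_extPart {a b : ℤ} {x y : Ext K} (hx : x ∈ extPart K a) (hy : y ∈ extPart K b) :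
    x * y = (a * b).negOnePow • (y * x) := by
  have h := CliffordAlgebra.map_mul_map_of_isOrtho_of_mem_evenOdd
    (QuadraticMap.Isometry.id (0 : QuadraticForm K (ℕ → K)))
    (QuadraticMap.Isometry.id (0 : QuadraticForm K (ℕ → K)))
    (fun x y => by simp [QuadraticMap.isOrtho_def]) x y hx hy
  rw [CliffordAlgebra.map_id, AlgHom.id_apply, AlgHom.id_apply] at h
  rw [h, ← Int.cast_mul, uzpow_intCast, mul_comm b a]
  rfl

variable (K) in
/-- The operad all of whose components are the exterior algebra, with its parity; partial
compositions are given by the product. -/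
def extOperad : GradedOperad K (ℤ × ℤ) degreeHom where
  obj _ g := extPart K g.1
  act := 1
  one := ⟨1, one_mem_extPart⟩
  comp _ e _ := LinearMap.mk₂ K
    (fun x y => ⟨x.1 * y.1, mul_mem_extPart (congrArg Prod.fst e) x.2 y.2⟩)
    (fun x x' y => Subtype.ext (add_mul _ _ _)) (fun r x y => Subtype.ext (smul_mul_assoc _ _ _))
    (fun x y y' => Subtype.ext (mul_add _ _ _)) (fun r x y => Subtype.ext (mul_smul_comm _ _ _))
  one_comp _ _ y := Subtype.ext (one_mul _)
  comp_one _ _ _ x := Subtype.ext (mul_one _)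
  act_comp _ _ _ _ _ _ _ _ _ := rfl
  assoc _ _ _ _ _ _ _ _ _ _ _ _ x y z := Subtype.ext (mul_assoc _ _ _)
  parallel _ _ _ _ _ _ _ _ _ _ _ _ _ _ _ x y z := Subtype.ext <| by
    change x.1 * y.1 * z.1 = _
    rw [mul_assoc, mul_comm_extPart y.2 z.2, Units.smul_def, mul_smul_comm, ← mul_assoc]
    rfl

variable (K) in
/-- The product of the first `g` generators of the exterior algebra. -/
def thetaProd : ℕ → Ext K
  | 0 => 1
  | g + 1 => thetaProd g * theta K g

theorem thetaProd_eq (g : ℕ) :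
    thetaProd K g = ExteriorAlgebra.ιMulti K g fun i : Fin g => (Pi.single i.val 1 : ℕ → K) := by
  rw [ExteriorAlgebra.ιMulti_apply]
  induction g with
  | zero => rw [List.ofFn_zero, List.prod_nil, thetaProd]
  | succ g ih =>
    rw [List.ofFn_succ', List.concat_eq_append, List.prod_append, List.prod_singleton, thetaProd,
      ih]
    rfl

/-- The product of generators is mapped to a determinant `1`. -/
theorem thetaProd_ne_zero (g : ℕ) : thetaProd K g ≠ 0 := by
  intro h
  let f : ∀ i, (ℕ → K) [⋀^Fin i]→ₗ[K] K := fun i =>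
    (Matrix.detRowAlternating (R := K) (n := Fin i)).compLinearMap
      (LinearMap.funLeft K K (Fin.val : Fin i → ℕ))
  have h1 := ExteriorAlgebra.liftAlternating_apply_ιMulti f
    fun i : Fin g => (Pi.single i.val 1 : ℕ → K)
  rw [← thetaProd_eq, h, map_zero] at h1
  have h2 : (fun i : Fin g => LinearMap.funLeft K K (Fin.val : Fin g → ℕ)
      (Pi.single i.val 1 : ℕ → K)) = (1 : Matrix (Fin g) (Fin g) K) := by
    funext i j
    simp [LinearMap.funLeft_apply, Pi.single_apply, Matrix.one_apply, Fin.ext_iff, eq_comm]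
  refine one_ne_zero (α := K) ?_
  rw [← Matrix.det_one (n := Fin g), ← h2]
  exact h1.symm

end Exterior

/-! ### The action of `O` on a polynomial algebra -/

section Polynomial

variable (K : Type u) [Field K] (ι : Type)

/-- The polynomials in variables indexed by an element of `ι` and a list of pairs of natural
numbers. -/
abbrev Poly := MvPolynomial (ι × List (ℕ × ℕ)) K

variable {ι} in
/-- The derivation that puts the pair `p` in front of the list of each variable. -/
def polyDer (p : ℕ × ℕ) : Derivation K (Poly K ι) (Poly K ι) :=
  MvPolynomial.mkDerivation K fun q => MvPolynomial.X (q.1, p :: q.2)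

/-- A linear map as an operation of arity `1`. -/
def unaryMap {K : Type u} [Field K] {A : Type*} [AddCommGroup A] [Module K A] (f : A →ₗ[K] A) :
    (endOperad K A).obj 1 () := MultilinearMap.ofSubsingleton K A A (0 : Fin 1) f

theorem evalAt_unaryMap {K : Type u} [Field K] {A : Type*} [Ring A] [Algebra K A] (f : A →ₗ[K] A)
    (v : Fin 1 → A) : evalAt (unaryMap f) v = f (v 0) := rfl

/-- The operad of the multilinear operations on the polynomial algebra, with coefficients in the
exterior algebra. -/
def polyOperad : GradedOperad K (ℤ × ℤ) degreeHom := tensorOperad (endOperad K (Poly K ι)) (extOperad K)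

variable {K ι}

/-- The operation `f` with the coefficient `t`. -/
def pt {n : ℕ} {g : ℤ × ℤ} (f : (endOperad K (Poly K ι)).obj n ()) (t : (extOperad K).obj n g) :
    (polyOperad K ι).obj n g := tensorMk _ _ f t

theorem pt_comp {m n k : ℕ} {a b c : ℤ × ℤ} (h : m + n = k + 1) (e : a + b = c) (i : Fin m)
    (x : (endOperad K (Poly K ι)).obj m ()) (y : (extOperad K).obj m a)
    (x' : (endOperad K (Poly K ι)).obj n ()) (y' : (extOperad K).obj n b) :
    (polyOperad K ι).comp h e i (pt x y) (pt x' y') =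
      pt ((endOperad K (Poly K ι)).comp (a := ()) (b := ()) (c := ()) h rfl i x x')
        ((extOperad K).comp h e i y y') := rfl

theorem pt_act {n : ℕ} {a : ℤ × ℤ} (σ : Equiv.Perm (Fin n))
    (x : (endOperad K (Poly K ι)).obj n ()) (y : (extOperad K).obj n a) :
    (polyOperad K ι).act σ (pt x y) = pt ((endOperad K (Poly K ι)).act σ x) y := rfl

@[elab_as_elim]
theorem poly_induction {n : ℕ} {a : ℤ × ℤ} {p : (polyOperad K ι).obj n a → Prop} (zero : p 0)
    (add : ∀ x y, p x → p y → p (x + y)) (pt : ∀ f t, p (pt f t)) (x : (polyOperad K ι).obj n a) :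
    p x :=
  TensorProduct.induction_on (motive := p) x zero pt add

theorem pt_add {n : ℕ} {a : ℤ × ℤ} (x x' : (endOperad K (Poly K ι)).obj n ())
    (y : (extOperad K).obj n a) : pt (x + x') y = pt x y + pt x' y := by
  exact LinearMap.map_add₂ (tensorMk _ _) x x' y

variable (K ι) in
/-- The multiplication of polynomials as an operation of arity `2`. -/
def polyProd : (endOperad K (Poly K ι)).obj 2 () := mulMap K (Poly K ι)

variable (K) in
/-- The unit of the exterior algebra as an operation of degree `0`. -/
def extOne (n : ℕ) (w : ℤ) : (extOperad K).obj n (0, w) := ⟨1, one_mem_extPart⟩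

variable (K) in
/-- A generator of the exterior algebra as an operation of degree `1`. -/
def extTheta (n : ℕ) (w : ℤ) (j : ℕ) : (extOperad K).obj n (1, w) := ⟨theta K j, theta_mem j⟩

variable (K ι) in
/-- The multiplication of polynomials, with coefficient `1`. -/
def polyMul : (polyOperad K ι).obj 2 (0, -1) := pt (polyProd K ι) (extOne K 2 (-1))

variable (K ι) in
/-- The operation by which `d_{n+1}` acts: the sum of the derivations `polyDer (n, j)` with
coefficients `theta j`, for `j < N`. -/
def polyD (N n : ℕ) (w : ℤ) : (polyOperad K ι).obj 1 (1, w) :=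
  ∑ j ∈ Finset.range N, pt (unaryMap (polyDer K (n, j)).toLinearMap) (extTheta K 1 w j)

variable (K ι) in
/-- The operations by which `O` acts on polynomials. -/
def polyGen (N : ℕ) : ∀ {n : ℕ} {g : ℤ × ℤ}, OGen n g → (polyOperad K ι).obj n g
  | _, _, .d n _ => polyD K ι N (n - 1) n
  | _, _, .mul => polyMul K ι

theorem polyProd_swap : (endOperad K (Poly K ι)).act (g := ()) (Equiv.swap 0 1) (polyProd K ι) =
    polyProd K ι := by
  refine evalAt_ext fun v => ?_
  rw [evalAt_act]
  refine (mulMap_apply _ _ _).trans (Eq.trans ?_ (mulMap_apply _ _ _).symm)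
  rw [Equiv.swap_apply_left, Equiv.swap_apply_right, mul_comm]

theorem evalAt_polyProd (v : Fin 2 → Poly K ι) :
    evalAt (polyProd K ι) v = v 0 * v 1 := mulMap_apply _ _ v

theorem polyProd_assoc (h : 2 + 2 = 3 + 1) :
    (endOperad K (Poly K ι)).comp (a := ()) (b := ()) (c := ()) h rfl 0 (polyProd K ι)
      (polyProd K ι) =
    (endOperad K (Poly K ι)).comp (a := ()) (b := ()) (c := ()) h rfl 1 (polyProd K ι)
      (polyProd K ι) := by
  refine evalAt_ext fun v => ?_
  rw [evalAt_comp, evalAt_comp, evalAt_polyProd, evalAt_polyProd, evalAt_polyProd, evalAt_polyProd,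
    plug_self, plug_self, plug_of_ne _ _ _ _ (by decide), plug_of_ne _ _ _ _ (by decide)]
  exact mul_assoc (v 0) (v 1) (v 2)

theorem unaryMap_polyProd (D : Derivation K (Poly K ι) (Poly K ι)) (h : 1 + 2 = 2 + 1)
    (h' : 2 + 1 = 2 + 1) :
    (endOperad K (Poly K ι)).comp (a := ()) (b := ()) (c := ()) h rfl 0 (unaryMap D.toLinearMap)
      (polyProd K ι) =
    (endOperad K (Poly K ι)).comp (a := ()) (b := ()) (c := ()) h' rfl 0 (polyProd K ι)
      (unaryMap D.toLinearMap) +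
    (endOperad K (Poly K ι)).comp (a := ()) (b := ()) (c := ()) h' rfl 1 (polyProd K ι)
      (unaryMap D.toLinearMap) := by
  refine evalAt_ext fun v => ?_
  rw [evalAt_add, evalAt_comp, evalAt_comp, evalAt_comp, evalAt_polyProd, evalAt_polyProd,
    evalAt_polyProd, evalAt_unaryMap, evalAt_unaryMap, evalAt_unaryMap,
    plug_self, plug_self, plug_self, plug_of_ne _ _ _ _ (by decide),
    plug_of_ne _ _ _ _ (by decide)]
  refine (D.leibniz (v 0) (v 1)).trans ?_
  rw [smul_eq_mul, smul_eq_mul, mul_comm (v 1), add_comm]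
  rfl

theorem polyGen_rel (N : ℕ) {n : ℕ} {g : ℤ × ℤ} (x : Lin K OGen n g) (hx : ORel K x) :
    evalLin (polyOperad K ι) (polyGen K ι N) x = 0 := by
  cases hx with
  | comm =>
    rw [map_sub, evalLin_act, evalLin_mon, sub_eq_zero]
    change polyMul K ι = (polyOperad K ι).act _ (polyMul K ι)
    rw [polyMul, pt_act, polyProd_swap]
  | assoc h e =>
    rw [map_sub, evalLin_comp, evalLin_comp, evalLin_mon, sub_eq_zero]
    change (polyOperad K ι).comp _ _ _ (polyMul K ι) (polyMul K ι) =
      (polyOperad K ι).comp _ _ _ (polyMul K ι) (polyMul K ι)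
    rw [polyMul, pt_comp, pt_comp, polyProd_assoc]
    rfl
  | deriv n hn h h' e e' =>
    rw [map_sub, map_add, evalLin_comp, evalLin_comp, evalLin_comp, evalLin_mon, evalLin_mon,
      sub_eq_zero]
    change (polyOperad K ι).comp h e 0 (polyD K ι N (n - 1) n) (polyMul K ι) =
      (polyOperad K ι).comp h' e' 0 (polyMul K ι) (polyD K ι N (n - 1) n) +
      (polyOperad K ι).comp h' e' 1 (polyMul K ι) (polyD K ι N (n - 1) n)
    rw [polyD, map_sum, LinearMap.sum_apply, map_sum, map_sum, ← Finset.sum_add_distrib]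
    refine Finset.sum_congr rfl fun j _ => ?_
    rw [polyMul, pt_comp, pt_comp, pt_comp, unaryMap_polyProd _ h h', pt_add]
    have ht : (extOperad K).comp h e 0 (extTheta K 1 n j)
        (extOne K 2 (-1)) =
        (extOperad K).comp h' e' 0 (extOne K 2 (-1))
        (extTheta K 1 n j) :=
      Subtype.ext ((mul_one _).trans (one_mul _).symm)
    rw [ht]
    rfl

variable (K ι) in
/-- The action of `O` on polynomials. -/
def polyHom (N : ℕ) : OperadHom (OOperad K) (polyOperad K ι) :=
  presentedLift (polyOperad K ι) (polyGen K ι N) (polyGen_rel N)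

theorem polyHom_oMul (N : ℕ) : (polyHom K ι N).map (oMul K) = polyMul K ι :=
  presentedLift_gen (polyOperad K ι) (polyGen K ι N) (polyGen_rel N) .mul

theorem polyHom_oD (N n : ℕ) :
    (polyHom K ι N).map (oD K n) = polyD K ι N n ((n + 1 : ℕ) : ℤ) :=
  presentedLift_gen (polyOperad K ι) (polyGen K ι N) (polyGen_rel N) (.d (n + 1) (Nat.le_add_left 1 n))

/-- The value of a linear functional at the value of an operation on polynomials. -/
def pairing (c : Poly K ι →ₗ[K] K) {n : ℕ} {g : ℤ × ℤ} (v : Fin n → Poly K ι) :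
    (polyOperad K ι).obj n g →ₗ[K] Ext K :=
  TensorProduct.lift (LinearMap.mk₂ K (fun (f : (endOperad K (Poly K ι)).obj n ())
      (t : (extOperad K).obj n g) => c (evalAt f v) • (t.1 : Ext K))
    (fun f f' t => by rw [evalAt_add, map_add, add_smul])
    (fun r f t => by
      rw [show evalAt (r • f) v = r • evalAt f v from rfl, map_smul, smul_assoc])
    (fun f t t' => smul_add _ _ _)
    (fun r f t => smul_comm _ _ _))

theorem pairing_pt (c : Poly K ι →ₗ[K] K) {n : ℕ} {g : ℤ × ℤ} (v : Fin n → Poly K ι)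
    (f : (endOperad K (Poly K ι)).obj n ()) (t : (extOperad K).obj n g) :
    pairing c v (pt f t) = c (evalAt f v) • (t.1 : Ext K) := rfl

/-- The insertion of an operator at an input acts on the argument at this input. -/
theorem pairing_comp_polyD (c : Poly K ι →ₗ[K] K) (N j : ℕ) {n : ℕ} {a b : ℤ × ℤ} {w : ℤ}
    (h : n + 1 = n + 1) (e : a + (1, w) = b) (i : Fin n) (v : Fin n → Poly K ι)
    (x : (polyOperad K ι).obj n a) :
    pairing c v ((polyOperad K ι).comp h e i x (polyD K ι N j w)) =
      ∑ k ∈ Finset.range N,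
        pairing c (Function.update v i (polyDer K (j, k) (v i))) x * theta K k := by
  induction x using poly_induction with
  | zero => simp only [map_zero, LinearMap.zero_apply, zero_mul, Finset.sum_const_zero]
  | add x y hx hy =>
    rw [map_add, LinearMap.add_apply, map_add, hx, hy, ← Finset.sum_add_distrib]
    refine Finset.sum_congr rfl fun k _ => ?_
    rw [map_add, add_mul]
  | pt f t =>
    rw [polyD, map_sum, map_sum]
    refine Finset.sum_congr rfl fun k _ => ?_
    rw [pt_comp, pairing_pt, pairing_pt, evalAt_comp, evalAt_unaryMap, smul_mul_assoc]
    have hv : plug h i ((polyDer K (j, k)).toLinearMap (v (innerPos h i 0))) v =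
        Function.update v i (polyDer K (j, k) (v i)) := by
      funext l
      have hi : innerPos h i 0 = i := Fin.ext (by simp [innerPos])
      by_cases hl : l = i
      · subst hl
        rw [plug_self, Function.update_self, hi]
        rfl
      · rw [plug_of_ne _ _ _ _ hl, Function.update_of_ne hl]
        refine congrArg v (Fin.ext ?_)
        simp only [outerPos]
        split_ifs <;> omega
    rw [hv]
    rfl

/-- The iterated product acts by the product of polynomials. -/
theorem polyHom_iteratedMul (N m : ℕ) : ∃ (f : (endOperad K (Poly K ι)).obj (m + 1) ())
    (t : (extOperad K).obj (m + 1) (0, -(m : ℤ))), (polyHom K ι N).map (iteratedMul K m) = pt f t ∧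
      (∀ v, evalAt f v = ∏ i, v i) ∧ (t.1 : Ext K) = 1 := by
  induction m with
  | zero =>
    refine ⟨(endOperad K (Poly K ι)).one, (extOperad K).one, (polyHom K ι N).map_one, fun v => ?_,
      rfl⟩
    rw [Fin.prod_univ_one]
    rfl
  | succ m ih =>
    obtain ⟨f, t, hf, hv, ht⟩ := ih
    have h3 : (polyHom K ι N).map (iteratedMul K (m + 1)) =
        (polyOperad K ι).comp (m := 2) (n := m + 1) (k := m + 2) (by omega) (by ext <;> simp) 0
          ((polyHom K ι N).map (oMul K)) ((polyHom K ι N).map (iteratedMul K m)) :=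
      (polyHom K ι N).map_comp (m := 2) (n := m + 1) (k := m + 2) (by omega)
        (by ext <;> simp) 0 (oMul K) (iteratedMul K m)
    rw [hf, polyHom_oMul, polyMul, pt_comp] at h3
    refine ⟨_, _, h3, fun v => ?_, ?_⟩
    · rw [evalAt_comp, evalAt_polyProd, plug_self, plug_of_ne _ _ _ _ (by decide), hv]
      refine Eq.trans ?_ (Fin.prod_univ_castSucc v).symm
      refine congrArg₂ _ (Finset.prod_congr rfl fun i _ => congrArg v (Fin.ext ?_))
        (congrArg v (Fin.ext ?_))
      · simp [innerPos]
      · simp [outerPos]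
    · exact (one_mul _).trans ht

end Polynomial

/-! ### A lower bound for the dimension of the deformation operad -/

section Words

variable {m : ℕ}

/-- Insert `p.2`, paired with the label `j`, in front of the list at the position `p.1`. -/
def push (L : Fin (m + 1) → List (ℕ × ℕ)) (p : Fin (m + 1) × ℕ) (j : ℕ) :
    Fin (m + 1) → List (ℕ × ℕ) := Function.update L p.1 ((p.2, j) :: L p.1)

/-- Insert the elements of `s` one after another, where the labels count down to `0`. -/
def labelled : List (Fin (m + 1) × ℕ) → (Fin (m + 1) → List (ℕ × ℕ)) → Fin (m + 1) → List (ℕ × ℕ)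
  | [], L => L
  | p :: s, L => labelled s (push L p s.length)

/-- Insert the elements of `s` one after another, without labels. -/
def unlabelled : List (Fin (m + 1) × ℕ) → (Fin (m + 1) → List ℕ) → Fin (m + 1) → List ℕ
  | [], L => L
  | p :: s, L => unlabelled s (Function.update L p.1 (p.2 :: L p.1))

/-- Remove the labels. -/
def forgetLabels (L : Fin (m + 1) → List (ℕ × ℕ)) (i : Fin (m + 1)) : List ℕ := (L i).map Prod.fst

theorem forgetLabels_push (L : Fin (m + 1) → List (ℕ × ℕ)) (p : Fin (m + 1) × ℕ) (j : ℕ) :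
    forgetLabels (push L p j) =
      Function.update (forgetLabels L) p.1 (p.2 :: forgetLabels L p.1) := by
  funext i
  by_cases hi : i = p.1
  · subst hi
    simp [forgetLabels, push]
  · simp [forgetLabels, push, Function.update_of_ne hi]

theorem forgetLabels_labelled (s : List (Fin (m + 1) × ℕ)) (L : Fin (m + 1) → List (ℕ × ℕ)) :
    forgetLabels (labelled s L) = unlabelled s (forgetLabels L) := by
  induction s generalizing L with
  | nil => rfl
  | cons p s ih => rw [labelled, ih, forgetLabels_push, unlabelled]

theorem push_eq_push {L L' : Fin (m + 1) → List (ℕ × ℕ)} {p : Fin (m + 1) × ℕ} {j j' : ℕ} :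
    push L p j = push L' p j' ↔ L = L' ∧ j = j' := by
  refine ⟨fun h => ?_, by rintro ⟨rfl, rfl⟩; rfl⟩
  have h1 := congrFun h p.1
  rw [push, push, Function.update_self, Function.update_self, List.cons.injEq,
    Prod.mk.injEq] at h1
  refine ⟨funext fun i => ?_, h1.1.2⟩
  by_cases hi : i = p.1
  · rw [hi, h1.2]
  · have h2 := congrFun h i
    rwa [push, push, Function.update_of_ne hi, Function.update_of_ne hi] at h2

theorem unlabelled_append (s : List (Fin (m + 1) × ℕ)) (p : Fin (m + 1) × ℕ)
    (L : Fin (m + 1) → List ℕ) : unlabelled (s ++ [p]) L =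
      Function.update (unlabelled s L) p.1 (p.2 :: unlabelled s L p.1) := by
  induction s generalizing L with
  | nil => rfl
  | cons q s ih => rw [List.cons_append, unlabelled, ih, unlabelled]

theorem sum_update (f : List ℕ → ℕ) (w : Fin (m + 1) → List ℕ) (i : Fin (m + 1)) (l : List ℕ) :
    ∑ j, f (Function.update w i l j) + f (w i) = ∑ j, f (w j) + f l := by
  rw [← Finset.add_sum_erase _ _ (Finset.mem_univ i),
    ← Finset.add_sum_erase (a := i) _ (fun j => f (w j)) (Finset.mem_univ i),
    Function.update_self, Finset.sum_congr rfl fun j hj => by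
      rw [Function.update_of_ne (Finset.ne_of_mem_erase hj)]]
  omega

theorem exists_unlabelled (g : ℕ) (w : Fin (m + 1) → List ℕ) (hg : ∑ i, (w i).length = g) :
    ∃ s : List (Fin (m + 1) × ℕ), unlabelled s (fun _ => []) = w ∧ s.length = g ∧
      (s.map fun p => p.2 + 1).sum = ∑ i, Plan.wordWeight (w i) := by
  induction g generalizing w with
  | zero =>
    obtain rfl : w = fun _ => [] := funext fun i =>
      List.eq_nil_of_length_eq_zero ((Finset.sum_eq_zero_iff.1 hg) i (Finset.mem_univ i))
    exact ⟨[], rfl, rfl, by simp [Plan.wordWeight]⟩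
  | succ g ih =>
    obtain ⟨i, -, hi⟩ := Finset.exists_ne_zero_of_sum_ne_zero (hg.trans_ne (Nat.succ_ne_zero g))
    obtain ⟨k, l, hl⟩ := List.exists_cons_of_length_pos (Nat.pos_of_ne_zero hi)
    have h1 := sum_update List.length w i l
    have h2 := sum_update Plan.wordWeight w i l
    have h3 : Plan.wordWeight (k :: l) = k + 1 + Plan.wordWeight l := by simp [Plan.wordWeight]
    rw [hl, List.length_cons] at h1
    rw [hl, h3] at h2
    obtain ⟨s, hs, hs', hs''⟩ := ih (Function.update w i l) (by omega)
    refine ⟨s ++ [(i, k)], ?_, by simp [hs'], ?_⟩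
    · rw [unlabelled_append, hs, Function.update_self, Function.update_idem, ← hl,
        Function.update_eq_self]
    · rw [List.map_append, List.sum_append, hs'', List.map_singleton, List.sum_singleton]
      omega

end Words

section Independence

variable {K : Type u} [Field K] {m : ℕ}

variable (K) in
/-- The variables with the given lists. -/
def varsAt (L : Fin (m + 1) → List (ℕ × ℕ)) (i : Fin (m + 1)) : Poly K (Fin (m + 1)) :=
  MvPolynomial.X (i, L i)

variable (K) in
/-- The coefficient of the product of the variables with the given lists. -/
def coeffOf (L : Fin (m + 1) → List (ℕ × ℕ)) : Poly K (Fin (m + 1)) →ₗ[K] K :=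
  MvPolynomial.lcoeff K (∑ i, Finsupp.single (i, L i) 1)

theorem coeffOf_prod (L L' : Fin (m + 1) → List (ℕ × ℕ)) :
    coeffOf K L' (∏ i, varsAt K L i) = if L = L' then 1 else 0 := by
  classical
  have h : ∏ i, varsAt K L i = MvPolynomial.monomial (∑ i, Finsupp.single (i, L i) 1) 1 := by
    rw [MvPolynomial.monomial_sum_one]
    rfl
  rw [h]
  refine (MvPolynomial.coeff_monomial _ _ _).trans (if_congr ⟨fun h => ?_, fun h => by rw [h]⟩
    rfl rfl)
  funext i
  have h1 := DFunLike.congr_fun h (i, L i)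
  rw [Finsupp.finsetSum_apply, Finsupp.finsetSum_apply, Finset.sum_eq_single i,
    Finset.sum_eq_single i, Finsupp.single_eq_same, Finsupp.single_apply] at h1
  · split_ifs at h1 with h2
    exact (Prod.ext_iff.1 h2).2.symm
  · intro j _ hj
    exact Finsupp.single_eq_of_ne fun e => hj (Prod.ext_iff.1 e).1.symm
  · simp
  · intro j _ hj
    exact Finsupp.single_eq_of_ne fun e => hj (Prod.ext_iff.1 e).1.symm
  · simp

theorem update_varsAt (L : Fin (m + 1) → List (ℕ × ℕ)) (p : Fin (m + 1) × ℕ) (j : ℕ) :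
    Function.update (varsAt K L) p.1 (polyDer K (p.2, j) (varsAt K L p.1)) =
      varsAt K (push L p j) := by
  funext i
  by_cases hi : i = p.1
  · subst hi
    rw [Function.update_self, varsAt, varsAt, push, Function.update_self, polyDer,
      MvPolynomial.mkDerivation_X]
  · rw [Function.update_of_ne hi, varsAt, varsAt, push, Function.update_of_ne hi]

/-- An element of `O` that applies the operators in `s` to the factors of an iterated product,
tested against the coefficients of monomials. -/
theorem exists_pairing_eq (N : ℕ) (s : List (Fin (m + 1) × ℕ)) (hs : s.length ≤ N) {d : ℤ × ℤ}
    (hd : d = ((s.length : ℤ), (((s.map fun p => p.2 + 1).sum : ℕ) : ℤ) - m)) :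
    ∃ y : (OOperad K).obj (m + 1) d, ∀ L : Fin (m + 1) → List (ℕ × ℕ),
      (∀ L', pairing (coeffOf K (labelled s L')) (varsAt K L)
        ((polyHom K (Fin (m + 1)) N).map y) = if L = L' then thetaProd K s.length else 0) ∧
      ∀ L', forgetLabels L' ≠ unlabelled s (forgetLabels L) →
        pairing (coeffOf K L') (varsAt K L) ((polyHom K (Fin (m + 1)) N).map y) = 0 := by
  induction s generalizing d with
  | nil =>
    obtain rfl : d = (0, -(m : ℤ)) := by rw [hd]; simp
    obtain ⟨f, t, hf, hv, ht⟩ := polyHom_iteratedMul (K := K) (ι := Fin (m + 1)) N m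
    have key : ∀ L L' : Fin (m + 1) → List (ℕ × ℕ), pairing (coeffOf K L') (varsAt K L)
        ((polyHom K (Fin (m + 1)) N).map (iteratedMul K m)) = if L = L' then 1 else 0 :=
      fun L L' => by
        rw [hf, pairing_pt, hv, ht, coeffOf_prod, ite_smul, one_smul, zero_smul]
    refine ⟨iteratedMul K m, fun L => ⟨fun L' => key L L', fun L' h => ?_⟩⟩
    rw [key, if_neg]
    rintro rfl
    exact h rfl
  | cons p s ih =>
    rw [List.length_cons] at hs
    obtain ⟨y, hy⟩ := ih (by omega) rfl
    have e : ((s.length : ℤ), (((s.map fun p => p.2 + 1).sum : ℕ) : ℤ) - m) +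
        (1, ((p.2 + 1 : ℕ) : ℤ)) = d := by
      rw [hd]
      ext <;> simp
      omega
    refine ⟨(OOperad K).comp (n := 1) rfl e p.1 y (oD K p.2), fun L => ?_⟩
    have key : ∀ c : Poly K (Fin (m + 1)) →ₗ[K] K, pairing c (varsAt K L)
        ((polyHom K (Fin (m + 1)) N).map ((OOperad K).comp (n := 1) rfl e p.1 y (oD K p.2))) =
        ∑ j ∈ Finset.range N, pairing c (varsAt K (push L p j))
          ((polyHom K (Fin (m + 1)) N).map y) * theta K j := fun c => by
      rw [(polyHom K (Fin (m + 1)) N).map_comp, polyHom_oD, pairing_comp_polyD]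
      simp only [update_varsAt]
    refine ⟨fun L' => ?_, fun L' h => ?_⟩
    -- The outermost label of `labelled` is `s.length`, so only this summand contributes.
    · rw [key, labelled, Finset.sum_eq_single s.length]
      · rw [(hy _).1]
        simp only [push_eq_push, and_true, ite_mul, zero_mul]
        rfl
      · intro j _ hj
        rw [(hy _).1, if_neg fun h => hj (push_eq_push.1 h).2, zero_mul]
      · intro h
        exact absurd (Finset.mem_range.2 (by omega)) h
    · rw [key]
      refine Finset.sum_eq_zero fun j _ => ?_
      rw [(hy _).2 L', zero_mul]
      rw [forgetLabels_push]
      exact h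

variable (K) in
/-- The dimension of `O` in arity `m + 1`, degree `g` and weight `0` is at least the number of
families of `m + 1` words with `g` letters and weight `m` in total. -/
theorem exists_linearIndependent_of_words (m g : ℕ) {α : Type*} (w : α → Fin (m + 1) → List ℕ)
    (hw : Function.Injective w) (hg : ∀ a, ∑ i, (w a i).length = g)
    (hm : ∀ a, ∑ i, Plan.wordWeight (w a i) = m) :
    ∃ x : α → (OOperad K).obj (m + 1) ((g : ℤ), (0 : ℤ)), LinearIndependent K x := by
  classical
  choose s hs hs' hs'' using fun a => exists_unlabelled g (w a) (hg a)
  choose y hy using fun a => exists_pairing_eq (K := K) (d := ((g : ℤ), (0 : ℤ))) g (s a)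
    (hs' a).le (by rw [hs', hs'', hm]; simp)
  let f : α → (OOperad K).obj (m + 1) ((g : ℤ), (0 : ℤ)) →ₗ[K] Ext K := fun a =>
    pairing (coeffOf K (labelled (s a) fun _ => [])) (varsAt K fun _ => []) ∘ₗ
      (polyHom K (Fin (m + 1)) g).map
  refine ⟨y, linearIndependent_of_diagonal (thetaProd_ne_zero (K := K) g) f fun a b => ?_⟩
  split_ifs with h
  · subst h
    refine ((hy b _).1 _).trans ?_
    rw [if_pos rfl, hs']
  · refine (hy b _).2 _ ?_
    rw [forgetLabels_labelled]
    change unlabelled _ (fun _ => []) ≠ unlabelled _ (fun _ => [])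
    rw [hs, hs]
    exact fun e => h (hw e.symm)

end Independence

/-! ### Counting -/

/-- The trees with `n` leaves and degree `g`, that is, with `g` generators at their vertices. -/
abbrev Trees (n : ℕ) (g : ℤ) : Type := {T : Plan.WithLeaves false n // (T.1.deg : ℤ) = g}

theorem finrank_directSum {K : Type*} [Field K] {M : ℤ → Type*} [∀ g, AddCommGroup (M g)]
    [∀ g, Module K (M g)] [∀ g, Module.Finite K (M g)] {n N : ℕ}
    (h : ∀ g, Module.finrank K (M g) = N * Nat.card (Trees n g)) :
    Module.finrank K (DirectSum ℤ M) = N * Nat.card (Plan.WithLeaves false n) := by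
  classical
  have e : ∀ g, Nonempty (Fin (Module.finrank K (M g)) ≃ Fin N × Trees n g) := fun g =>
    Finite.card_eq.1 (by rw [Nat.card_prod, Nat.card_fin, Nat.card_fin, h])
  refine (Module.finrank_eq_nat_card_basis
    (DFinsupp.basis fun g => Module.finBasis K (M g))).trans ?_
  refine Eq.trans (Nat.card_congr ?_)
    ((Nat.card_prod (Fin N) (Plan.WithLeaves false n)).trans (by rw [Nat.card_fin]))
  refine (Equiv.sigmaCongrRight fun g => (e g).some.trans (Equiv.prodComm _ _)).trans ?_
  refine (Equiv.sigmaProdDistrib _ _).symm.trans ?_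
  exact ((Equiv.sigmaFiberEquiv _).prodCongr (Equiv.refl _)).trans (Equiv.prodComm _ _)

/-- A tensor factor of a finite-dimensional space is finite-dimensional if the other factor is not
zero. -/
theorem finite_of_finite_tensorProduct {K A B : Type*} [Field K] [AddCommGroup A] [Module K A]
    [AddCommGroup B] [Module K B] (hA : 0 < Module.finrank K A) (h : Module.Finite K (A ⊗[K] B)) :
    Module.Finite K B := by
  have := Module.finite_of_finrank_pos hA
  obtain ⟨x, hx⟩ := Module.finrank_pos_iff_exists_ne_zero.1 hA
  obtain ⟨φ, hφ⟩ : ∃ φ : Module.Dual K A, φ x ≠ 0 := by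
    by_contra! h'
    exact hx ((Module.forall_dual_apply_eq_zero_iff K x).1 h')
  refine Module.Finite.of_surjective ((TensorProduct.lid K B).toLinearMap ∘ₗ φ.rTensor B)
    fun y => ⟨(φ x)⁻¹ • (x ⊗ₜ y), ?_⟩
  simp [smul_smul, hφ]

theorem finrank_tensor_eq {K A B : Type*} [Field K] [AddCommGroup A] [Module K A]
    [AddCommGroup B] [Module K B] :
    Module.finrank K (A ⊗[K] B) = Module.finrank K A * Module.finrank K B :=
  Module.finrank_tensorProduct

section Squeeze

variable (K : Type u) [Field K]

/-- The tuples of words given by the rotations of the codes of trees are different, and have the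
length and weight that belong to the degree `g` and the weight `0`. -/
theorem mul_card_trees_le_finrank (m : ℕ) (g : ℤ)
    [Module.Finite K ((OOperad K).obj (m + 1) (g, 0))] :
    (m + 1) * Nat.card (Trees (m + 1) g) ≤ Module.finrank K ((OOperad K).obj (m + 1) (g, 0)) := by
  rcases lt_or_ge g 0 with hg | hg
  · have : IsEmpty (Trees (m + 1) g) := ⟨fun T => by have := T.2; omega⟩
    rw [Nat.card_of_isEmpty, mul_zero]
    exact Nat.zero_le _
  obtain ⟨g, rfl⟩ := Int.eq_ofNat_of_zero_le hg
  have hl : ∀ a : Trees (m + 1) g × Fin (m + 1), (a.1.1.1.enc.rotate a.2).length = m + 1 :=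
    fun a => by rw [List.length_rotate, Plan.length_enc, a.1.1.2]
  let w : Trees (m + 1) g × Fin (m + 1) → Fin (m + 1) → List ℕ := fun a i =>
    (a.1.1.1.enc.rotate a.2)[i.val]'(by rw [hl]; exact i.isLt)
  have hw : ∀ a, List.ofFn (w a) = a.1.1.1.enc.rotate a.2 := fun a =>
    List.ext_getElem (by rw [List.length_ofFn, hl]) fun i h1 h2 => by
      rw [List.getElem_ofFn]
  have hsum : ∀ (f : List ℕ → ℕ) a, ∑ i, f (w a i) = (a.1.1.1.enc.map f).sum := fun f a => by
    rw [← List.sum_ofFn, ← ((List.rotate_perm a.1.1.1.enc a.2).map f).sum_eq, ← hw, List.map_ofFn]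
    rfl
  obtain ⟨x, hx⟩ := exists_linearIndependent_of_words K m g w
    (fun a b hab => by
      have h1 := hw a
      rw [hab, hw b] at h1
      obtain ⟨h2, h3⟩ := Plan.enc_rotate_rotate_inj b.1.1.2 a.1.1.2 b.2.isLt a.2.isLt h1
      exact Prod.ext (Subtype.ext (Subtype.ext h2.symm)) (Fin.ext h3.symm))
    (fun a => by
      have h1 := Plan.length_flatten_enc a.1.1.1
      have h2 := a.1.2
      rw [hsum, ← List.length_flatten]
      simp only [Bool.false_eq_true, if_false] at h1
      omega)
    (fun a => by
      have h1 := Plan.height_enc a.1.1.1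
      have h2 : ∀ l : List (List ℕ),
          Plan.height l = (((l.map Plan.wordWeight).sum : ℕ) : ℤ) - l.length := fun l => by
        induction l with
        | nil => rfl
        | cons a l ih =>
          simp only [Plan.height, List.map_cons, List.sum_cons, List.length_cons] at ih ⊢
          rw [ih]
          push_cast
          ring
      rw [h2, Plan.length_enc, a.1.1.2] at h1
      rw [hsum]
      simp only [Plan.drop] at h1
      omega)
  cases nonempty_fintype (Trees (m + 1) g)
  have h := hx.fintype_card_le_finrank
  rw [Fintype.card_prod, Fintype.card_fin] at h
  rwa [Nat.card_eq_fintype_card, mul_comm]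

/-- The upper bound for the dimension of the free operad. -/
theorem finrank_freeOp_le (n : ℕ) (g : ℤ) : Module.Finite K ((FreeOp K).obj n (g, 0)) ∧
    Module.finrank K ((FreeOp K).obj n (g, 0)) ≤ n.factorial * Nat.card (Trees n g) := by
  classical
  cases nonempty_fintype (Trees n g)
  let F : Equiv.Perm (Fin n) × Trees n g → (FreeOp K).obj n (g, 0) := fun a =>
    if h : ∃ z : (FreeOp K).obj n (g, 0), IsEv a.2.1.1 0 z then (FreeOp K).act a.1 h.choose else 0
  have hF : Submodule.span K (Set.range F) = ⊤ := by
    rw [← treeSpan_eq_top K n (g, 0)]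
    refine le_antisymm ?_ (Submodule.span_mono ?_)
    · rw [treeSpan_eq_top]
      exact le_top
    · rintro x ⟨σ, T, z, hz, rfl⟩
      have h : ∃ z : (FreeOp K).obj n (g, 0), IsEv T 0 z := ⟨z, hz⟩
      refine ⟨(σ, ⟨⟨T, hz.arity⟩, (Prod.ext_iff.1 hz.degree).1⟩), ?_⟩
      change dite _ _ _ = _
      rw [dif_pos h, h.choose_spec.unique hz]
  refine ⟨Module.finite_def.2 (hF ▸ Submodule.fg_span (Set.finite_range F)), ?_⟩
  have h := finrank_range_le_card (R := K) F
  rw [Set.finrank, hF, finrank_top, Fintype.card_prod, Fintype.card_perm, Fintype.card_fin] at h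
  rwa [Nat.card_eq_fintype_card]

/-- The values of the generators of the free operad. -/
def freeGen : ∀ {n : ℕ} {g : ℤ × ℤ}, FGen n g → (LieO K).obj n g
  | _, _, .l n => derivedBracket K n

/-- The morphism from the free operad to `Lie ⊗ O` that maps the generators to the higher derived
brackets. -/
def freeHom : OperadHom (FreeOp K) (LieO K) :=
  presentedLift (LieO K) (freeGen K) fun _ h => h.elim

theorem freeHom_fL (n : ℕ) : (freeHom K).map (fL K n) = derivedBracket K n :=
  presentedLift_gen (LieO K) (freeGen K) (fun _ h => h.elim) (.l n)

/-- The range of `freeHom` is a suboperad that contains the higher derived brackets. -/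
theorem freeHom_surjective (n : ℕ) (g : ℤ) :
    Function.Surjective ((freeHom K).map : (FreeOp K).obj n (g, 0) →ₗ[K] _) := by
  have hM : ContainsDerived (K := K) fun n g =>
      LinearMap.range ((freeHom K).map : (FreeOp K).obj n g →ₗ[K] _) :=
    { one := ⟨_, (freeHom K).map_one⟩
      act := by
        rintro n g σ _ ⟨x, rfl⟩
        exact ⟨_, (freeHom K).map_act σ x⟩
      comp := by
        rintro m n k a b c h e i _ _ ⟨x, rfl⟩ ⟨y, rfl⟩
        exact ⟨_, (freeHom K).map_comp h e i x y⟩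
      derived := fun n => ⟨_, freeHom_fL K n⟩ }
  exact fun x => mem_of_containsDerived hM x

theorem finite_oOperad (m : ℕ) (g : ℤ) : Module.Finite K ((OOperad K).obj (m + 1) (g, 0)) := by
  have h1 := (finrank_freeOp_le K (m + 1) g).1
  have h2 : Module.Finite K ((LieO K).obj (m + 1) (g, 0)) :=
    Module.Finite.of_surjective _ (freeHom_surjective K (m + 1) g)
  have h3 := factorial_le_finrank_lie (K := K) m
  exact finite_of_finite_tensorProduct (A := (Lie K).obj (m + 1) ()) (m.factorial_pos.trans_le h3) h2

/-- Both the dimension of the free operad and that of `Lie ⊗ D_∞` are given by the number of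
trees, since the number of trees bounds the first from above, and the second from below. -/
theorem finrank_eq (m : ℕ) (g : ℤ) :
    Module.finrank K ((LieO K).obj (m + 1) (g, 0)) =
      (m + 1).factorial * Nat.card (Trees (m + 1) g) ∧
    Module.finrank K ((OOperad K).obj (m + 1) (g, 0)) = (m + 1) * Nat.card (Trees (m + 1) g) := by
  have := finite_lie (K := K) (m + 1)
  have := finite_oOperad K m g
  obtain ⟨h1, h2⟩ := finrank_freeOp_le K (m + 1) g
  have h3 := LinearMap.finrank_le_finrank_of_surjective (freeHom_surjective K (m + 1) g)
  have h4 : Module.finrank K ((LieO K).obj (m + 1) (g, 0)) =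
      Module.finrank K ((Lie K).obj (m + 1) ()) *
        Module.finrank K ((OOperad K).obj (m + 1) (g, 0)) := finrank_tensor_eq
  have h5 := factorial_le_finrank_lie (K := K) m
  have h6 := mul_card_trees_le_finrank K m g
  have h7 := m.factorial_pos
  rw [h4] at h3 ⊢
  rw [Nat.factorial_succ] at h2 ⊢
  generalize Module.finrank K ((Lie K).obj (m + 1) ()) = a at *
  generalize Module.finrank K ((OOperad K).obj (m + 1) (g, 0)) = b at *
  generalize Nat.card (Trees (m + 1) g) = t at *
  -- From `a * b ≤ (m + 1)! * t`, `m! ≤ a` and `(m + 1) * t ≤ b`, equality holds everywhere.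
  have h8 := Nat.mul_le_mul_right b h5
  have h9 := Nat.mul_le_mul_left m.factorial h6
  have h10 : (m + 1) * m.factorial * t = m.factorial * ((m + 1) * t) := by ring
  refine ⟨by omega, le_antisymm (Nat.le_of_mul_le_mul_left (by omega) h7) h6⟩

theorem freeHom_bijective (n : ℕ) (g : ℤ) :
    Function.Bijective ((freeHom K).map : (FreeOp K).obj n (g, 0) →ₗ[K] _) := by
  have hs := freeHom_surjective K n g
  obtain ⟨h1, h2⟩ := finrank_freeOp_le K n g
  have h3 : Module.Finite K ((LieO K).obj n (g, 0)) := Module.Finite.of_surjective _ hs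
  refine ⟨(LinearMap.injective_iff_surjective_of_finrank_eq_finrank ?_).2 hs, hs⟩
  refine le_antisymm ?_ (LinearMap.finrank_le_finrank_of_surjective hs)
  cases n with
  | zero =>
    have : IsEmpty (Trees 0 g) := ⟨fun T => by
      have := T.1.1.leaves_pos
      have := T.1.2
      omega⟩
    rw [Nat.card_of_isEmpty, mul_zero] at h2
    omega
  | succ m => rwa [(finrank_eq K m g).1]

end Squeeze

/-! ### The part of degree one -/

section DegreeOne

theorem isEmpty_trees_one {n : ℕ} (hn : n < 2) : IsEmpty (Trees n 1) := ⟨fun T => by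
  obtain ⟨k, hk⟩ := Plan.eq_corolla (T := T.1.1) (by exact_mod_cast T.2)
  have h := T.1.2
  rw [hk, Plan.leaves_corolla] at h
  omega⟩

theorem card_trees_one (n : ℕ) : Nat.card (Trees (n + 2) 1) = 1 := by
  have key : ∀ T : Trees (n + 2) 1, T.1.1 = Plan.corolla n := fun T => by
    obtain ⟨k, hk⟩ := Plan.eq_corolla (T := T.1.1) (by exact_mod_cast T.2)
    have h := T.1.2
    rw [hk, Plan.leaves_corolla] at h
    rw [hk, Nat.add_right_cancel h]
  refine Nat.card_eq_one_iff_unique.2 ⟨⟨fun T T' => Subtype.ext (Subtype.ext ?_)⟩,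
    ⟨⟨⟨.corolla n, Plan.leaves_corolla n⟩, ?_⟩⟩⟩
  · rw [key, key]
  · exact congrArg Prod.fst (isEv_corolla (K := ℚ) n).degree

variable (K : Type u) [Field K]

theorem subsingleton_degree_one {n : ℕ} (hn : n < 2) :
    Subsingleton ((LieO K).obj n (1, 0)) := by
  have h := isEmpty_trees_one hn
  obtain ⟨h1, h2⟩ := finrank_freeOp_le K n 1
  rw [Nat.card_of_isEmpty, mul_zero, Nat.le_zero, Module.finrank_zero_iff] at h2
  exact (freeHom_surjective K n 1).subsingleton

theorem span_derivedBracket (n : ℕ) : Submodule.span K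
    (Set.range fun σ : Equiv.Perm (Fin (n + 2)) => (LieO K).act σ (derivedBracket K n)) = ⊤ := by
  refine eq_top_iff.2 fun x _ => ?_
  obtain ⟨z, rfl⟩ := freeHom_surjective K (n + 2) 1 x
  suffices treeSpan K (n + 2) (1, 0) ≤ (Submodule.span K (Set.range fun
      σ : Equiv.Perm (Fin (n + 2)) => (LieO K).act σ (derivedBracket K n))).comap
        (freeHom K).map from
    this (treeSpan_eq_top K (n + 2) (1, 0) ▸ Submodule.mem_top)
  refine Submodule.span_le.2 ?_
  rintro _ ⟨σ, T, z, hz, rfl⟩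
  obtain ⟨k, rfl⟩ := Plan.eq_corolla (T := T)
    (Nat.cast_eq_one.1 (Prod.ext_iff.1 hz.degree).1)
  have hk := hz.arity
  rw [Plan.leaves_corolla] at hk
  obtain rfl : k = n := by omega
  have h1 : (freeHom K).map ((FreeOp K).act σ z) = (LieO K).act σ (derivedBracket K k) := by
    rw [(freeHom K).map_act, hz.unique (isEv_corolla k), freeHom_fL]
  exact (congrArg (· ∈ Submodule.span K (Set.range fun
      σ : Equiv.Perm (Fin (k + 2)) => (LieO K).act σ (derivedBracket K k))) h1).mpr
    (Submodule.subset_span ⟨σ, rfl⟩)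

theorem linearIndependent_derivedBracket (n : ℕ) : LinearIndependent K
    fun σ : Equiv.Perm (Fin (n + 2)) => (LieO K).act σ (derivedBracket K n) := by
  refine linearIndependent_of_top_le_span_of_card_eq_finrank (span_derivedBracket K n).ge ?_
  rw [(finrank_eq K (n + 1) 1).1, card_trees_one, mul_one, Fintype.card_perm, Fintype.card_fin]

end DegreeOne

/-! ### Freeness -/

section Freeness

variable {K : Type u} [Field K]

/-- An operad that is graded by degree, with an additional weight on which nothing depends. -/
def forgetWeight (Q : GradedOperad.{u, v, 0} K ℤ (AddMonoidHom.id ℤ)) :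
    GradedOperad.{u, v, 0} K (ℤ × ℤ) degreeHom where
  obj n g := Q.obj n g.1
  act := Q.act
  one := Q.one
  comp h e := Q.comp h (congrArg Prod.fst e)
  one_comp h e := Q.one_comp h (congrArg Prod.fst e)
  comp_one h e := Q.comp_one h (congrArg Prod.fst e)
  act_comp h e := Q.act_comp h (congrArg Prod.fst e)
  assoc h₁ h₂ h₃ h₄ e₁ e₂ e₃ e₄ := Q.assoc h₁ h₂ h₃ h₄ (congrArg Prod.fst e₁)
    (congrArg Prod.fst e₂) (congrArg Prod.fst e₃) (congrArg Prod.fst e₄)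
  parallel h₁ h₂ h₃ h₄ e₁ e₂ e₃ e₄ := Q.parallel h₁ h₂ h₃ h₄ (congrArg Prod.fst e₁)
    (congrArg Prod.fst e₂) (congrArg Prod.fst e₃) (congrArg Prod.fst e₄)

variable (K) in
/-- The isomorphism of the free operad, in weight `0`, with `Lie ⊗ D_∞`. -/
def freeEquiv (n : ℕ) (g : ℤ) : (FreeOp K).obj n (g, 0) ≃ₗ[K] (LieD K).obj n g :=
  LinearEquiv.ofBijective (M₂ := (LieO K).obj n (g, 0)) (freeHom K).map (freeHom_bijective K n g)

theorem freeEquiv_act {n : ℕ} {g : ℤ} (σ : Equiv.Perm (Fin n)) (z : (FreeOp K).obj n (g, 0)) :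
    freeEquiv K n g ((FreeOp K).act σ z) = (LieD K).act σ (freeEquiv K n g z) :=
  (freeHom K).map_act σ z

theorem freeEquiv_comp {m n k : ℕ} {a b c : ℤ} (h : m + n = k + 1) (e : a + b = c)
    (e' : ((a, 0) : ℤ × ℤ) + (b, 0) = (c, 0)) (i : Fin m) (x : (FreeOp K).obj m (a, 0))
    (y : (FreeOp K).obj n (b, 0)) : freeEquiv K k c ((FreeOp K).comp h e' i x y) =
      (LieD K).comp h e i (freeEquiv K m a x) (freeEquiv K n b y) :=
  (freeHom K).map_comp h e' i x y

theorem normalBracket_one (n : ℕ) : normalBracket K n 1 = derivedBracket K n := by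
  rw [normalBracket, map_one]
  rfl

theorem act_normalBracket_one (n : ℕ) (σ : Equiv.Perm (Fin (n + 2))) :
    (LieD K).act σ (normalBracket K n 1) = normalBracket K n σ :=
  congrArg ((LieD K).act σ) (normalBracket_one n)

theorem freeEquiv_fL (n : ℕ) : freeEquiv K (n + 2) 1 (fL K n) = normalBracket K n 1 :=
  (freeHom_fL K n).trans (normalBracket_one n).symm

section Descend

variable {Q : GradedOperad.{u, v, 0} K ℤ (AddMonoidHom.id ℤ)}
  (F : OperadHom (FreeOp K) (forgetWeight Q))

/-- The linear map on `Lie ⊗ D_∞` that corresponds to a morphism from the free operad. -/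
def descendMap (n : ℕ) (g : ℤ) : (LieD K).obj n g →ₗ[K] Q.obj n g :=
  LinearMap.comp (M₂ := (FreeOp K).obj n (g, 0)) F.map (freeEquiv K n g).symm.toLinearMap

theorem descendMap_apply {n : ℕ} {g : ℤ} (z : (FreeOp K).obj n (g, 0)) :
    descendMap F n g (freeEquiv K n g z) = F.map z :=
  congrArg F.map ((freeEquiv K n g).symm_apply_apply z)

/-- A morphism from the free operad to an operad with no weight gives a morphism from
`Lie ⊗ D_∞`. -/
def descend : OperadHom (LieD K) Q where
  map {n g} := descendMap F n g
  map_act {n g} σ x := by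
    obtain ⟨x, rfl⟩ := (freeEquiv K n g).surjective x
    rw [← freeEquiv_act]
    exact (descendMap_apply F _).trans ((F.map_act σ x).trans
      (congrArg (Q.act σ) (descendMap_apply F x).symm))
  map_one := by
    have h : freeEquiv K 1 0 (FreeOp K).one = (LieD K).one := (freeHom K).map_one
    rw [← h]
    exact (descendMap_apply F _).trans F.map_one
  map_comp {m n k a b c} h e i x y := by
    obtain ⟨x, rfl⟩ := (freeEquiv K m a).surjective x
    obtain ⟨y, rfl⟩ := (freeEquiv K n b).surjective y
    have e' : ((a, 0) : ℤ × ℤ) + (b, 0) = (c, 0) := by rw [← e]; rfl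
    rw [← freeEquiv_comp h e e']
    exact (descendMap_apply F _).trans ((F.map_comp h e' i x y).trans
      (congrArg₂ (fun u v => Q.comp h e i u v) (descendMap_apply F x).symm
        (descendMap_apply F y).symm))

end Descend

variable (K) in
/-- The higher derived bracket as an element of the part of degree one. -/
def firstBracket (n : ℕ) : (degreePart (LieD K).toGradedSModule 1).obj (n + 2) 1 :=
  ⟨normalBracket K n 1, fun h => absurd rfl h⟩

theorem span_normalBracket (n : ℕ) :
    Submodule.span K (Set.range (normalBracket K n)) = ⊤ := span_derivedBracket K n

/-- Morphisms of `𝕊`-modules from the part of degree one of `Lie ⊗ D_∞` are determined by the values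
of the higher derived brackets. -/
theorem degree_one_ext {Q : GradedOperad.{u, v, 0} K ℤ (AddMonoidHom.id ℤ)}
    (f f' : SHom (degreePart (LieD K).toGradedSModule 1) Q.toGradedSModule)
    (h : ∀ n, f.map (firstBracket K n) = f'.map (firstBracket K n)) {n : ℕ} {g : ℤ}
    (x : (degreePart (LieD K).toGradedSModule 1).obj n g) : f.map x = f'.map x := by
  by_cases hg : g = 1
  swap
  · obtain rfl : x = 0 := Subtype.ext (x.2 hg)
    rw [map_zero, map_zero]
  subst hg
  match n, x with
  | 0, x =>
    obtain rfl : x = 0 := Subtype.ext ((subsingleton_degree_one K (by omega)).elim _ _)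
    rw [map_zero, map_zero]
  | 1, x =>
    obtain rfl : x = 0 := Subtype.ext ((subsingleton_degree_one K (by omega)).elim _ _)
    rw [map_zero, map_zero]
  | n + 2, x =>
    have hx : x.1 ∈ Submodule.span K (Set.range (normalBracket K n)) :=
      (span_normalBracket (K := K) n).ge Submodule.mem_top
    obtain ⟨x, hx'⟩ := x
    change x ∈ _ at hx
    induction hx using Submodule.span_induction with
    | mem x hx =>
      obtain ⟨σ, rfl⟩ := hx
      have h1 : (⟨normalBracket K n σ, hx'⟩ :
          (degreePart (LieD K).toGradedSModule 1).obj (n + 2) 1) =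
          (degreePart (LieD K).toGradedSModule 1).act σ (firstBracket K n) :=
        Subtype.ext (act_normalBracket_one n σ).symm
      rw [h1, f.map_act, f'.map_act, h]
    | zero => exact (map_zero f.map).trans (map_zero f'.map).symm
    | add x y _ _ hx hy =>
      exact (map_add f.map ⟨x, fun h => absurd rfl h⟩ ⟨y, fun h => absurd rfl h⟩).trans
        ((congrArg₂ (· + ·) (hx _) (hy _)).trans
        (map_add f'.map ⟨x, fun h => absurd rfl h⟩ ⟨y, fun h => absurd rfl h⟩).symm)
    | smul r x _ hx =>
      exact (map_smul f.map r ⟨x, fun h => absurd rfl h⟩).trans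
        ((congrArg (r • ·) (hx _)).trans (map_smul f'.map r ⟨x, fun h => absurd rfl h⟩).symm)

/-- Morphisms from `Lie ⊗ D_∞` are determined by the values of the higher derived brackets. -/
theorem operadHom_ext {Q : GradedOperad.{u, v, 0} K ℤ (AddMonoidHom.id ℤ)}
    (F F' : OperadHom (LieD K) Q)
    (h : ∀ n, F.map (normalBracket K n 1) = F'.map (normalBracket K n 1)) : F = F' := by
  -- In each weight other than `0` the submodule on which the morphisms agree is taken to be zero.
  let M : ∀ n g, Submodule K ((LieO K).obj n g) := fun n g =>
    { carrier := {x | (g.2 ≠ 0 → x = 0) ∧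
        ∀ d (e : g = (d, 0)), F.map (g := d) (e ▸ x : (LieO K).obj n (d, 0)) =
          F'.map (g := d) (e ▸ x : (LieO K).obj n (d, 0))}
      zero_mem' := ⟨fun _ => rfl, by
        rintro d rfl
        exact (map_zero F.map).trans (map_zero F'.map).symm⟩
      add_mem' := by
        rintro x y ⟨hx, hx'⟩ ⟨hy, hy'⟩
        refine ⟨fun hg => by rw [hx hg, hy hg, add_zero], ?_⟩
        rintro d rfl
        exact (map_add F.map _ _).trans ((congrArg₂ (· + ·) (hx' d rfl) (hy' d rfl)).trans
          (map_add F'.map _ _).symm)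
      smul_mem' := by
        rintro r x ⟨hx, hx'⟩
        refine ⟨fun hg => by rw [hx hg, smul_zero], ?_⟩
        rintro d rfl
        exact (map_smul F.map r _).trans ((congrArg (r • ·) (hx' d rfl)).trans
          (map_smul F'.map r _).symm) }
  have hM : ContainsDerived M :=
    { one := ⟨fun h => absurd rfl h, by
        rintro d e
        obtain rfl : d = 0 := (congrArg Prod.fst e).symm
        exact F.map_one.trans F'.map_one.symm⟩
      act := by
        rintro n g σ x ⟨hx, hx'⟩
        refine ⟨fun hg => by rw [hx hg, map_zero], ?_⟩
        rintro d rfl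
        exact (F.map_act σ _).trans ((congrArg (Q.act σ) (hx' d rfl)).trans (F'.map_act σ _).symm)
      comp := by
        rintro m n k ⟨a, a'⟩ ⟨b, b'⟩ c h e i x y ⟨hx, hx'⟩ ⟨hy, hy'⟩
        by_cases ha : a' = 0
        swap
        · rw [hx ha, map_zero, LinearMap.zero_apply]
          exact zero_mem (M k c)
        by_cases hb : b' = 0
        swap
        · rw [hy hb, map_zero]
          exact zero_mem (M k c)
        subst ha hb e
        refine ⟨fun hc => absurd rfl hc, ?_⟩
        intro d e
        obtain rfl : d = a + b := (congrArg Prod.fst e).symm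
        exact (F.map_comp h rfl i x y).trans
          ((congrArg₂ (fun u v => Q.comp h rfl i u v) (hx' a rfl) (hy' b rfl)).trans
            (F'.map_comp h rfl i x y).symm)
      derived := fun n => ⟨fun h => absurd rfl h, by
        rintro d e
        obtain rfl : d = 1 := (congrArg Prod.fst e).symm
        have := h n
        rwa [normalBracket_one] at this⟩ }
  have key : ∀ {n : ℕ} {g : ℤ} (x : (LieD K).obj n g), F.map x = F'.map x := fun {n g} x =>
    (mem_of_containsDerived hM (g := g) x).2 g rfl
  rcases F with ⟨⟨F, hF⟩, hF1, hF2⟩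
  rcases F' with ⟨⟨F', hF'⟩, hF1', hF2'⟩
  obtain rfl : @F = @F' := funext fun n => funext fun g => LinearMap.ext key
  rfl

/-- An extension of `f` is obtained from the free operad. It agrees with `f` on the whole part of
degree one since that is spanned by the relabelled higher derived brackets. -/
theorem isFreeOperad_lieD (K : Type u) [Field K] : IsFreeOperad.{u, u, u, v, 0}
    (degreePart (LieD K).toGradedSModule 1) (LieD K)
    (degreeIncl (LieD K).toGradedSModule 1) := by
  intro Q f
  let φ : ∀ {n : ℕ} {g : ℤ × ℤ}, FGen n g → (forgetWeight Q).obj n g := fun {n g} x =>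
    match n, g, x with
    | _, _, .l n => f.map (firstBracket K n)
  let F := descend (Q := Q) (presentedLift (forgetWeight Q) φ fun _ h => h.elim)
  have hF : ∀ n, F.map (normalBracket K n 1) = f.map (firstBracket K n) := fun n => by
    rw [← freeEquiv_fL]
    exact (descendMap_apply _ _).trans
      (presentedLift_gen (forgetWeight Q) φ (fun _ h => h.elim) (.l n))
  let f' : SHom (degreePart (LieD K).toGradedSModule 1) Q.toGradedSModule :=
    { map := fun {n g} => F.map ∘ₗ (degreeIncl (LieD K).toGradedSModule 1).map
      map_act := fun σ x => F.map_act σ x.1 }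
  refine ⟨F, fun n g x => degree_one_ext f' f hF x, fun F' hF' => operadHom_ext _ _ fun n => ?_⟩
  rw [hF]
  exact hF' (n + 2) 1 (firstBracket K n)

end Freeness

/-! ### The total dimensions -/

section Dimension

variable (K : Type u) [Field K] (m : ℕ)

theorem finrank_directSum_lieD :
    Module.finrank K (DirectSum ℤ fun g => (LieD K).obj (m + 1) g) =
      (m + 1).factorial * Nat.card (Plan.WithLeaves false (m + 1)) := by
  have : ∀ g, Module.Finite K ((LieD K).obj (m + 1) g) := fun g =>
    have := (finrank_freeOp_le K (m + 1) g).1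
    Module.Finite.equiv (freeEquiv K (m + 1) g)
  exact finrank_directSum fun g => (finrank_eq K m g).1

theorem finrank_directSum_dInfty :
    Module.finrank K (DirectSum ℤ fun g => (DInfty K).obj (m + 1) g) =
      (m + 1) * Nat.card (Plan.WithLeaves false (m + 1)) := by
  have : ∀ g, Module.Finite K ((DInfty K).obj (m + 1) g) := finite_oOperad K m
  exact finrank_directSum fun g => (finrank_eq K m g).2

end Dimension

end HigherDerived

end

theorem mainTheorem3 (K : Type u) [Field K] [CharZero K] :
    -- the normal higher derived brackets are a basis of the part of degree one
    ((∀ n : ℕ, n < 2 → Subsingleton ((HigherDerived.LieD K).obj n 1)) ∧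
      ∀ n : ℕ, LinearIndependent K (HigherDerived.normalBracket K n) ∧
        Submodule.span K (Set.range (HigherDerived.normalBracket K n)) = ⊤) ∧
    -- `Lie ⊗ D_∞` is the free operad over its part of degree one
    HigherDerived.IsFreeOperad.{u, u, u, v, 0}
      (HigherDerived.degreePart (HigherDerived.LieD K).toGradedSModule 1)
      (HigherDerived.LieD K)
      (HigherDerived.degreeIncl (HigherDerived.LieD K).toGradedSModule 1) ∧
    -- dimensions
    ∀ n : ℕ, 1 ≤ n →
      Module.finrank K (DirectSum ℤ fun g => (HigherDerived.LieD K).obj n g) =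
        n.factorial * n.smallSchroder ∧
      n.factorial * n.smallSchroder =
        (n - 1).factorial *
          Module.finrank K (DirectSum ℤ fun g => (HigherDerived.DInfty K).obj n g) := by
  refine ⟨⟨fun n hn => HigherDerived.subsingleton_degree_one K hn, fun n =>
    ⟨HigherDerived.linearIndependent_derivedBracket K n, HigherDerived.span_normalBracket n⟩⟩,
    HigherDerived.isFreeOperad_lieD K, fun n hn => ?_⟩
  obtain ⟨m, rfl⟩ := Nat.exists_eq_add_of_le' hn
  have h1 := HigherDerived.finrank_directSum_lieD K m
  have h2 := HigherDerived.finrank_directSum_dInfty K m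
  rw [HigherDerived.Plan.card_tree hn] at h1 h2
  rw [h1, h2, Nat.add_sub_cancel, Nat.factorial_succ]
  exact ⟨rfl, by ring⟩
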